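/- Let $p>2$, $m+p>3$ and $C_0,C_1>0$. There is a constant $\gamma>0$, depending only on $m,p,C_0,C_1$, with the following property. Let $N\ge 1$, let $E\subset\mathbb{R}^N$ be open, let $T_1<T_2$, and let $A:E\times(T_1,T_2)\times\mathbb{R}\times\mathbb{R}^N\to\mathbb{R}^N$ be measurable with $$A(x,t,s,\xi)\cdot\xi\ \ge\ C_0|s|^{m-1}|\xi|^p,\qquad |A(x,t,s,\xi)|\ \le\ C_1|s|^{m-1}|\xi|^{p-1}$$ for almost all $(x,t)\in E\times(T_1,T_2)$ and all $s\neq0$, $\xi\in\mathbb{R}^N$. Put $\alpha=\frac{m+p-2}{p-1}$. Let $u$ be a positive (almost everywhere) weak supersolution of $\partial_tu-\operatorname{div}A(x,t,u,Du)=0$ in $E\times(T_1,T_2)$, that is, $u\in C_{loc}(T_1,T_2;L^2_{loc}(E))$, $u^\alpha\in L^p_{loc}(T_1,T_2;W^{1,p}_{loc}(E))$, and $$-\int_{T_1}^{T_2}\!\!\int_E u\,\partial_t\eta\,dx\,dt+\int_{T_1}^{T_2}\!\!\int_E A(x,t,u,Du)\cdot D\eta\,dx\,dt\ \ge\ 0$$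 for all non-negative $\eta\in C_0^\infty(E\times(T_1,T_2))$, where $Du:=\alpha^{-1}u^{1-\alpha}D(u^\alpha)$. Let $Q$ be an open set whose closure is a compact subset of $E$, and let $T>0$ with $[0,T]\subset(T_1,T_2)$. Let $\epsilon\in(-1,0)$, let $0\le t_1<t_2\le T$, write $Q_{t_1,t_2}=Q\times(t_1,t_2)$, and let $\varphi\ge0$ be a smooth function on $Q\times[0,T]$ (smooth up to $t=0$ and $t=T$) that vanishes for $x$ outside a compact subset of $Q$. Then all the integrals in the next inequality converge absolutely, and $$\begin{aligned}\frac{1}{\epsilon(1+\epsilon)}&\int_{Q}u(\cdot,t_2)^{1+\epsilon}\varphi(\cdot,t_2)^p\,dx-\frac{1}{\epsilon(1+\epsilon)}\int_{Q}u(\cdot,t_1)^{1+\epsilon}\varphi(\cdot,t_1)^p\,dx+\frac1\gamma\iint_{Q_{t_1,t_2}}|Du|^pu^{m+\epsilon-2}\varphi^p\,dx\,dt\\&\le\ \frac{\gamma}{|\epsilon|^p}\iint_{Q_{t_1,t_2}}u^{m+p+\epsilon-2}|D\varphi|^p\,dx\,dt+\iint_{Q_{t_1,t_2}}u^{1+\epsilon}\,\frac{1}{\epsilon(1+\epsilon)}\frac{\partial\varphi^p}{\partial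 t}\,dx\,dt.\end{aligned}$$ If, in addition, $\varphi=0$ on $Q\times\{t_2\}$, then $$\begin{aligned}\frac{1}{|\epsilon(1+\epsilon)|}&\operatorname*{ess\,sup}_{t_1\le\tau\le t_2}\int_{Q}u(\cdot,\tau)^{1+\epsilon}\varphi(\cdot,\tau)^p\,dx+\iint_{Q_{t_1,t_2}}|Du|^pu^{m+\epsilon-2}\varphi^p\,dx\,dt\\&\le\ \gamma\left(\frac{1}{|\epsilon|^p}\iint_{Q_{t_1,t_2}}u^{m+p+\epsilon-2}|D\varphi|^p\,dx\,dt+\iint_{Q_{t_1,t_2}}u^{1+\epsilon}\Big(\frac{1}{\epsilon(1+\epsilon)}\frac{\partial\varphi^p}{\partial t}\Big)_+dx\,dt\right).\end{aligned}$$ -/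

import Mathlib

open MeasureTheory Set Filter Topology
open scoped ContDiff ENNReal

/-- Euclidean space `ℝ^N`; space-time points are pairs `z = (x, t)` in `Space N × ℝ`. -/
abbrev Space (N : ℕ) : Type := EuclideanSpace ℝ (Fin N)

/-- The spatial gradient `Dφ(x, t)`. -/
noncomputable def spaceGrad {N : ℕ} (φ : Space N × ℝ → ℝ) (z : Space N × ℝ) : Space N :=
  gradient (fun y => φ (y, z.2)) z.1

/-- The time derivative `∂φ/∂t (x, t)`. -/
noncomputable def timeDeriv {N : ℕ} (φ : Space N × ℝ → ℝ) (z : Space N × ℝ) : ℝ :=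
  deriv (fun s => φ (z.1, s)) z.2

/-- Test functions: `φ ∈ C₀^∞(U)` for an open set `U` of a normed space. -/
def IsTestFunction {V : Type*} [NormedAddCommGroup V] [NormedSpace ℝ V]
    (U : Set V) (φ : V → ℝ) : Prop :=
  ContDiff ℝ ∞ φ ∧ HasCompactSupport φ ∧ tsupport φ ⊆ U

/-- `g` is the weak gradient of `f` in the open set `E`. -/
def IsWeakGradient {N : ℕ} (E : Set (Space N)) (f : Space N → ℝ) (g : Space N → Space N) :
    Prop :=
  LocallyIntegrableOn f E ∧ LocallyIntegrableOn g E ∧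
    ∀ ψ : Space N → ℝ, IsTestFunction E ψ →
      ∫ x in E, f x • gradient ψ x = -∫ x in E, ψ x • g x

/-- `v ∈ L^p_loc(T₁, T₂; W^{1,p}_loc(E))`, with weak spatial gradient `Dv = G`. -/
structure MemLpLocSobolev {N : ℕ} (p : ℝ) (E : Set (Space N)) (T₁ T₂ : ℝ)
    (v : Space N × ℝ → ℝ) (G : Space N × ℝ → Space N) : Prop where
  memLp : ∀ (K : Set (Space N)) (a b : ℝ), IsCompact K → K ⊆ E → T₁ < a → b < T₂ →
    MemLp v (ENNReal.ofReal p) (volume.restrict (K ×ˢ Icc a b))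
  memLp_grad : ∀ (K : Set (Space N)) (a b : ℝ), IsCompact K → K ⊆ E → T₁ < a → b < T₂ →
    MemLp G (ENNReal.ofReal p) (volume.restrict (K ×ˢ Icc a b))
  weakGrad : ∀ᵐ t ∂(volume.restrict (Ioo T₁ T₂)),
    IsWeakGradient E (fun x => v (x, t)) (fun x => G (x, t))

/-- `u ∈ C_loc(T₁, T₂; L²_loc(E))`: every slice `u(·, t)` is in `L²(K)` for every compact `K ⊆ E`
and depends continuously on `t` in `L²(K)`. -/
structure MemContLocL2 {N : ℕ} (E : Set (Space N)) (T₁ T₂ : ℝ) (u : Space N × ℝ → ℝ) :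
    Prop where
  memLp : ∀ K : Set (Space N), IsCompact K → K ⊆ E → ∀ t ∈ Ioo T₁ T₂,
    MemLp (fun x => u (x, t)) 2 (volume.restrict K)
  tendsto : ∀ K : Set (Space N), IsCompact K → K ⊆ E → ∀ t₀ ∈ Ioo T₁ T₂,
    Tendsto (fun t => eLpNorm (fun x => u (x, t) - u (x, t₀)) 2 (volume.restrict K))
      (𝓝 t₀) (𝓝 0)

/-- `A` is measurable and satisfies, for almost all `(x, t) ∈ E × (T₁, T₂)`,
`A(x,t,s,ξ) · ξ ≥ C₀ |s|^{m-1} |ξ|^p` and `|A(x,t,s,ξ)| ≤ C₁ |s|^{m-1} |ξ|^{p-1}`.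
The value `s = 0`, where `|s|^{m-1}` need not make sense, is left out: the supersolutions
considered are positive almost everywhere. -/
structure StructureConditions {N : ℕ} (m p C₀ C₁ : ℝ) (E : Set (Space N)) (T₁ T₂ : ℝ)
    (A : Space N → ℝ → ℝ → Space N → Space N) : Prop where
  measurable : Measurable
    (fun q : Space N × ℝ × ℝ × Space N => A q.1 q.2.1 q.2.2.1 q.2.2.2)
  bounds : ∀ᵐ z : Space N × ℝ ∂(volume.restrict (E ×ˢ Ioo T₁ T₂)),
    ∀ (s : ℝ) (ξ : Space N), s ≠ 0 →
      C₀ * |s| ^ (m - 1) * ‖ξ‖ ^ p ≤ inner ℝ (A z.1 z.2 s ξ) ξ ∧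
      ‖A z.1 z.2 s ξ‖ ≤ C₁ * |s| ^ (m - 1) * ‖ξ‖ ^ (p - 1)

/-- The exponent `α = (m + p - 2) / (p - 1)`. -/
noncomputable def alphaExp (m p : ℝ) : ℝ := (m + p - 2) / (p - 1)

/-- `Du = α⁻¹ u^{1-α} D(u^α)`, where `G = D(u^α)`. -/
noncomputable def gradOf {N : ℕ} (m p : ℝ) (u : Space N × ℝ → ℝ) (G : Space N × ℝ → Space N)
    (z : Space N × ℝ) : Space N :=
  ((alphaExp m p)⁻¹ * u z ^ (1 - alphaExp m p)) • G z

/-- `u` is a positive, local weak supersolution of `∂u/∂t - div A(x,t,u,Du) = 0` in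
`E × (T₁, T₂)`, and `G` is the weak spatial gradient of `u^α`. -/
structure IsPositiveWeakSupersolution {N : ℕ} (m p : ℝ)
    (A : Space N → ℝ → ℝ → Space N → Space N) (E : Set (Space N)) (T₁ T₂ : ℝ)
    (u : Space N × ℝ → ℝ) (G : Space N × ℝ → Space N) : Prop where
  aestronglyMeasurable : AEStronglyMeasurable u (volume.restrict (E ×ˢ Ioo T₁ T₂))
  pos : ∀ᵐ z ∂(volume.restrict (E ×ˢ Ioo T₁ T₂)), 0 < u z
  continuous_time : MemContLocL2 E T₁ T₂ u
  sobolev : MemLpLocSobolev p E T₁ T₂ (fun z => u z ^ alphaExp m p) G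
  weak_ineq : ∀ φ : Space N × ℝ → ℝ, IsTestFunction (E ×ˢ Ioo T₁ T₂) φ → (∀ z, 0 ≤ φ z) →
    0 ≤ -(∫ z in E ×ˢ Ioo T₁ T₂, u z * timeDeriv φ z) +
      ∫ z in E ×ˢ Ioo T₁ T₂, inner ℝ (A z.1 z.2 (u z) (gradOf m p u G z)) (spaceGrad φ z)

/-- Non-negative `φ ∈ C₀^∞(Q × [0, T])`: `φ` is smooth up to `t = 0` and `t = T`, and vanishes
for `x` outside a compact subset of `Q`; it need not vanish at `t = 0` or `t = T`. -/
structure IsNonnegCutoff {N : ℕ} (Q : Set (Space N)) (T : ℝ) (φ : Space N × ℝ → ℝ) : Prop where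
  contDiff : ContDiff ℝ ∞ φ
  nonneg : ∀ x, ∀ t ∈ Icc 0 T, 0 ≤ φ (x, t)
  support : ∃ K : Set (Space N), IsCompact K ∧ K ⊆ Q ∧
    ∀ x ∉ K, ∀ t ∈ Icc 0 T, φ (x, t) = 0

/-- The integrand `|Du|^p u^{m+ε-2} φ^p`. -/
noncomputable def energyDensity {N : ℕ} (m p ε : ℝ) (u : Space N × ℝ → ℝ)
    (G : Space N × ℝ → Space N) (φ : Space N × ℝ → ℝ) (z : Space N × ℝ) : ℝ :=
  ‖gradOf m p u G z‖ ^ p * u z ^ (m + ε - 2) * φ z ^ p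

/-- The integrand `u^{m+p+ε-2} |Dφ|^p`. -/
noncomputable def cutoffDensity {N : ℕ} (m p ε : ℝ) (u : Space N × ℝ → ℝ)
    (φ : Space N × ℝ → ℝ) (z : Space N × ℝ) : ℝ :=
  u z ^ (m + p + ε - 2) * ‖spaceGrad φ z‖ ^ p

/-- The function `(1 / (ε (1 + ε))) ∂(φ^p)/∂t`. -/
noncomputable def timeFactor {N : ℕ} (p ε : ℝ) (φ : Space N × ℝ → ℝ) (z : Space N × ℝ) : ℝ :=
  1 / (ε * (1 + ε)) * timeDeriv (fun w => φ w ^ p) z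

/-- The integrand `u(·, t)^{1+ε} φ(·, t)^p` on a time slice. -/
noncomputable def sliceDensity {N : ℕ} (p ε : ℝ) (u φ : Space N × ℝ → ℝ) (t : ℝ)
    (x : Space N) : ℝ :=
  u (x, t) ^ (1 + ε) * φ (x, t) ^ p

/-! The weak formulation is tested with `u ^ ε φ ^ p`. The ellipticity of `A` then gives the energy
with the factor `ε < 0`, Young's inequality absorbs the cross term, and the time derivative falls on
`φ ^ p`. This is formal: `u` has no time derivative, no positive lower bound, and a gradient only
through `v = u ^ α`.

In terms of `G = Dv` the structure conditions read `|A| ≤ c₁ |G| ^ (p - 1)` and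
`A · G ≥ c₀ |G| ^ p`, without powers of `u` (`structure_bounds`), so that the flux lies in `L^{p'}`
locally (`memLp_flux`). With `κ = ε / α` the power `u ^ ε = v ^ κ` is replaced by `(v + δ) ^ κ`, a
smooth and bounded function of `v ≥ 0` (`regPower`). It is a nonincreasing function of `u`, so its
primitive `F` (`regPrimitive`) is concave.

Time is treated by differences. Test functions approximating `ψ(x) 1_{(s, t]}` turn the weak
formulation into an inequality between the slices of `u` at times `s` and `t` (`slice_inequality`).
Mollification of `v` extends it from smooth `ψ` to `ψ = (v + δ) ^ κ φ ^ p`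
(`nonneg_of_forall_testFunction`). The test function is frozen at the later time `t`, with
`s = t - h`: by concavity, `F(b) - F(a) ≥ F'(b) (b - a)`, and the difference of `u` becomes a
difference of `F(u)` (`ae_regularized_slice_inequality`). After integration in `t` and division by
`h`, the limit `h → 0` needs only the continuity of `t ↦ u(·, t)` (`tendsto_time_average`) and the
continuity of translations in `L^{p'}` for the flux (`tendsto_space_average`). This gives
`regularized_inequality`.

Young's inequality, in a form uniform in `δ` (`inner_regGrad_le`), and the limit `δ → 0`, by
dominated convergence for the slices and the cutoff terms and by Fatou's lemma for the energy, give
`energy_inequality`. Division by `-ε` is the first estimate (`energy_estimate`). For the second one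
(`sup_energy_estimate`) the first is applied on `(τ, t₂)` for every `τ`, where the slice at `t₂`
drops out. -/

/-! ### Translations and mollification in `L^p` -/

section Mollification

variable {V F : Type*} [NormedAddCommGroup V] [NormedSpace ℝ V] [FiniteDimensional ℝ V]
  [MeasurableSpace V] [BorelSpace V] [NormedAddCommGroup F] {μ : Measure V} [μ.IsAddHaarMeasure]

theorem tendsto_eLpNorm_translate {q : ℝ≥0∞} (hq1 : 1 ≤ q) (hq : q ≠ ⊤) {f : V → F}
    (hf : MemLp f q μ) :
    Tendsto (fun y => eLpNorm (fun x => f (x - y) - f x) q μ) (𝓝 0) (𝓝 0) := by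
  have : Fact (1 ≤ q) := ⟨hq1⟩
  let g : C(V, C(V, V)) := (ContinuousMap.mk (fun a : V × V => a.2 - a.1) (by fun_prop)).curry
  have hg : ∀ y, MeasurePreserving (g y) μ μ := fun y => measurePreserving_sub_right μ y
  have h1 : Tendsto (fun y => Lp.compMeasurePreserving (g y) (hg y) (hf.toLp f)) (𝓝 0)
      (𝓝 (Lp.compMeasurePreserving (g 0) (hg 0) (hf.toLp f))) :=
    (tendsto_const_nhds (x := hf.toLp f)).compMeasurePreservingLp (g.continuous.tendsto 0) hg (hg 0)
      hq
  rw [tendsto_iff_edist_tendsto_0] at h1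
  refine h1.congr fun y => ?_
  rw [Lp.toLp_compMeasurePreserving, Lp.toLp_compMeasurePreserving, Lp.edist_toLp_toLp]
  congr 1
  ext x
  simp [g]

variable [NormedSpace ℝ F] [CompleteSpace F]

/-- The mollification error is an average of translation errors, with respect to the probability
measure of density `φ.normed μ`. -/
theorem normed_convolution_sub_eq_integral (φ : ContDiffBump (0 : V)) {f : V → F}
    (hf : LocallyIntegrable f μ) (x : V) :
    (convolution (φ.normed μ) f (ContinuousLinearMap.lsmul ℝ ℝ) μ) x - f x =
      ∫ y, (f (x - y) - f x) ∂(μ.withDensity fun y => ENNReal.ofReal (φ.normed μ y)) := by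
  have hm : Measurable fun y => ENNReal.ofReal (φ.normed μ y) :=
    φ.continuous_normed.measurable.ennreal_ofReal
  rw [integral_withDensity_eq_integral_toReal_smul hm (by simp)]
  simp only [ENNReal.toReal_ofReal (φ.nonneg_normed _), smul_sub]
  have h1 : Integrable (fun y => φ.normed μ y • f (x - y)) μ :=
    (φ.hasCompactSupport_normed.convolutionExists_left (ContinuousLinearMap.lsmul ℝ ℝ)
      φ.continuous_normed hf) x
  rw [integral_sub h1 (φ.integrable_normed.smul_const (f x)), φ.integral_normed_smul]
  rfl

/-- By Jensen's inequality and Tonelli's theorem, mollification moves `f` in `L^p` no further than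
the translations by vectors in the support of the mollifier do. -/
theorem eLpNorm_normed_convolution_sub_le {p : ℝ} (hp : 1 ≤ p) (φ : ContDiffBump (0 : V))
    {f : V → F} (hf : MemLp f (ENNReal.ofReal p) μ) {δ : ℝ≥0∞}
    (hδ : ∀ y ∈ Metric.ball (0 : V) φ.rOut,
      eLpNorm (fun x => f (x - y) - f x) (ENNReal.ofReal p) μ ≤ δ) :
    eLpNorm ((convolution (φ.normed μ) f (ContinuousLinearMap.lsmul ℝ ℝ) μ) - f)
      (ENNReal.ofReal p) μ ≤ δ := by
  have hp0 : 0 < p := by linarith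
  have hq1 : (1 : ℝ≥0∞) ≤ ENNReal.ofReal p := by simpa using ENNReal.ofReal_le_ofReal hp
  have hq0 : ENNReal.ofReal p ≠ 0 := by simpa using hp0
  have hqt : (ENNReal.ofReal p).toReal = p := ENNReal.toReal_ofReal hp0.le
  have hm : Measurable fun y => ENNReal.ofReal (φ.normed μ y) :=
    φ.continuous_normed.measurable.ennreal_ofReal
  set ν := μ.withDensity fun y => ENNReal.ofReal (φ.normed μ y) with hν
  have hνμ : ν ≪ μ := withDensity_absolutelyContinuous _ _
  have : IsProbabilityMeasure ν := ⟨by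
    rw [hν, withDensity_apply _ MeasurableSet.univ, Measure.restrict_univ,
      ← ofReal_integral_eq_lintegral_ofReal φ.integrable_normed
        (Eventually.of_forall φ.nonneg_normed), φ.integral_normed, ENNReal.ofReal_one]⟩
  have hmeas : AEStronglyMeasurable (fun z : V × V => f (z.1 - z.2) - f z.1) (μ.prod ν) :=
    (hf.1.comp_quasiMeasurePreserving (quasiMeasurePreserving_sub_of_right_invariant μ ν)).sub
      (hf.1.comp_quasiMeasurePreserving Measure.quasiMeasurePreserving_fst)
  have hslice : ∀ x, AEStronglyMeasurable (fun y => f (x - y) - f x) ν := fun x =>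
    ((hf.1.comp_quasiMeasurePreserving
      (quasiMeasurePreserving_sub_left μ x)).sub
      aestronglyMeasurable_const).mono_ac hνμ
  rw [eLpNorm_eq_lintegral_rpow_enorm_toReal hq0 ENNReal.ofReal_ne_top, hqt]
  have key : ∫⁻ x, ‖((convolution (φ.normed μ) f (ContinuousLinearMap.lsmul ℝ ℝ) μ) - f) x‖ₑ ^ p ∂μ
      ≤ δ ^ p := by
    calc _ ≤ ∫⁻ x, ∫⁻ y, ‖f (x - y) - f x‖ₑ ^ p ∂ν ∂μ := by
          refine lintegral_mono fun x => ?_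
          simp only [Pi.sub_apply]
          rw [normed_convolution_sub_eq_integral φ (hf.locallyIntegrable hq1)]
          have h1 := enorm_integral_le_lintegral_enorm (μ := ν) (fun y => f (x - y) - f x)
          rw [← eLpNorm_one_eq_lintegral_enorm] at h1
          have h2 := h1.trans (eLpNorm_le_eLpNorm_of_exponent_le hq1 (hslice x))
          rw [eLpNorm_eq_lintegral_rpow_enorm_toReal hq0 ENNReal.ofReal_ne_top, hqt] at h2
          calc _ ≤ _ := ENNReal.rpow_le_rpow h2 hp0.le
            _ = _ := by rw [← ENNReal.rpow_mul, one_div_mul_cancel hp0.ne', ENNReal.rpow_one]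
      _ = ∫⁻ y, ∫⁻ x, ‖f (x - y) - f x‖ₑ ^ p ∂μ ∂ν :=
          lintegral_lintegral_swap (hmeas.enorm.pow_const p)
      _ ≤ ∫⁻ y, δ ^ p ∂ν := by
          refine lintegral_mono_ae ?_
          have : ∀ᵐ y ∂ν, y ∈ Metric.ball (0 : V) φ.rOut := by
            rw [hν, ae_withDensity_iff hm]
            refine Eventually.of_forall fun y hy => ?_
            rw [← φ.support_normed_eq (μ := μ)]
            intro h
            simp [h] at hy
          filter_upwards [this] with y hy
          have h2 := hδ y hy
          rw [eLpNorm_eq_lintegral_rpow_enorm_toReal hq0 ENNReal.ofReal_ne_top, hqt] at h2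
          calc _ = ((∫⁻ x, ‖f (x - y) - f x‖ₑ ^ p ∂μ) ^ (1 / p)) ^ p := by
                rw [← ENNReal.rpow_mul, one_div_mul_cancel hp0.ne', ENNReal.rpow_one]
            _ ≤ _ := ENNReal.rpow_le_rpow h2 hp0.le
      _ = δ ^ p := by simp
  calc _ ≤ (δ ^ p) ^ (1 / p) := ENNReal.rpow_le_rpow key (by positivity)
    _ = δ := by rw [← ENNReal.rpow_mul, mul_one_div_cancel hp0.ne', ENNReal.rpow_one]

theorem tendsto_eLpNorm_normed_convolution_sub {p : ℝ} (hp : 1 ≤ p) {ι : Type*} {l : Filter ι}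
    {φ : ι → ContDiffBump (0 : V)} (hφ : Tendsto (fun i => (φ i).rOut) l (𝓝 0))
    {f : V → F} (hf : MemLp f (ENNReal.ofReal p) μ) :
    Tendsto (fun i => eLpNorm
      ((convolution ((φ i).normed μ) f (ContinuousLinearMap.lsmul ℝ ℝ) μ) - f)
      (ENNReal.ofReal p) μ) l (𝓝 0) := by
  rw [ENNReal.tendsto_nhds_zero]
  intro δ hδ
  have hq1 : (1 : ℝ≥0∞) ≤ ENNReal.ofReal p := by simpa using ENNReal.ofReal_le_ofReal hp
  have h1 := (ENNReal.tendsto_nhds_zero.1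
    (tendsto_eLpNorm_translate hq1 ENNReal.ofReal_ne_top hf)) δ hδ
  obtain ⟨r, hr, hball⟩ := Metric.eventually_nhds_iff_ball.1 h1
  filter_upwards [hφ.eventually_lt_const hr] with i hi
  exact eLpNorm_normed_convolution_sub_le hp _ hf fun y hy =>
    hball y (Metric.ball_subset_ball hi.le hy)

end Mollification

/-! ### Smooth approximation of functions with a weak gradient -/

theorem tendsto_eLpNorm_zero_of_dominated {α F : Type*} [MeasurableSpace α] {μ : Measure α}
    [NormedAddCommGroup F] {p : ℝ} (hp : 0 < p) {f : ℕ → α → F}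
    (hf : ∀ n, AEStronglyMeasurable (f n) μ) {g : α → ℝ} (hg : MemLp g (ENNReal.ofReal p) μ)
    (hfg : ∀ n, ∀ᵐ x ∂μ, ‖f n x‖ ≤ ‖g x‖)
    (hlim : ∀ᵐ x ∂μ, Tendsto (fun n => f n x) atTop (𝓝 0)) :
    Tendsto (fun n => eLpNorm (f n) (ENNReal.ofReal p) μ) atTop (𝓝 0) := by
  have hq0 : ENNReal.ofReal p ≠ 0 := by simpa using hp
  have hqt : (ENNReal.ofReal p).toReal = p := ENNReal.toReal_ofReal hp.le
  simp only [eLpNorm_eq_lintegral_rpow_enorm_toReal hq0 ENNReal.ofReal_ne_top, hqt]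
  have h1 : Tendsto (fun n => ∫⁻ x, ‖f n x‖ₑ ^ p ∂μ) atTop (𝓝 (∫⁻ _, 0 ∂μ)) := by
    refine tendsto_lintegral_of_dominated_convergence' (fun x => ‖g x‖ₑ ^ p)
      (fun n => (hf n).enorm.pow_const p) (fun n => ?_) ?_ ?_
    · filter_upwards [hfg n] with x hx
      exact ENNReal.rpow_le_rpow (enorm_le_iff_norm_le.2 hx) hp.le
    · have := lintegral_rpow_enorm_lt_top_of_eLpNorm_lt_top hq0 ENNReal.ofReal_ne_top hg.2
      rw [hqt] at this
      exact this.ne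
    · filter_upwards [hlim] with x hx
      have := (ENNReal.continuous_rpow_const (y := p)).tendsto 0
      rw [ENNReal.zero_rpow_of_pos hp] at this
      refine this.comp ?_
      simpa using hx.enorm
  have h2 := (ENNReal.continuous_rpow_const (y := 1 / p)).tendsto 0
  rw [ENNReal.zero_rpow_of_pos (by positivity)] at h2
  rw [lintegral_zero] at h1
  exact h2.comp h1

theorem gradient_eq_zero_of_eventuallyEq {V : Type*} [NormedAddCommGroup V]
    [InnerProductSpace ℝ V] [CompleteSpace V] {f : V → ℝ} {x : V} (h : f =ᶠ[𝓝 x] fun _ => 0) :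
    gradient f x = 0 := by
  simp [gradient, h.fderiv_eq]

theorem continuous_gradient {V : Type*} [NormedAddCommGroup V]
    [InnerProductSpace ℝ V] [CompleteSpace V] {f : V → ℝ} (hf : ContDiff ℝ ∞ f) :
    Continuous (gradient f) :=
  (InnerProductSpace.toDual ℝ V).symm.continuous.comp (hf.continuous_fderiv (by simp))

/-- Mollification commutes with the weak gradient at points far from the boundary. -/
theorem hasGradientAt_normed_convolution {N : ℕ} {E K' : Set (Space N)} {v : Space N → ℝ}
    {G : Space N → Space N} (hK' : IsCompact K') (hK'E : K' ⊆ E) (hv : IsWeakGradient E v G)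
    (φ : ContDiffBump (0 : Space N)) {x : Space N} (hx : Metric.closedBall x φ.rOut ⊆ K') :
    HasGradientAt (convolution (φ.normed volume) (K'.indicator v)
        (ContinuousLinearMap.lsmul ℝ ℝ) volume)
      (convolution (φ.normed volume) (K'.indicator G)
        (ContinuousLinearMap.lsmul ℝ ℝ) volume x) x := by
  obtain ⟨hvi, hGi, hw⟩ := hv
  set ρ := φ.normed (volume : Measure (Space N)) with hρ
  have hρs : ContDiff ℝ ∞ ρ := φ.contDiff_normed
  have hv0 : LocallyIntegrable (K'.indicator v) volume :=
    ((integrable_indicator_iff hK'.measurableSet).2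
      (hvi.integrableOn_compact_subset hK'E hK')).locallyIntegrable
  have h1 := φ.hasCompactSupport_normed.hasFDerivAt_convolution_left (μ := volume)
    (ContinuousLinearMap.lsmul ℝ ℝ) (hρs.of_le (by simp)) hv0 x
  rw [hasGradientAt_iff_hasFDerivAt]
  convert! h1 using 1
  set ψ : Space N → ℝ := fun y => ρ (x - y) with hψ
  have hψs : ContDiff ℝ ∞ ψ := hρs.comp (contDiff_const.sub contDiff_id)
  have hψsupp : tsupport ψ ⊆ Metric.closedBall x φ.rOut := by
    refine closure_minimal ?_ Metric.isClosed_closedBall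
    intro y hy
    have : x - y ∈ Function.support ρ := hy
    rw [hρ, φ.support_normed_eq] at this
    rw [Metric.mem_closedBall, dist_comm, dist_eq_norm]
    exact (by simpa using this : ‖x - y‖ < φ.rOut).le
  have hψt : IsTestFunction E ψ :=
    ⟨hψs, (isCompact_closedBall x φ.rOut).of_isClosed_subset (isClosed_tsupport _) hψsupp,
      hψsupp.trans (hx.trans hK'E)⟩
  have hgψ : ∀ y, gradient ψ y = - gradient ρ (x - y) := by
    intro y
    have hd : DifferentiableAt ℝ ρ (x - y) := hρs.differentiable (by simp) _
    have : HasFDerivAt ψ ((fderiv ℝ ρ (x - y)).comp (-ContinuousLinearMap.id ℝ (Space N))) y := by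
      refine HasFDerivAt.comp y hd.hasFDerivAt ?_
      simpa using (hasFDerivAt_id y).const_sub x
    rw [gradient, this.fderiv, gradient, ← map_neg]
    congr 1
    ext e
    simp
  have hE := hw ψ hψt
  have hψ0 : ∀ y, y ∉ K' → ψ y = 0 := fun y hy =>
    image_eq_zero_of_notMem_tsupport fun h => hy (hx (hψsupp h))
  have hgψ0 : ∀ y, y ∉ K' → gradient ψ y = 0 := fun y hy =>
    gradient_eq_zero_of_eventuallyEq
      (notMem_tsupport_iff_eventuallyEq.1 fun h => hy (hx (hψsupp h)))
  have e1 : ∫ y in E, v y • gradient ψ y = ∫ y, v y • gradient ψ y :=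
    setIntegral_eq_integral_of_forall_compl_eq_zero fun y hy => by
      rw [hgψ0 y fun h => hy (hK'E h), smul_zero]
  have e2 : ∫ y in E, ψ y • G y = ∫ y, ψ y • G y :=
    setIntegral_eq_integral_of_forall_compl_eq_zero fun y hy => by
      rw [hψ0 y fun h => hy (hK'E h), zero_smul]
  have e3 : convolution (fderiv ℝ ρ) (K'.indicator v)
      (ContinuousLinearMap.precompL (Space N) (ContinuousLinearMap.lsmul ℝ ℝ)) volume x =
      InnerProductSpace.toDual ℝ (Space N) (∫ t, K'.indicator v (x - t) • gradient ρ t) := by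
    rw [convolution_def]
    refine Eq.trans ?_ (ContinuousLinearEquiv.integral_comp_comm
      (InnerProductSpace.toDual ℝ (Space N)).toContinuousLinearEquiv _)
    refine integral_congr_ae (Eventually.of_forall fun t => ?_)
    ext e
    simp [mul_comm]
  have e4 : convolution ρ (K'.indicator G) (ContinuousLinearMap.lsmul ℝ ℝ) volume x =
      ∫ t, K'.indicator v (x - t) • gradient ρ t := by
    rw [convolution_eq_swap, ← integral_sub_left_eq_self
      (fun t => K'.indicator v (x - t) • gradient ρ t) volume x]
    simp only [sub_sub_cancel, ContinuousLinearMap.lsmul_apply]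
    calc ∫ y, ρ (x - y) • K'.indicator G y = ∫ y, ψ y • G y := by
          refine integral_congr_ae (Eventually.of_forall fun y => ?_)
          by_cases hy : y ∈ K'
          · simp [hy, hψ]
          · simp [hy, hψ0 y hy]
      _ = - ∫ y, v y • gradient ψ y := by rw [← e2, ← e1, hE, neg_neg]
      _ = _ := by
          rw [← integral_neg]
          refine integral_congr_ae (Eventually.of_forall fun y => ?_)
          by_cases hy : y ∈ K'
          · simp [hy, hgψ]
          · simp [hy, hgψ0 y hy]
  rw [e3, e4]

/-- A nonnegative function with a weak gradient in `L^p` is approximated near a compact set by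
smooth nonnegative functions, almost everywhere and with `L^p`-convergence of the gradients. -/
theorem exists_smooth_approx {N : ℕ} {E K K' : Set (Space N)} {p : ℝ} (hp : 1 ≤ p)
    {v : Space N → ℝ} {G : Space N → Space N} (hK : IsCompact K) (hK' : IsCompact K')
    (hKK' : K ⊆ interior K') (hK'E : K' ⊆ E) (hv : IsWeakGradient E v G)
    (hv0 : ∀ᵐ x ∂(volume.restrict K'), 0 ≤ v x)
    (hG : MemLp G (ENNReal.ofReal p) (volume.restrict K')) :
    ∃ vk : ℕ → Space N → ℝ, (∀ k, ContDiff ℝ ∞ (vk k)) ∧ (∀ k x, 0 ≤ vk k x) ∧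
      (∀ᵐ x ∂(volume.restrict K), Tendsto (fun k => vk k x) atTop (𝓝 (v x))) ∧
      Tendsto (fun k => eLpNorm (fun x => gradient (vk k) x - G x) (ENNReal.ofReal p)
        (volume.restrict K)) atTop (𝓝 0) := by
  obtain ⟨δ, hδ, hδK⟩ := hK.exists_cthickening_subset_open isOpen_interior hKK'
  let φ : ℕ → ContDiffBump (0 : Space N) := fun k =>
    { rIn := δ / 2 * (1 / (k + 1)), rOut := δ * (1 / (k + 1)), rIn_pos := by positivity,
      rIn_lt_rOut := by
        have : 0 < 1 / ((k : ℝ) + 1) := by positivity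
        nlinarith }
  have hφ : Tendsto (fun k => (φ k).rOut) atTop (𝓝 0) := by
    simpa [φ] using tendsto_one_div_add_atTop_nhds_zero_nat.const_mul δ
  have hvi : Integrable (K'.indicator v) :=
    (integrable_indicator_iff hK'.measurableSet).2 (hv.1.integrableOn_compact_subset hK'E hK')
  have hGi : MemLp (K'.indicator G) (ENNReal.ofReal p) volume :=
    (memLp_indicator_iff_restrict hK'.measurableSet).2 hG
  have hnn : 0 ≤ᵐ[volume] K'.indicator v := by
    filter_upwards [(ae_restrict_iff' hK'.measurableSet).1 hv0] with x hx
    by_cases h : x ∈ K' <;> simp [h, hx]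
  refine ⟨fun k => convolution ((φ k).normed volume) (K'.indicator v)
    (ContinuousLinearMap.lsmul ℝ ℝ) volume, fun k => ?_, fun k x => ?_, ?_, ?_⟩
  · exact (φ k).hasCompactSupport_normed.contDiff_convolution_left _
      (φ k).contDiff_normed hvi.locallyIntegrable
  · beta_reduce
    rw [convolution_eq_swap]
    refine integral_nonneg_of_ae ?_
    filter_upwards [hnn] with y hy
    exact mul_nonneg ((φ k).nonneg_normed _) hy
  · have h1 := ContDiffBump.ae_convolution_tendsto_right_of_locallyIntegrable (K := 2) hφ
      (Eventually.of_forall fun k => by simp only [φ]; apply le_of_eq; ring)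
      hvi.locallyIntegrable
    filter_upwards [ae_restrict_of_ae h1, ae_restrict_mem hK.measurableSet] with x hx hxK
    rwa [indicator_of_mem (interior_subset (hKK' hxK))] at hx
  · have h2 := tendsto_eLpNorm_normed_convolution_sub hp hφ hGi
    refine tendsto_of_tendsto_of_tendsto_of_le_of_le tendsto_const_nhds h2 (fun _ => zero_le)
      fun k => ?_
    refine le_trans (le_of_eq ?_)
      (eLpNorm_mono_measure _ (Measure.restrict_le_self (s := K)))
    refine eLpNorm_congr_ae ?_
    filter_upwards [ae_restrict_mem hK.measurableSet] with x hxK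
    have hball : Metric.closedBall x (φ k).rOut ⊆ K' := by
      refine Subset.trans (Metric.closedBall_subset_closedBall ?_)
        ((Metric.closedBall_subset_cthickening hxK δ).trans (hδK.trans interior_subset))
      have : 1 / ((k : ℝ) + 1) ≤ 1 := by
        rw [div_le_one (by positivity)]
        linarith [(Nat.cast_nonneg k : (0 : ℝ) ≤ k)]
      simp only [φ]
      nlinarith
    rw [(hasGradientAt_normed_convolution hK' hK'E hv (φ k) hball).gradient]
    simp [indicator_of_mem (interior_subset (hKK' hxK))]

/-! ### Testing with functions of the solution -/

/-- A functional inequality valid for smooth nonnegative test functions `ψ` extends to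
`ψ = b(v) w`, where `v ≥ 0` has a weak gradient `G` in `L^p`, `b` is smooth on `[0, ∞)` with `b`
and `b'` bounded, and `w` is a bounded limit of smooth functions whose gradients converge boundedly
to `w'`. The functional `Λ` of the gradient is only required to be Lipschitz in `L^p`. -/
theorem nonneg_of_forall_testFunction {N : ℕ} {E K K' : Set (Space N)} {p M : ℝ} (hp : 1 ≤ p)
    {v : Space N → ℝ} {G : Space N → Space N} (hK : IsCompact K) (hK' : IsCompact K')
    (hKK' : K ⊆ interior K') (hK'E : K' ⊆ E) (hv : IsWeakGradient E v G)
    (hv0 : ∀ᵐ x ∂(volume.restrict K'), 0 ≤ v x)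
    (hG : MemLp G (ENNReal.ofReal p) (volume.restrict K'))
    {b : ℝ → ℝ} (hb : ∀ r, 0 ≤ r → ContDiffAt ℝ ∞ b r) (hb0 : ∀ r, 0 ≤ r → 0 ≤ b r)
    (hbM : ∀ r, 0 ≤ r → b r ≤ M) (hb'M : ∀ r, 0 ≤ r → |deriv b r| ≤ M)
    {wk : ℕ → Space N → ℝ} {w : Space N → ℝ} {w' : Space N → Space N}
    (hwk : ∀ k, ContDiff ℝ ∞ (wk k)) (hwk0 : ∀ k x, 0 ≤ wk k x) (hwkM : ∀ k x, wk k x ≤ M)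
    (hwkK : ∀ k, ∀ x ∉ K, wk k x = 0) (hwk'M : ∀ k x, ‖gradient (wk k) x‖ ≤ M)
    (hw : ∀ x, Tendsto (fun k => wk k x) atTop (𝓝 (w x)))
    (hw' : ∀ x, Tendsto (fun k => gradient (wk k) x) atTop (𝓝 (w' x)))
    {W : Space N → ℝ} (hW : IntegrableOn W K) {Λ : (Space N → Space N) → ℝ} {C : ℝ}
    (hΛ : ∀ X Y : Space N → Space N, MemLp X (ENNReal.ofReal p) (volume.restrict K) →
      MemLp Y (ENNReal.ofReal p) (volume.restrict K) →
      |Λ X - Λ Y| ≤ C * (eLpNorm (X - Y) (ENNReal.ofReal p) (volume.restrict K)).toReal)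
    (hΛ0 : ∀ ψ, IsTestFunction E ψ → (∀ x, 0 ≤ ψ x) → (∀ x ∉ K, ψ x = 0) →
      0 ≤ (∫ x in K, W x * ψ x) + Λ (gradient ψ)) :
    MemLp (fun x => (deriv b (v x) * w x) • G x + b (v x) • w' x) (ENNReal.ofReal p)
      (volume.restrict K) ∧
    0 ≤ (∫ x in K, W x * (b (v x) * w x)) +
      Λ (fun x => (deriv b (v x) * w x) • G x + b (v x) • w' x) := by
  have hp0 : 0 < p := by linarith
  have hq1 : (1 : ℝ≥0∞) ≤ ENNReal.ofReal p := by simpa using ENNReal.ofReal_le_ofReal hp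
  have hM0 : 0 ≤ M := (hwk0 0 0).trans (hwkM 0 0)
  obtain ⟨vk, hvk, hvk0, hvkv, hvkG⟩ := exists_smooth_approx hp hK hK' hKK' hK'E hv hv0 hG
  set μ : Measure (Space N) := volume.restrict K with hμ
  have : IsFiniteMeasure μ := ⟨by rw [hμ, Measure.restrict_apply_univ]; exact hK.measure_lt_top⟩
  have hKsub : K ⊆ K' := hKK'.trans interior_subset
  have hGK : MemLp G (ENNReal.ofReal p) μ := hG.mono_measure (Measure.restrict_mono_set _ hKsub)
  have hv0K : ∀ᵐ x ∂μ, 0 ≤ v x := ae_mono (Measure.restrict_mono_set _ hKsub) hv0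
  have hderiv : ∀ r, 0 ≤ r → ContinuousAt (deriv b) r := fun r hr =>
    ((hb r hr).continuousAt_fderiv (by simp)).clm_apply continuousAt_const
  -- the smooth test functions
  set ψ : ℕ → Space N → ℝ := fun k x => b (vk k x) * wk k x with hψ
  have hψs : ∀ k, ContDiff ℝ ∞ (ψ k) := fun k =>
    (contDiff_iff_contDiffAt.2 fun x => (hb _ (hvk0 k x)).comp x (hvk k).contDiffAt).mul (hwk k)
  have hψK : ∀ k, ∀ x ∉ K, ψ k x = 0 := fun k x hx => by simp [hψ, hwkK k x hx]
  have hψt : ∀ k, IsTestFunction E (ψ k) := fun k => by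
    have hsub : tsupport (ψ k) ⊆ K := closure_minimal
      (fun x hx => by_contra fun h => hx (hψK k x h)) hK.isClosed
    exact ⟨hψs k, hK.of_isClosed_subset (isClosed_tsupport _) hsub,
      hsub.trans (hKsub.trans hK'E)⟩
  have hψ0 : ∀ k x, 0 ≤ ψ k x := fun k x => mul_nonneg (hb0 _ (hvk0 k x)) (hwk0 k x)
  have hψg : ∀ k x, gradient (ψ k) x =
      (deriv b (vk k x) * wk k x) • gradient (vk k) x + b (vk k x) • gradient (wk k) x := by
    intro k x
    have h1 : HasFDerivAt (vk k) (fderiv ℝ (vk k) x) x :=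
      ((hvk k).differentiable (by simp) x).hasFDerivAt
    have h2 : HasFDerivAt (wk k) (fderiv ℝ (wk k) x) x :=
      ((hwk k).differentiable (by simp) x).hasFDerivAt
    have h3 : HasDerivAt b (deriv b (vk k x)) (vk k x) :=
      ((hb _ (hvk0 k x)).differentiableAt (by simp)).hasDerivAt
    have h4 := (h3.comp_hasFDerivAt x h1).mul h2
    have h5 : fderiv ℝ (ψ k) x = _ := h4.fderiv
    simp only [gradient, h5, map_add, map_smulₛₗ, Function.comp]
    simp [smul_smul, mul_comm, add_comm]
  set X : Space N → Space N :=
    fun x => (deriv b (v x) * w x) • G x + b (v x) • w' x with hX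
  -- almost everywhere limits of the coefficients
  have hbl : ∀ᵐ x ∂μ, Tendsto (fun k => b (vk k x)) atTop (𝓝 (b (v x))) := by
    filter_upwards [hvkv, hv0K] with x hx h0
    exact (hb _ h0).continuousAt.tendsto.comp hx
  have hdl : ∀ᵐ x ∂μ, Tendsto (fun k => deriv b (vk k x) * wk k x) atTop
      (𝓝 (deriv b (v x) * w x)) := by
    filter_upwards [hvkv, hv0K] with x hx h0
    exact ((hderiv _ h0).tendsto.comp hx).mul (hw x)
  have hdc : ∀ k, Continuous fun x => deriv b (vk k x) * wk k x := fun k =>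
    (continuous_iff_continuousAt.2 fun x => ContinuousAt.comp (g := deriv b)
      (hderiv _ (hvk0 k x)) (hvk k).continuous.continuousAt).mul (hwk k).continuous
  have hbc : ∀ k, Continuous fun x => b (vk k x) := fun k =>
    continuous_iff_continuousAt.2 fun x => ContinuousAt.comp (g := b)
      (hb _ (hvk0 k x)).continuousAt (hvk k).continuous.continuousAt
  have hwl : ∀ x, w x ≤ M := fun x => le_of_tendsto' (hw x) fun k => hwkM k x
  have hw0 : ∀ x, 0 ≤ w x := fun x => ge_of_tendsto' (hw x) fun k => hwk0 k x
  have hw'l : ∀ x, ‖w' x‖ ≤ M := fun x => le_of_tendsto' (hw' x).norm fun k => hwk'M k x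
  have hdm : AEStronglyMeasurable (fun x => deriv b (v x) * w x) μ :=
    aestronglyMeasurable_of_tendsto_ae atTop (fun k => (hdc k).aestronglyMeasurable) hdl
  have hbm : AEStronglyMeasurable (fun x => b (v x)) μ :=
    aestronglyMeasurable_of_tendsto_ae atTop (fun k => (hbc k).aestronglyMeasurable) hbl
  have hw'm : AEStronglyMeasurable w' μ :=
    aestronglyMeasurable_of_tendsto_ae atTop
      (fun k => (continuous_gradient (hwk k)).aestronglyMeasurable) (Eventually.of_forall hw')
  have hXm : AEStronglyMeasurable X μ := (hdm.smul hGK.1).add (hbm.smul hw'm)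
  have hdM : ∀ r, 0 ≤ r → ∀ s, 0 ≤ s → s ≤ M → |deriv b r * s| ≤ M * M := fun r hr s hs hsM => by
    rw [abs_mul, abs_of_nonneg hs]
    exact mul_le_mul (hb'M r hr) hsM hs hM0
  have hgψM : ∀ k, MemLp (gradient (ψ k)) (ENNReal.ofReal p) μ := fun k => by
    have hcont := continuous_gradient (hψs k)
    obtain ⟨c, hc⟩ := hK.exists_bound_of_continuousOn hcont.continuousOn
    exact MemLp.of_bound hcont.aestronglyMeasurable c
      ((ae_restrict_mem hK.measurableSet).mono fun x hx => hc x hx)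
  -- convergence of the gradients of the test functions in `L^p`
  have l1 : Tendsto (fun k => eLpNorm (fun x => (deriv b (vk k x) * wk k x) •
      (gradient (vk k) x - G x)) (ENNReal.ofReal p) μ) atTop (𝓝 0) := by
    have h0 : Tendsto (fun k => ENNReal.ofReal (M * M) *
        eLpNorm (fun x => gradient (vk k) x - G x) (ENNReal.ofReal p) μ) atTop (𝓝 0) := by
      simpa using ENNReal.Tendsto.const_mul hvkG (Or.inr ENNReal.ofReal_ne_top)
    refine tendsto_of_tendsto_of_tendsto_of_le_of_le tendsto_const_nhds h0 (fun _ => zero_le)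
      fun k => ?_
    refine eLpNorm_le_mul_eLpNorm_of_ae_le_mul (Eventually.of_forall fun x => ?_) _
    rw [norm_smul]
    exact mul_le_mul_of_nonneg_right (hdM _ (hvk0 k x) _ (hwk0 k x) (hwkM k x)) (norm_nonneg _)
  have l2 : Tendsto (fun k => eLpNorm (fun x => (deriv b (vk k x) * wk k x -
      deriv b (v x) * w x) • G x) (ENNReal.ofReal p) μ) atTop (𝓝 0) := by
    refine tendsto_eLpNorm_zero_of_dominated hp0 (g := fun x => (2 * (M * M)) * ‖G x‖)
      (fun k => (((hdc k).aestronglyMeasurable).sub hdm).smul hGK.1)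
      (hGK.norm.const_mul _) (fun k => ?_) ?_
    · filter_upwards [hv0K] with x h0
      rw [norm_smul, norm_mul, norm_norm]
      refine mul_le_mul_of_nonneg_right ?_ (norm_nonneg _)
      rw [Real.norm_of_nonneg (by positivity : 0 ≤ 2 * (M * M))]
      have h1 := hdM _ (hvk0 k x) _ (hwk0 k x) (hwkM k x)
      have h2 := hdM _ h0 _ (hw0 x) (hwl x)
      calc _ ≤ |deriv b (vk k x) * wk k x| + |deriv b (v x) * w x| := abs_sub _ _
        _ ≤ _ := by linarith
    · filter_upwards [hdl] with x hx
      have h1 : Tendsto (fun k => deriv b (vk k x) * wk k x - deriv b (v x) * w x) atTop (𝓝 0) := by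
        simpa using hx.sub_const (deriv b (v x) * w x)
      simpa using h1.smul_const (G x)
  have l3 : Tendsto (fun k => eLpNorm (fun x => b (vk k x) • gradient (wk k) x -
      b (v x) • w' x) (ENNReal.ofReal p) μ) atTop (𝓝 0) := by
    refine tendsto_eLpNorm_zero_of_dominated hp0 (g := fun _ => 2 * (M * M))
      (fun k => ((hbc k).aestronglyMeasurable.smul
        (continuous_gradient (hwk k)).aestronglyMeasurable).sub (hbm.smul hw'm))
      (memLp_const _) (fun k => ?_) ?_
    · filter_upwards [hv0K] with x h0
      rw [Real.norm_of_nonneg (by positivity : 0 ≤ 2 * (M * M))]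
      have h1 : ‖b (vk k x) • gradient (wk k) x‖ ≤ M * M := by
        rw [norm_smul, Real.norm_of_nonneg (hb0 _ (hvk0 k x))]
        exact mul_le_mul (hbM _ (hvk0 k x)) (hwk'M k x) (norm_nonneg _) hM0
      have h2 : ‖b (v x) • w' x‖ ≤ M * M := by
        rw [norm_smul, Real.norm_of_nonneg (hb0 _ h0)]
        exact mul_le_mul (hbM _ h0) (hw'l x) (norm_nonneg _) hM0
      calc _ ≤ ‖b (vk k x) • gradient (wk k) x‖ + ‖b (v x) • w' x‖ := norm_sub_le _ _
        _ ≤ _ := by linarith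
    · filter_upwards [hbl] with x hx
      simpa using (hx.smul (hw' x)).sub_const (b (v x) • w' x)
  have l4 : Tendsto (fun k => eLpNorm (gradient (ψ k) - X) (ENNReal.ofReal p) μ)
      atTop (𝓝 0) := by
    have hsum := (l1.add l2).add l3
    simp only [add_zero] at hsum
    refine tendsto_of_tendsto_of_tendsto_of_le_of_le tendsto_const_nhds hsum (fun _ => zero_le)
      fun k => ?_
    have m1 : AEStronglyMeasurable (fun x => (deriv b (vk k x) * wk k x) •
        (gradient (vk k) x - G x)) μ :=
      (hdc k).aestronglyMeasurable.smul
        ((continuous_gradient (hvk k)).aestronglyMeasurable.sub hGK.1)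
    have m2 : AEStronglyMeasurable (fun x => (deriv b (vk k x) * wk k x -
        deriv b (v x) * w x) • G x) μ := (((hdc k).aestronglyMeasurable).sub hdm).smul hGK.1
    have m3 : AEStronglyMeasurable (fun x => b (vk k x) • gradient (wk k) x -
        b (v x) • w' x) μ := ((hbc k).aestronglyMeasurable.smul
        (continuous_gradient (hwk k)).aestronglyMeasurable).sub (hbm.smul hw'm)
    refine le_trans (le_of_eq ?_) ((eLpNorm_add_le (m1.add m2) m3 hq1).trans
      (add_le_add_left (eLpNorm_add_le m1 m2 hq1) _))
    congr 1
    ext1 x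
    simp only [Pi.sub_apply, Pi.add_apply, hψg, hX]
    module
  have hXL : MemLp X (ENNReal.ofReal p) μ := by
    obtain ⟨k, hk⟩ := (l4.eventually_lt_const (by norm_num : (0 : ℝ≥0∞) < 1)).exists
    have h1 : MemLp (gradient (ψ k) - X) (ENNReal.ofReal p) μ :=
      ⟨(hgψM k).1.sub hXm, hk.trans ENNReal.one_lt_top⟩
    simpa using (hgψM k).sub h1
  refine ⟨hXL, ?_⟩
  have t1 : Tendsto (fun k => Λ (gradient (ψ k))) atTop (𝓝 (Λ X)) := by
    rw [tendsto_iff_norm_sub_tendsto_zero]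
    have h0 := ((ENNReal.tendsto_toReal ENNReal.zero_ne_top).comp l4).const_mul C
    simp only [ENNReal.toReal_zero, mul_zero] at h0
    exact tendsto_of_tendsto_of_tendsto_of_le_of_le tendsto_const_nhds h0
      (fun _ => norm_nonneg _) fun k => hΛ _ _ (hgψM k) hXL
  have t2 : Tendsto (fun k => ∫ x, W x * ψ k x ∂μ) atTop (𝓝 (∫ x, W x * (b (v x) * w x) ∂μ)) := by
    refine tendsto_integral_of_dominated_convergence (fun x => ‖W x‖ * (M * M))
      (fun k => hW.1.mul (hψs k).continuous.aestronglyMeasurable)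
      (hW.norm.mul_const _) (fun k => Eventually.of_forall fun x => ?_) ?_
    · rw [norm_mul, Real.norm_of_nonneg (hψ0 k x)]
      exact mul_le_mul_of_nonneg_left
        (mul_le_mul (hbM _ (hvk0 k x)) (hwkM k x) (hwk0 k x) hM0) (norm_nonneg _)
    · filter_upwards [hbl] with x hx
      exact (hx.mul (hw x)).const_mul _
  exact ge_of_tendsto' (t2.add t1) fun k => hΛ0 _ (hψt k) (hψ0 k) (hψK k)

/-! ### Time continuity of the slices -/

section Slices

variable {N : ℕ} {E K : Set (Space N)} {T₁ T₂ : ℝ} {u : Space N × ℝ → ℝ}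

theorem MemContLocL2.integrableOn_slice (hu : MemContLocL2 E T₁ T₂ u) (hK : IsCompact K)
    (hKE : K ⊆ E) {t : ℝ} (ht : t ∈ Ioo T₁ T₂) : IntegrableOn (fun x => u (x, t)) K := by
  have : IsFiniteMeasure (volume.restrict K) :=
    ⟨by rw [Measure.restrict_apply_univ]; exact hK.measure_lt_top⟩
  exact (hu.memLp K hK hKE t ht).integrable (by norm_num)

theorem MemContLocL2.tendsto_integral_abs_sub (hu : MemContLocL2 E T₁ T₂ u) (hK : IsCompact K)
    (hKE : K ⊆ E) {t₀ : ℝ} (ht₀ : t₀ ∈ Ioo T₁ T₂) :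
    Tendsto (fun t => ∫ x in K, |u (x, t) - u (x, t₀)|) (𝓝 t₀) (𝓝 0) := by
  have : IsFiniteMeasure (volume.restrict K) :=
    ⟨by rw [Measure.restrict_apply_univ]; exact hK.measure_lt_top⟩
  have h1 := hu.tendsto K hK hKE t₀ ht₀
  have h2 : Tendsto (fun t => eLpNorm (fun x => u (x, t) - u (x, t₀)) 1 (volume.restrict K))
      (𝓝 t₀) (𝓝 0) := by
    have h3 := ENNReal.Tendsto.mul_const (b := (volume.restrict K) univ ^
      (1 / (1 : ℝ≥0∞).toReal - 1 / (2 : ℝ≥0∞).toReal)) h1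
      (Or.inr (ENNReal.rpow_ne_top_of_nonneg (by norm_num) (measure_ne_top _ _)))
    rw [zero_mul] at h3
    refine tendsto_of_tendsto_of_tendsto_of_le_of_le' tendsto_const_nhds h3
      (Eventually.of_forall fun _ => zero_le) ?_
    filter_upwards [isOpen_Ioo.mem_nhds ht₀] with t ht
    exact eLpNorm_le_eLpNorm_mul_rpow_measure_univ (by norm_num)
      ((hu.memLp K hK hKE t ht).1.sub (hu.memLp K hK hKE t₀ ht₀).1)
  refine ((ENNReal.tendsto_toReal ENNReal.zero_ne_top).comp h2).congr' ?_
  filter_upwards [isOpen_Ioo.mem_nhds ht₀] with t ht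
  have := integral_norm_eq_lintegral_enorm
    ((hu.memLp K hK hKE t ht).1.sub (hu.memLp K hK hKE t₀ ht₀).1)
  simp only [Pi.sub_apply, Real.norm_eq_abs] at this
  rw [this, Function.comp, eLpNorm_one_eq_lintegral_enorm]

theorem MemContLocL2.integrableOn_comp_slice (hu : MemContLocL2 E T₁ T₂ u) (hK : IsCompact K)
    (hKE : K ⊆ E) {L : NNReal} {F : ℝ → ℝ} (hF : LipschitzWith L F) {t : ℝ}
    (ht : t ∈ Ioo T₁ T₂) : IntegrableOn (fun x => F (u (x, t))) K := by
  have hi := hu.integrableOn_slice hK hKE ht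
  have : IsFiniteMeasure (volume.restrict K) :=
    ⟨by rw [Measure.restrict_apply_univ]; exact hK.measure_lt_top⟩
  refine Integrable.mono' (g := fun x => ‖F 0‖ + L * |u (x, t)|)
    ((integrable_const _).add (hi.abs.const_mul _))
    (hF.continuous.comp_aestronglyMeasurable hi.1) (Eventually.of_forall fun x => ?_)
  have h1 := hF.dist_le_mul (u (x, t)) 0
  rw [Real.dist_eq, Real.dist_eq, sub_zero] at h1
  calc ‖F (u (x, t))‖ = ‖F 0 + (F (u (x, t)) - F 0)‖ := by ring_nf
    _ ≤ ‖F 0‖ + ‖F (u (x, t)) - F 0‖ := norm_add_le _ _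
    _ ≤ _ := by simpa using h1

/-- Time continuity of the weighted integrals of a Lipschitz function of the solution. -/
theorem MemContLocL2.continuousOn_integral (hu : MemContLocL2 E T₁ T₂ u) (hK : IsCompact K)
    (hKE : K ⊆ E) {L : NNReal} {F : ℝ → ℝ} (hF : LipschitzWith L F) {θ : Space N → ℝ} {M : ℝ}
    (hθ : AEStronglyMeasurable θ (volume.restrict K)) (hθM : ∀ x, |θ x| ≤ M) :
    ContinuousOn (fun t => ∫ x in K, F (u (x, t)) * θ x) (Ioo T₁ T₂) := by
  intro t₀ ht₀
  refine ContinuousAt.continuousWithinAt ?_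
  rw [ContinuousAt, tendsto_iff_norm_sub_tendsto_zero]
  have h1 := (hu.tendsto_integral_abs_sub hK hKE ht₀).const_mul (L * M : ℝ)
  rw [mul_zero] at h1
  refine tendsto_of_tendsto_of_tendsto_of_le_of_le' tendsto_const_nhds h1
    (Eventually.of_forall fun _ => norm_nonneg _) ?_
  filter_upwards [isOpen_Ioo.mem_nhds ht₀] with t ht
  have hi : ∀ s ∈ Ioo T₁ T₂, IntegrableOn (fun x => F (u (x, s)) * θ x) K := fun s hs =>
    (hu.integrableOn_comp_slice hK hKE hF hs).mul_bdd (c := M) hθ (Eventually.of_forall hθM)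
  rw [← integral_sub (hi t ht) (hi t₀ ht₀), ← integral_const_mul]
  refine (norm_integral_le_integral_norm _).trans (integral_mono_of_nonneg
    (Eventually.of_forall fun _ => norm_nonneg _) ?_ (Eventually.of_forall fun x => ?_))
  · exact (((hu.integrableOn_slice hK hKE ht).sub
      (hu.integrableOn_slice hK hKE ht₀)).abs).const_mul _
  · simp only [Real.norm_eq_abs, ← sub_mul, abs_mul]
    have h2 := hF.dist_le_mul (u (x, t)) (u (x, t₀))
    rw [Real.dist_eq, Real.dist_eq] at h2
    calc _ ≤ (L * |u (x, t) - u (x, t₀)|) * M :=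
          mul_le_mul h2 (hθM x) (abs_nonneg _) (by positivity)
      _ = _ := by ring

theorem MemContLocL2.integrableOn_prod (hu : MemContLocL2 E T₁ T₂ u)
    (hum : AEStronglyMeasurable u (volume.restrict (E ×ˢ Ioo T₁ T₂))) (hK : IsCompact K)
    (hKE : K ⊆ E) {a b : ℝ} (ha : T₁ < a) (hb : b < T₂) : IntegrableOn u (K ×ˢ Icc a b) := by
  have hsub : Icc a b ⊆ Ioo T₁ T₂ := fun t ht => ⟨ha.trans_le ht.1, ht.2.trans_lt hb⟩
  have hm : AEStronglyMeasurable u ((volume.restrict K).prod (volume.restrict (Icc a b))) := by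
    rw [Measure.prod_restrict, ← Measure.volume_eq_prod]
    exact hum.mono_measure (Measure.restrict_mono_set _ (prod_mono hKE hsub))
  rw [IntegrableOn, Measure.volume_eq_prod, ← Measure.prod_restrict, integrable_prod_iff' hm]
  refine ⟨(ae_restrict_mem measurableSet_Icc).mono fun t ht =>
    hu.integrableOn_slice hK hKE (hsub ht), ?_⟩
  have hc : ContinuousOn (fun t => ∫ x in K, ‖u (x, t)‖) (Icc a b) := by
    have := hu.continuousOn_integral hK hKE lipschitzWith_one_norm (θ := fun _ => 1) (M := 1)
      aestronglyMeasurable_const (by simp)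
    simp only [mul_one] at this
    exact this.mono hsub
  exact hc.integrableOn_Icc

theorem MemContLocL2.integrableOn_comp_prod (hu : MemContLocL2 E T₁ T₂ u)
    (hum : AEStronglyMeasurable u (volume.restrict (E ×ˢ Ioo T₁ T₂))) (hK : IsCompact K)
    (hKE : K ⊆ E) {L : NNReal} {F : ℝ → ℝ} (hF : LipschitzWith L F) {a b : ℝ} (ha : T₁ < a)
    (hb : b < T₂) : IntegrableOn (fun z => F (u z)) (K ×ˢ Icc a b) := by
  have hi := hu.integrableOn_prod hum hK hKE ha hb
  have : IsFiniteMeasure ((volume : Measure (Space N × ℝ)).restrict (K ×ˢ Icc a b)) :=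
    ⟨by rw [Measure.restrict_apply_univ]; exact (hK.prod isCompact_Icc).measure_lt_top⟩
  refine Integrable.mono' (g := fun z => ‖F 0‖ + L * |u z|)
    ((integrable_const _).add (hi.abs.const_mul _))
    (hF.continuous.comp_aestronglyMeasurable hi.1) (Eventually.of_forall fun z => ?_)
  have h1 := hF.dist_le_mul (u z) 0
  rw [Real.dist_eq, Real.dist_eq, sub_zero] at h1
  calc ‖F (u z)‖ = ‖F 0 + (F (u z) - F 0)‖ := by ring_nf
    _ ≤ ‖F 0‖ + ‖F (u z) - F 0‖ := norm_add_le _ _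
    _ ≤ _ := by simpa using h1

end Slices

/-! ### The inequality between two time slices -/

/-- The primitive of a bump function, a smooth approximation of the Heaviside function. -/
noncomputable def bumpPrimitive (φ : ContDiffBump (0 : ℝ)) (τ : ℝ) : ℝ :=
  ∫ x in (-φ.rOut)..τ, φ.normed volume x

section BumpPrimitive

variable (φ : ContDiffBump (0 : ℝ))

theorem hasDerivAt_bumpPrimitive (τ : ℝ) :
    HasDerivAt (bumpPrimitive φ) (φ.normed volume τ) τ :=
  (φ.continuous_normed.integral_hasStrictDerivAt _ τ).hasDerivAt

theorem contDiff_bumpPrimitive : ContDiff ℝ ∞ (bumpPrimitive φ) := by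
  refine contDiff_infty_iff_deriv.2
    ⟨fun τ => (hasDerivAt_bumpPrimitive φ τ).differentiableAt, ?_⟩
  rw [funext fun τ => (hasDerivAt_bumpPrimitive φ τ).deriv]
  exact φ.contDiff_normed

theorem monotone_bumpPrimitive : Monotone (bumpPrimitive φ) :=
  monotone_of_deriv_nonneg (fun τ => (hasDerivAt_bumpPrimitive φ τ).differentiableAt) fun τ => by
    rw [(hasDerivAt_bumpPrimitive φ τ).deriv]
    exact φ.nonneg_normed τ

theorem bumpPrimitive_of_le {τ : ℝ} (h : τ ≤ -φ.rOut) : bumpPrimitive φ τ = 0 := by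
  refine intervalIntegral.integral_zero_ae (Eventually.of_forall fun x hx => ?_)
  rw [uIoc_of_ge h] at hx
  have : x ∉ Function.support (φ.normed volume) := by
    rw [φ.support_normed_eq, Metric.mem_ball, dist_zero_right, Real.norm_eq_abs, abs_lt]
    intro h1
    linarith [hx.2, h1.1]
  simpa using this

theorem bumpPrimitive_of_ge {τ : ℝ} (h : φ.rOut ≤ τ) : bumpPrimitive φ τ = 1 := by
  rw [bumpPrimitive, intervalIntegral.integral_eq_integral_of_support_subset, φ.integral_normed]
  rw [φ.support_normed_eq]
  intro x hx
  rw [Metric.mem_ball, dist_zero_right, Real.norm_eq_abs, abs_lt] at hx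
  exact ⟨hx.1, hx.2.le.trans h⟩

theorem bumpPrimitive_nonneg (τ : ℝ) : 0 ≤ bumpPrimitive φ τ := by
  rw [← bumpPrimitive_of_le φ (min_le_right τ _)]
  exact monotone_bumpPrimitive φ (min_le_left _ _)

theorem bumpPrimitive_le_one (τ : ℝ) : bumpPrimitive φ τ ≤ 1 := by
  rw [← bumpPrimitive_of_ge φ (le_max_right τ _)]
  exact monotone_bumpPrimitive φ (le_max_left _ _)

end BumpPrimitive

/-- The bumps form an approximate identity at interior points of continuity. -/
theorem tendsto_integral_bump_mul {φ : ℕ → ContDiffBump (0 : ℝ)}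
    (hφ : Tendsto (fun k => (φ k).rOut) atTop (𝓝 0)) {U : ℝ → ℝ} {a b t : ℝ}
    (hU : ContinuousOn U (Icc a b)) (ht : t ∈ Ioo a b) :
    Tendsto (fun k => ∫ τ in Icc a b, (φ k).normed volume (τ - t) * U τ) atTop (𝓝 (U t)) := by
  have h := ContDiffBump.convolution_tendsto_right (μ := (volume : Measure ℝ))
    (g := fun _ => (Icc a b).indicator U) (k := fun _ => t) (x₀ := t) (z₀ := U t) hφ
    (Eventually.of_forall fun _ => (aestronglyMeasurable_indicator_iff measurableSet_Icc).2
      (hU.aestronglyMeasurable measurableSet_Icc)) ?_ tendsto_const_nhds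
  · refine h.congr fun k => ?_
    rw [convolution_eq_swap, ← integral_indicator measurableSet_Icc]
    refine integral_congr_ae (Eventually.of_forall fun τ => ?_)
    by_cases hτ : τ ∈ Icc a b
    · simp only [hτ, indicator_of_mem, ContinuousLinearMap.lsmul_apply, smul_eq_mul]
      rw [← (φ k).normed_neg, neg_sub]
    · simp [hτ]
  · have hc : ContinuousAt ((Icc a b).indicator U) t := by
      refine ((hU.continuousAt (Icc_mem_nhds ht.1 ht.2))).congr ?_
      filter_upwards [Icc_mem_nhds ht.1 ht.2] with τ hτ
      rw [indicator_of_mem hτ]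
    have h2 := hc.tendsto
    rw [indicator_of_mem (Ioo_subset_Icc_self ht)] at h2
    exact h2.comp tendsto_snd

theorem gradient_eq_zero_of_notMem {N : ℕ} {K : Set (Space N)} (hK : IsClosed K)
    {ψ : Space N → ℝ} (h : ∀ x ∉ K, ψ x = 0) {x : Space N} (hx : x ∉ K) : gradient ψ x = 0 :=
  gradient_eq_zero_of_eventuallyEq <| by
    filter_upwards [hK.isOpen_compl.mem_nhds hx] with y hy using h y hy

/-- The distributional inequality, tested with `ψ(x)` times an approximation of the indicator of
`(s, t]`, gives an inequality between the slices at times `s` and `t`. -/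
theorem slice_inequality {N : ℕ} {E K : Set (Space N)} {T₁ T₂ : ℝ} {u : Space N × ℝ → ℝ}
    {B : Space N × ℝ → Space N} (hu : MemContLocL2 E T₁ T₂ u)
    (hum : AEStronglyMeasurable u (volume.restrict (E ×ˢ Ioo T₁ T₂)))
    (hK : IsCompact K) (hKE : K ⊆ E)
    (hB : ∀ a b, T₁ < a → b < T₂ → IntegrableOn B (K ×ˢ Icc a b))
    (hweak : ∀ φ : Space N × ℝ → ℝ, IsTestFunction (E ×ˢ Ioo T₁ T₂) φ → (∀ z, 0 ≤ φ z) →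
      0 ≤ -(∫ z in E ×ˢ Ioo T₁ T₂, u z * timeDeriv φ z) +
        ∫ z in E ×ˢ Ioo T₁ T₂, inner ℝ (B z) (spaceGrad φ z))
    {ψ : Space N → ℝ} (hψ : IsTestFunction E ψ) (hψ0 : ∀ x, 0 ≤ ψ x) (hψK : ∀ x ∉ K, ψ x = 0)
    {s t : ℝ} (hs : T₁ < s) (hst : s ≤ t) (ht : t < T₂) :
    0 ≤ (∫ x in K, (u (x, t) - u (x, s)) * ψ x) +
      ∫ z in K ×ˢ Ioc s t, inner ℝ (B z) (gradient ψ z.1) := by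
  -- the smoothing radius `c` keeps the test functions supported inside `(T₁, T₂)`
  set c : ℝ := min (s - T₁) (T₂ - t) / 2 with hc
  have hcs : c < s - T₁ := by
    have := min_le_left (s - T₁) (T₂ - t)
    have h2 : 0 < min (s - T₁) (T₂ - t) := lt_min (by linarith) (by linarith)
    linarith
  have hct : c < T₂ - t := by
    have := min_le_right (s - T₁) (T₂ - t)
    have h2 : 0 < min (s - T₁) (T₂ - t) := lt_min (by linarith) (by linarith)
    linarith
  have hc0 : 0 < c := by
    have h2 : 0 < min (s - T₁) (T₂ - t) := lt_min (by linarith) (by linarith)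
    linarith
  let φ : ℕ → ContDiffBump (0 : ℝ) := fun k =>
    { rIn := c / 2 * (1 / (k + 1)), rOut := c * (1 / (k + 1)), rIn_pos := by positivity,
      rIn_lt_rOut := by
        have : 0 < 1 / ((k : ℝ) + 1) := by positivity
        nlinarith }
  have hφ : Tendsto (fun k => (φ k).rOut) atTop (𝓝 0) := by
    simpa [φ] using tendsto_one_div_add_atTop_nhds_zero_nat.const_mul c
  have hφc : ∀ k, (φ k).rOut ≤ c := fun k => by
    have : 1 / ((k : ℝ) + 1) ≤ 1 := by
      rw [div_le_one (by positivity)]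
      linarith [(Nat.cast_nonneg k : (0 : ℝ) ≤ k)]
    simp only [φ]
    nlinarith
  set a := s - c with ha
  set b := t + c with hb
  have haT : T₁ < a := by linarith
  have hbT : b < T₂ := by linarith
  have hsub : Icc a b ⊆ Ioo T₁ T₂ := fun τ hτ => ⟨haT.trans_le hτ.1, hτ.2.trans_lt hbT⟩
  have hψc := hψ.1.continuous
  have hgψc := continuous_gradient hψ.1
  have hgψ0 : ∀ x ∉ K, gradient ψ x = 0 := fun x hx => gradient_eq_zero_of_notMem hK.isClosed hψK hx
  obtain ⟨M, hM⟩ := hK.exists_bound_of_continuousOn hψc.continuousOn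
  obtain ⟨M', hM'⟩ := hK.exists_bound_of_continuousOn hgψc.continuousOn
  have hM0 : ∀ x, |ψ x| ≤ max M 0 := fun x => by
    by_cases hx : x ∈ K
    · exact (hM x hx).trans (le_max_left _ _)
    · simp [hψK x hx]
  -- the cutoffs in time
  set η : ℕ → ℝ → ℝ := fun k τ => bumpPrimitive (φ k) (τ - s) - bumpPrimitive (φ k) (τ - t) with hη
  have hη' : ∀ k τ, HasDerivAt (η k)
      ((φ k).normed volume (τ - s) - (φ k).normed volume (τ - t)) τ := fun k τ =>
    ((hasDerivAt_bumpPrimitive (φ k) _).comp_sub_const τ s).sub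
      ((hasDerivAt_bumpPrimitive (φ k) _).comp_sub_const τ t)
  have hηs : ∀ k, ContDiff ℝ ∞ (η k) := fun k =>
    ((contDiff_bumpPrimitive (φ k)).comp (contDiff_id.sub contDiff_const)).sub
      ((contDiff_bumpPrimitive (φ k)).comp (contDiff_id.sub contDiff_const))
  have hη0 : ∀ k τ, 0 ≤ η k τ := fun k τ =>
    sub_nonneg.2 (monotone_bumpPrimitive (φ k) (by linarith))
  have hη1 : ∀ k τ, η k τ ≤ 1 := fun k τ => by
    have h1 := bumpPrimitive_le_one (φ k) (τ - s)
    have h2 := bumpPrimitive_nonneg (φ k) (τ - t)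
    simp only [hη]
    linarith
  have hηsupp : ∀ k, ∀ τ ∉ Icc a b, η k τ = 0 := fun k τ hτ => by
    have := hφc k
    by_cases h : τ < a
    · simp only [hη]
      rw [bumpPrimitive_of_le _ (by linarith), bumpPrimitive_of_le _ (by linarith), sub_zero]
    · have h' : b < τ := by
        by_contra h2
        exact hτ ⟨not_lt.1 h, not_lt.1 h2⟩
      simp only [hη]
      rw [bumpPrimitive_of_ge _ (by linarith), bumpPrimitive_of_ge _ (by linarith), sub_self]
  have hη'supp : ∀ k, ∀ τ ∉ Icc a b,
      (φ k).normed volume (τ - s) - (φ k).normed volume (τ - t) = 0 := fun k τ hτ => by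
    rw [← (hη' k τ).deriv]
    have : η k =ᶠ[𝓝 τ] fun _ => 0 := by
      filter_upwards [isClosed_Icc.isOpen_compl.mem_nhds hτ] with σ hσ using hηsupp k σ hσ
    rw [this.deriv_eq, deriv_const]
  have hηlim : ∀ τ, τ ≠ s → τ ≠ t → Tendsto (fun k => η k τ) atTop
      (𝓝 ((Ioc s t).indicator (fun _ => 1) τ)) := by
    intro τ h1 h2
    refine tendsto_const_nhds.congr' ?_
    have hd : 0 < min |τ - s| |τ - t| :=
      lt_min (abs_pos.2 (sub_ne_zero.2 h1)) (abs_pos.2 (sub_ne_zero.2 h2))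
    filter_upwards [hφ.eventually_lt_const hd] with k hk
    have k1 := hk.trans_le (min_le_left _ _)
    have k2 := hk.trans_le (min_le_right _ _)
    simp only [hη]
    rcases lt_or_gt_of_ne h1 with h1 | h1
    · rw [abs_of_neg (by linarith)] at k1 k2
      rw [indicator_of_notMem (fun h => by linarith [h.1]), bumpPrimitive_of_le _ (by linarith),
        bumpPrimitive_of_le _ (by linarith), sub_zero]
    · rcases lt_or_gt_of_ne h2 with h2 | h2
      · rw [abs_of_pos (by linarith)] at k1
        rw [abs_of_neg (by linarith)] at k2
        rw [indicator_of_mem (show τ ∈ Ioc s t from ⟨h1, h2.le⟩),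
          bumpPrimitive_of_ge _ (by linarith), bumpPrimitive_of_le _ (by linarith), sub_zero]
      · rw [abs_of_pos (by linarith)] at k1 k2
        rw [indicator_of_notMem (fun h => by linarith [h.2]), bumpPrimitive_of_ge _ (by linarith),
          bumpPrimitive_of_ge _ (by linarith), sub_self]
  -- the space-time test functions `ψ(x) η(t)`
  set Φ : ℕ → Space N × ℝ → ℝ := fun k z => ψ z.1 * η k z.2 with hΦ
  have hΦt : ∀ k, IsTestFunction (E ×ˢ Ioo T₁ T₂) (Φ k) := fun k => by
    have hsub2 : tsupport (Φ k) ⊆ K ×ˢ Icc a b := by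
      refine closure_minimal (fun z hz => by_contra fun h => hz ?_)
        (hK.isClosed.prod isClosed_Icc)
      by_cases h1 : z.1 ∈ K
      · simp [hΦ, hηsupp k z.2 fun h2 => h ⟨h1, h2⟩]
      · simp [hΦ, hψK _ h1]
    exact ⟨(hψ.1.comp contDiff_fst).mul ((hηs k).comp contDiff_snd),
      (hK.prod isCompact_Icc).of_isClosed_subset (isClosed_tsupport _) hsub2,
      hsub2.trans (prod_mono hKE hsub)⟩
  have hΦd : ∀ k z, timeDeriv (Φ k) z =
      ψ z.1 * ((φ k).normed volume (z.2 - s) - (φ k).normed volume (z.2 - t)) := fun k z =>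
    ((hη' k z.2).const_mul (ψ z.1)).deriv
  have hΦg : ∀ k z, spaceGrad (Φ k) z = η k z.2 • gradient ψ z.1 := fun k z => by
    have h1 : HasFDerivAt (fun y => ψ y * η k z.2) (η k z.2 • fderiv ℝ ψ z.1) z.1 :=
      (hψ.1.differentiable (by simp) z.1).hasFDerivAt.mul_const (η k z.2)
    simp only [spaceGrad, hΦ, gradient]
    rw [h1.fderiv]
    simp
  -- the two limits
  have hui := hu.integrableOn_prod hum hK hKE haT hbT
  set U : ℝ → ℝ := fun τ => ∫ x in K, u (x, τ) * ψ x with hU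
  have hUc : ContinuousOn U (Icc a b) :=
    (hu.continuousOn_integral hK hKE (LipschitzWith.id) hψc.aestronglyMeasurable hM0).mono hsub
  have lim1 : Tendsto (fun k => -∫ z in E ×ˢ Ioo T₁ T₂, u z * timeDeriv (Φ k) z) atTop
      (𝓝 (U t - U s)) := by
    have l1 := (tendsto_integral_bump_mul hφ hUc (t := t) ⟨by linarith, by linarith⟩).sub
      (tendsto_integral_bump_mul hφ hUc (t := s) ⟨by linarith, by linarith⟩)
    refine l1.congr fun k => ?_
    have hbump : ∀ r, Continuous fun τ : ℝ => (φ k).normed volume (τ - r) := fun r =>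
      (φ k).continuous_normed.comp (continuous_id.sub continuous_const)
    have hint : ∀ r, IntegrableOn (fun τ => (φ k).normed volume (τ - r) * U τ) (Icc a b) :=
      fun r => ((hbump r).continuousOn.mul hUc).integrableOn_Icc
    have e1 : ∫ z in E ×ˢ Ioo T₁ T₂, u z * timeDeriv (Φ k) z =
        ∫ z in K ×ˢ Icc a b, u z * timeDeriv (Φ k) z := by
      have hz : ∀ z ∉ K ×ˢ Icc a b, u z * timeDeriv (Φ k) z = 0 := fun z hz => by
        rw [hΦd]
        by_cases h1 : z.1 ∈ K
        · rw [hη'supp k z.2 fun h2 => hz ⟨h1, h2⟩, mul_zero, mul_zero]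
        · rw [hψK _ h1, zero_mul, mul_zero]
      rw [setIntegral_eq_integral_of_forall_compl_eq_zero hz,
        setIntegral_eq_integral_of_forall_compl_eq_zero
          fun z h => hz z fun h2 => h (prod_mono hKE hsub h2)]
    have hi2 : IntegrableOn (fun z => u z * timeDeriv (Φ k) z) (K ×ˢ Icc a b) := by
      simp only [hΦd]
      have hcont : Continuous fun z : Space N × ℝ => ψ z.1 *
          ((φ k).normed volume (z.2 - s) - (φ k).normed volume (z.2 - t)) :=
        (hψc.comp continuous_fst).mul
          (((hbump s).comp continuous_snd).sub ((hbump t).comp continuous_snd))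
      exact hui.mul_continuousOn hcont.continuousOn (hK.prod isCompact_Icc)
    rw [e1, Measure.volume_eq_prod, ← Measure.prod_restrict, integral_prod_symm _
      (by rw [Measure.prod_restrict, ← Measure.volume_eq_prod]; exact hi2),
      ← integral_sub (hint t) (hint s), ← integral_neg]
    refine integral_congr_ae (Eventually.of_forall fun τ => ?_)
    simp only [hΦd, hU]
    rw [← sub_mul, ← integral_const_mul, ← integral_neg]
    refine integral_congr_ae (Eventually.of_forall fun x => ?_)
    simp only
    ring
  have lim2 : Tendsto (fun k => ∫ z in E ×ˢ Ioo T₁ T₂, inner ℝ (B z) (spaceGrad (Φ k) z)) atTop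
      (𝓝 (∫ z in K ×ˢ Ioc s t, inner ℝ (B z) (gradient ψ z.1))) := by
    have hBi := hB a b haT hbT
    have hgi : IntegrableOn (fun z : Space N × ℝ => inner ℝ (B z) (gradient ψ z.1))
        (K ×ˢ Icc a b) := by
      refine Integrable.mono' (hBi.norm.mul_const M')
        (hBi.1.inner (hgψc.comp continuous_fst).aestronglyMeasurable) ?_
      filter_upwards [ae_restrict_mem (hK.measurableSet.prod measurableSet_Icc)] with z hz
      exact (norm_inner_le_norm _ _).trans
        (mul_le_mul_of_nonneg_left (hM' _ hz.1) (norm_nonneg _))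
    have e0 : ∫ z in K ×ˢ Ioc s t, inner ℝ (B z) (gradient ψ z.1) = ∫ z in K ×ˢ Icc a b,
        (Ioc s t).indicator (fun _ => (1 : ℝ)) z.2 * inner ℝ (B z) (gradient ψ z.1) := by
      have h1 : K ×ˢ Ioc s t = (K ×ˢ Icc a b) ∩ (Prod.snd ⁻¹' Ioc s t) := by
        ext z
        simp only [mem_prod, mem_inter_iff, mem_preimage, mem_Icc, mem_Ioc]
        constructor
        · rintro ⟨h1, h2, h3⟩
          exact ⟨⟨h1, by linarith, by linarith⟩, h2, h3⟩
        · rintro ⟨⟨h1, -⟩, h2⟩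
          exact ⟨h1, h2⟩
      rw [h1, ← setIntegral_indicator (measurable_snd measurableSet_Ioc)]
      refine integral_congr_ae (Eventually.of_forall fun z => ?_)
      by_cases hz : z.2 ∈ Ioc s t
      · simp [hz, indicator, -mem_Ioc]
      · simp [hz, indicator, -mem_Ioc]
    have e1 : ∀ k, ∫ z in E ×ˢ Ioo T₁ T₂, inner ℝ (B z) (spaceGrad (Φ k) z) =
        ∫ z in K ×ˢ Icc a b, η k z.2 * inner ℝ (B z) (gradient ψ z.1) := fun k => by
      simp only [hΦg, inner_smul_right]
      have hz : ∀ z ∉ K ×ˢ Icc a b, η k z.2 * inner ℝ (B z) (gradient ψ z.1) = 0 := fun z hz => by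
        by_cases h1 : z.1 ∈ K
        · rw [hηsupp k z.2 fun h2 => hz ⟨h1, h2⟩, zero_mul]
        · rw [hgψ0 _ h1, inner_zero_right, mul_zero]
      rw [setIntegral_eq_integral_of_forall_compl_eq_zero hz,
        setIntegral_eq_integral_of_forall_compl_eq_zero
          fun z h => hz z fun h2 => h (prod_mono hKE hsub h2)]
    simp only [e1]
    rw [e0]
    refine tendsto_integral_of_dominated_convergence
      (fun z => ‖inner ℝ (B z) (gradient ψ z.1)‖)
      (fun k => ((hηs k).continuous.comp continuous_snd).aestronglyMeasurable.mul hgi.1)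
      hgi.norm (fun k => Eventually.of_forall fun z => ?_) ?_
    · rw [norm_mul, Real.norm_of_nonneg (hη0 _ _)]
      exact mul_le_of_le_one_left (norm_nonneg _) (hη1 _ _)
    · have hne : ∀ r : ℝ, ∀ᵐ z : Space N × ℝ ∂volume, z.2 ≠ r := fun r => by
        have : (Prod.snd ⁻¹' {r} : Set (Space N × ℝ)) = univ ×ˢ {r} := by ext; simp
        rw [ae_iff]
        simp only [ne_eq, not_not]
        change volume (Prod.snd ⁻¹' {r} : Set (Space N × ℝ)) = 0
        rw [this, Measure.volume_eq_prod, Measure.prod_prod]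
        simp
      filter_upwards [ae_restrict_of_ae (hne s), ae_restrict_of_ae (hne t)] with z h1 h2
      exact (hηlim z.2 h1 h2).mul_const _
  have hfin := ge_of_tendsto' (lim1.add lim2) fun k =>
    hweak (Φ k) (hΦt k) fun z => mul_nonneg (hψ0 _) (hη0 _ _)
  have hi : ∀ τ ∈ Ioo T₁ T₂, IntegrableOn (fun x => u (x, τ) * ψ x) K := fun τ hτ =>
    (hu.integrableOn_slice hK hKE hτ).mul_bdd (c := max M 0) hψc.aestronglyMeasurable
      (Eventually.of_forall hM0)
  have e : ∫ x in K, (u (x, t) - u (x, s)) * ψ x = U t - U s := by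
    rw [hU, ← integral_sub (hi t ⟨by linarith, ht⟩) (hi s ⟨hs, by linarith⟩)]
    simp only [sub_mul]
  rw [e]
  exact hfin

/-! ### Averages over short time intervals -/

section Holder

variable {α V : Type*} [MeasurableSpace α] {μ : Measure α} [NormedAddCommGroup V]
  [InnerProductSpace ℝ V]

theorem eLpNorm_inner_le {p q : ℝ} (hpq : q.HolderConjugate p) {f g : α → V}
    (hf : AEStronglyMeasurable f μ) (hg : AEStronglyMeasurable g μ) :
    eLpNorm (fun z => inner ℝ (f z) (g z)) 1 μ ≤
      eLpNorm f (ENNReal.ofReal q) μ * eLpNorm g (ENNReal.ofReal p) μ := by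
  have := hpq.ennrealOfReal
  simpa using eLpNorm_le_eLpNorm_mul_eLpNorm_of_nnnorm (p := ENNReal.ofReal q)
    (q := ENNReal.ofReal p) (r := 1) hf hg (fun x y => inner ℝ x y) 1
    (Eventually.of_forall fun z => by simpa using nnnorm_inner_le_nnnorm (𝕜 := ℝ) (f z) (g z))

theorem integrable_inner_of_memLp {p q : ℝ} (hpq : q.HolderConjugate p) {f g : α → V}
    (hf : MemLp f (ENNReal.ofReal q) μ) (hg : MemLp g (ENNReal.ofReal p) μ) :
    Integrable (fun z => inner ℝ (f z) (g z)) μ :=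
  memLp_one_iff_integrable.1 ⟨hf.1.inner hg.1,
    (eLpNorm_inner_le hpq hf.1 hg.1).trans_lt (ENNReal.mul_lt_top hf.2 hg.2)⟩

theorem integral_norm_inner_le {p q : ℝ} (hpq : q.HolderConjugate p) {f g : α → V}
    (hf : MemLp f (ENNReal.ofReal q) μ) (hg : MemLp g (ENNReal.ofReal p) μ) :
    ∫ z, ‖(inner ℝ (f z) (g z) : ℝ)‖ ∂μ ≤ (eLpNorm f (ENNReal.ofReal q) μ).toReal *
      (eLpNorm g (ENNReal.ofReal p) μ).toReal := by
  rw [integral_norm_eq_lintegral_enorm (hf.1.inner hg.1), ← eLpNorm_one_eq_lintegral_enorm,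
    ← ENNReal.toReal_mul]
  exact ENNReal.toReal_mono (ENNReal.mul_ne_top hf.2.ne hg.2.ne) (eLpNorm_inner_le hpq hf.1 hg.1)

end Holder

/-- Almost every time slice of a function in `L^p` of a product is in `L^p`. -/
theorem MemLp.ae_slice {α β V : Type*} [MeasurableSpace α] [MeasurableSpace β]
    [NormedAddCommGroup V] {μ : Measure α} {ν : Measure β} [SFinite μ] [SFinite ν] {p : ℝ}
    (hp : 0 < p) {f : α × β → V} (hf : MemLp f (ENNReal.ofReal p) (μ.prod ν)) :
    ∀ᵐ t ∂ν, MemLp (fun x => f (x, t)) (ENNReal.ofReal p) μ := by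
  have hq0 : ENNReal.ofReal p ≠ 0 := by simpa using hp
  have h1 := (hf.integrable_norm_rpow hq0 ENNReal.ofReal_ne_top).prod_left_ae
  have h2 : ∀ᵐ t ∂ν, AEStronglyMeasurable (fun x => f (x, t)) μ :=
    hf.1.prod_swap.prodMk_left
  filter_upwards [h1, h2] with t h1 h2
  exact (integrable_norm_rpow_iff h2 hq0 ENNReal.ofReal_ne_top).1 h1

/-- The measure `volume` on `Space N × ℝ` is the product measure only after unfolding, so that the
instance for products has to be transported by hand. -/
instance isAddHaarMeasure_volume_space_prod (N : ℕ) :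
    (volume : Measure (Space N × ℝ)).IsAddHaarMeasure :=
  inferInstanceAs ((volume : Measure (Space N)).prod (volume : Measure ℝ)).IsAddHaarMeasure

theorem memLp_translate {V : Type*} [NormedAddCommGroup V] {N : ℕ} {q : ℝ}
    {f : Space N × ℝ → V} (hf : MemLp f (ENNReal.ofReal q) volume) (r : ℝ) :
    MemLp (fun z : Space N × ℝ => f (z - (0, r))) (ENNReal.ofReal q) volume :=
  hf.comp_measurePreserving (measurePreserving_sub_right volume ((0 : Space N), r))

section Translation

variable {V : Type*} [NormedAddCommGroup V] [InnerProductSpace ℝ V] {N : ℕ} {p q : ℝ}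
  {f g : Space N × ℝ → V}

theorem tendsto_integral_inner_translate (hpq : q.HolderConjugate p)
    (hf : MemLp f (ENNReal.ofReal q) volume) (hg : MemLp g (ENNReal.ofReal p) volume) :
    Tendsto (fun r : ℝ => ∫ z, inner ℝ (f (z - (0, r))) (g z)) (𝓝 0)
      (𝓝 (∫ z, inner ℝ (f z) (g z))) := by
  have hq1 : (1 : ℝ≥0∞) ≤ ENNReal.ofReal q := by simpa using ENNReal.ofReal_le_ofReal hpq.lt.le
  rw [tendsto_iff_norm_sub_tendsto_zero]
  have h0 : Tendsto (fun r : ℝ => ((0 : Space N), r)) (𝓝 0) (𝓝 0) :=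
    Continuous.tendsto' (by fun_prop) _ _ (by simp)
  have h1 := (tendsto_eLpNorm_translate (μ := (volume : Measure (Space N × ℝ))) hq1
    ENNReal.ofReal_ne_top hf).comp h0
  have h2 := ((ENNReal.tendsto_toReal ENNReal.zero_ne_top).comp h1).mul_const
    (eLpNorm g (ENNReal.ofReal p) volume).toReal
  simp only [ENNReal.toReal_zero, zero_mul] at h2
  refine tendsto_of_tendsto_of_tendsto_of_le_of_le tendsto_const_nhds h2
    (fun _ => norm_nonneg _) fun r => ?_
  simp only
  rw [← integral_sub (integrable_inner_of_memLp hpq (memLp_translate hf r) hg)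
    (integrable_inner_of_memLp hpq hf hg)]
  simp only [← inner_sub_left]
  exact (norm_integral_le_integral_norm _).trans
    (integral_norm_inner_le hpq ((memLp_translate hf r).sub hf) hg)

/-- Joint integrability in the point and in the time shift. Measurability holds because the shear
`(r, z) ↦ (r, z - (0, r))` preserves the product measure. -/
theorem integrable_inner_translate (hpq : q.HolderConjugate p)
    (hf : MemLp f (ENNReal.ofReal q) volume) (hg : MemLp g (ENNReal.ofReal p) volume)
    (I : Set ℝ) (hI : volume I ≠ ⊤) :
    Integrable (fun y : (Space N × ℝ) × ℝ => inner ℝ (f (y.1 - (0, y.2))) (g y.1))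
      ((volume : Measure (Space N × ℝ)).prod (volume.restrict I)) := by
  have : IsFiniteMeasure (volume.restrict I) := ⟨by
    rw [Measure.restrict_apply_univ]; exact hI.lt_top⟩
  have hshear : Measure.QuasiMeasurePreserving
      (fun y : (Space N × ℝ) × ℝ => y.1 - ((0 : Space N), y.2))
      ((volume : Measure (Space N × ℝ)).prod (volume.restrict I)) volume := by
    have h1 : MeasurePreserving (fun y : ℝ × (Space N × ℝ) => (y.1, y.2 - ((0 : Space N), y.1)))
        ((volume.restrict I).prod volume) ((volume.restrict I).prod volume) := by
      refine (MeasurePreserving.id _).skew_product (g := fun r z => z - ((0 : Space N), r))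
        (by fun_prop) (Eventually.of_forall fun r => ?_)
      exact (measurePreserving_sub_right volume ((0 : Space N), r)).map_eq
    exact (Measure.quasiMeasurePreserving_snd.comp h1.quasiMeasurePreserving).comp
      (Measure.measurePreserving_swap).quasiMeasurePreserving
  have hm : AEStronglyMeasurable
      (fun y : (Space N × ℝ) × ℝ => (inner ℝ (f (y.1 - (0, y.2))) (g y.1) : ℝ))
      ((volume : Measure (Space N × ℝ)).prod (volume.restrict I)) :=
    (hf.1.comp_quasiMeasurePreserving hshear).inner
      (hg.1.comp_quasiMeasurePreserving Measure.quasiMeasurePreserving_fst)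
  rw [integrable_prod_iff' hm]
  refine ⟨Eventually.of_forall fun r => integrable_inner_of_memLp hpq (memLp_translate hf r) hg,
    ?_⟩
  refine Integrable.mono' (integrable_const ((eLpNorm f (ENNReal.ofReal q) volume).toReal *
    (eLpNorm g (ENNReal.ofReal p) volume).toReal)) hm.norm.prod_swap.integral_prod_right'
    (Eventually.of_forall fun r => ?_)
  rw [Real.norm_of_nonneg (integral_nonneg fun _ => norm_nonneg _)]
  have h1 : eLpNorm (fun z : Space N × ℝ => f (z - (0, r))) (ENNReal.ofReal q) volume =
      eLpNorm f (ENNReal.ofReal q) volume :=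
    eLpNorm_comp_measurePreserving hf.1
      (measurePreserving_sub_right volume ((0 : Space N), r))
  rw [← h1]
  exact integral_norm_inner_le hpq (memLp_translate hf r) hg

end Translation

/-- Convergence of averages over `(0, h]` of functions `D h` that may vary with `h`. -/
theorem tendsto_average_of_forall_le {D : ℝ → ℝ → ℝ} {d : ℝ}
    (hD : ∀ ε > 0, ∀ᶠ h in 𝓝[>] (0 : ℝ), ∀ r ∈ Ioc 0 h, |D h r - d| ≤ ε)
    (hi : ∀ᶠ h in 𝓝[>] (0 : ℝ), IntegrableOn (D h) (Ioc 0 h)) :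
    Tendsto (fun h => h⁻¹ * ∫ r in Ioc 0 h, D h r) (𝓝[>] 0) (𝓝 d) := by
  rw [Metric.tendsto_nhds]
  intro ε hε
  filter_upwards [hD (ε / 2) (by linarith), hi, self_mem_nhdsWithin] with h hb hi hh
  have hh0 : 0 < h := hh
  have h1 : ‖∫ r in (0 : ℝ)..h, (D h r - d)‖ ≤ ε / 2 * |h - 0| :=
    intervalIntegral.norm_integral_le_of_norm_le_const fun r hr => by
      rw [uIoc_of_le hh0.le] at hr
      exact hb r hr
  rw [intervalIntegral.integral_sub
    ((intervalIntegrable_iff_integrableOn_Ioc_of_le hh0.le).2 hi) (by simp),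
    intervalIntegral.integral_of_le hh0.le, intervalIntegral.integral_const, sub_zero,
    smul_eq_mul, abs_of_pos hh0] at h1
  rw [Real.dist_eq]
  have h2 : h⁻¹ * (∫ r in Ioc 0 h, D h r) - d = h⁻¹ * ((∫ r in Ioc 0 h, D h r) - h * d) := by
    field_simp
  rw [h2, abs_mul, abs_of_pos (inv_pos.2 hh0)]
  calc _ ≤ h⁻¹ * (ε / 2 * h) := mul_le_mul_of_nonneg_left h1 (inv_pos.2 hh0).le
    _ = ε / 2 := by field_simp
    _ < ε := by linarith

theorem tendsto_average_of_tendsto {D : ℝ → ℝ} {d : ℝ} (hD : Tendsto D (𝓝 0) (𝓝 d))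
    (hi : ∀ h, 0 < h → IntegrableOn D (Ioc 0 h)) :
    Tendsto (fun h => h⁻¹ * ∫ r in Ioc 0 h, D r) (𝓝[>] 0) (𝓝 d) := by
  refine tendsto_average_of_forall_le (D := fun _ => D) (fun ε hε => ?_)
    (eventually_mem_nhdsWithin.mono fun h hh => hi h hh)
  obtain ⟨δ, hδ, hball⟩ := Metric.eventually_nhds_iff.1 (Metric.tendsto_nhds.1 hD ε hε)
  filter_upwards [Ioo_mem_nhdsGT hδ] with h hh r hr
  refine (hball ?_).le
  rw [Real.dist_eq, sub_zero, abs_of_pos hr.1]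
  exact hr.2.trans_lt hh.2

section SpaceAverage

variable {N : ℕ} {K : Set (Space N)} {p q a t₁ t₂ : ℝ} {B X : Space N × ℝ → Space N}

theorem integrableOn_inner_slice (hpq : q.HolderConjugate p) {s t : ℝ}
    (hB : MemLp B (ENNReal.ofReal q) (volume.restrict (K ×ˢ Ioc s t))) {Y : Space N → Space N}
    (hY : MemLp Y (ENNReal.ofReal p) (volume.restrict K)) :
    IntegrableOn (fun z : Space N × ℝ => inner ℝ (B z) (Y z.1)) (K ×ˢ Ioc s t) := by
  refine integrable_inner_of_memLp hpq hB ?_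
  rw [Measure.volume_eq_prod, ← Measure.prod_restrict]
  exact hY.comp_fst _

/-- Averaging `B` over the preceding time interval of length `h` and pairing with `X` amounts to
averaging the pairings of `X` with the time translates of `B`, since almost every slice of `X` is
in `L^p`. Continuity of translations in `L^q` then gives the limit as `h → 0`. -/
theorem tendsto_space_average (hpq : q.HolderConjugate p) (hK : IsCompact K) (ha : a < t₁)
    (hB : MemLp B (ENNReal.ofReal q) (volume.restrict (K ×ˢ Icc a t₂)))
    (hX : MemLp X (ENNReal.ofReal p) (volume.restrict (K ×ˢ Ioc t₁ t₂))) :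
    (∀ᶠ h in 𝓝[>] (0 : ℝ), IntegrableOn
      (fun t => ∫ z in K ×ˢ Ioc (t - h) t, inner ℝ (B z) (X (z.1, t))) (Ioc t₁ t₂)) ∧
    Tendsto (fun h => h⁻¹ * ∫ t in Ioc t₁ t₂, ∫ z in K ×ˢ Ioc (t - h) t,
      inner ℝ (B z) (X (z.1, t))) (𝓝[>] 0)
      (𝓝 (∫ z in K ×ˢ Ioc t₁ t₂, inner ℝ (B z) (X z))) := by
  set B' := (K ×ˢ Icc a t₂).indicator B with hB'
  set X' := (K ×ˢ Ioc t₁ t₂).indicator X with hX'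
  have hmB : MeasurableSet (K ×ˢ Icc a t₂) := hK.measurableSet.prod measurableSet_Icc
  have hmX : MeasurableSet (K ×ˢ Ioc t₁ t₂) := hK.measurableSet.prod measurableSet_Ioc
  have hBL : MemLp B' (ENNReal.ofReal q) volume := (memLp_indicator_iff_restrict hmB).2 hB
  have hXL : MemLp X' (ENNReal.ofReal p) volume := (memLp_indicator_iff_restrict hmX).2 hX
  set D : ℝ → ℝ := fun r => ∫ z, inner ℝ (B' (z - (0, r))) (X' z) with hD
  have hint := fun h : ℝ => integrable_inner_translate hpq hBL hXL (Ioc 0 h) (by simp)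
  have hDi : ∀ h, 0 < h → IntegrableOn D (Ioc 0 h) := fun h _ => (hint h).integral_prod_right
  have hlim := tendsto_average_of_tendsto (tendsto_integral_inner_translate hpq hBL hXL) hDi
  have hD0 : ∫ z, inner ℝ (B' z) (X' z) = ∫ z in K ×ˢ Ioc t₁ t₂, inner ℝ (B z) (X z) := by
    rw [← integral_indicator hmX]
    refine integral_congr_ae (Eventually.of_forall fun z => ?_)
    by_cases hz : z ∈ K ×ˢ Ioc t₁ t₂
    · have hz2 : z ∈ K ×ˢ Icc a t₂ := ⟨hz.1, (ha.trans hz.2.1).le, hz.2.2⟩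
      simp only [hB', hX', indicator_of_mem hz, indicator_of_mem hz2]
    · simp only [hX', indicator_of_notMem hz, inner_zero_right]
  rw [hD0] at hlim
  have hslice : ∀ᵐ t ∂(volume.restrict (Ioc t₁ t₂)),
      MemLp (fun x => X (x, t)) (ENNReal.ofReal p) (volume.restrict K) := by
    refine MemLp.ae_slice hpq.symm.pos ?_
    rw [Measure.prod_restrict, ← Measure.volume_eq_prod]
    exact hX
  -- the slicewise identification with the translated pairing
  have key : ∀ h, 0 < h → h < t₁ - a → ∀ᵐ t ∂(volume : Measure ℝ),
      ∫ x, ∫ r in Ioc 0 h, inner ℝ (B' ((x, t) - (0, r))) (X' (x, t)) =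
      (Ioc t₁ t₂).indicator
        (fun t => ∫ z in K ×ˢ Ioc (t - h) t, inner ℝ (B z) (X (z.1, t))) t := by
    intro h hh0 hh
    filter_upwards [(ae_restrict_iff' measurableSet_Ioc).1 hslice] with t ht
    by_cases htI : t ∈ Ioc t₁ t₂
    · have hBt : MemLp B (ENNReal.ofReal q) (volume.restrict (K ×ˢ Ioc (t - h) t)) :=
        hB.mono_measure (Measure.restrict_mono_set _ (prod_mono Subset.rfl
          fun σ (hσ : σ ∈ Ioc (t - h) t) => mem_Icc.2
            ⟨by linarith [hσ.1, htI.1], hσ.2.trans htI.2⟩))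
      rw [indicator_of_mem htI, Measure.volume_eq_prod, setIntegral_prod _
        (integrableOn_inner_slice hpq hBt (ht htI)), ← integral_indicator hK.measurableSet]
      refine integral_congr_ae (Eventually.of_forall fun x => ?_)
      by_cases hx : x ∈ K
      · simp only [indicator_of_mem hx]
        rw [← intervalIntegral.integral_of_le hh0.le, ← intervalIntegral.integral_of_le
          (by linarith : t - h ≤ t)]
        have hsub := intervalIntegral.integral_comp_sub_left (a := 0) (b := h)
          (fun σ => (inner ℝ (B (x, σ)) (X (x, t)) : ℝ)) t
        rw [sub_zero] at hsub
        rw [← hsub]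
        refine intervalIntegral.integral_congr fun r hr => ?_
        rw [uIcc_of_le hh0.le] at hr
        have h1 : (x, t) ∈ K ×ˢ Ioc t₁ t₂ := ⟨hx, htI⟩
        have h2 : (x, t - r) ∈ K ×ˢ Icc a t₂ :=
          ⟨hx, by linarith [hr.2, htI.1], by linarith [hr.1, htI.2]⟩
        simp only [hX', indicator_of_mem h1, Prod.mk_sub_mk, sub_zero]
        rw [hB', indicator_of_mem h2]
      · have : ∀ r : ℝ, X' (x, t) = 0 := fun r => indicator_of_notMem (fun h => hx h.1) _
        simp [hx, this 0]
    · have : ∀ x, X' (x, t) = 0 := fun x => indicator_of_notMem (fun h => htI h.2) _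
      simp [htI, this]
  have hfub : ∀ h, 0 < h → h < t₁ - a →
      IntegrableOn (fun t => ∫ z in K ×ˢ Ioc (t - h) t, inner ℝ (B z) (X (z.1, t)))
        (Ioc t₁ t₂) ∧
      ∫ t in Ioc t₁ t₂, ∫ z in K ×ˢ Ioc (t - h) t, inner ℝ (B z) (X (z.1, t)) =
        ∫ r in Ioc 0 h, D r := by
    intro h hh0 hh
    have h1 := (hint h).integral_prod_left
    have h1' := h1
    rw [Measure.volume_eq_prod] at h1'
    have h2 := h1'.integral_prod_right
    refine ⟨?_, ?_⟩
    · rw [← integrable_indicator_iff measurableSet_Ioc]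
      exact h2.congr (key h hh0 hh)
    · rw [← integral_indicator measurableSet_Ioc, ← integral_congr_ae (key h hh0 hh), hD,
        ← integral_integral_swap (f := fun (z : Space N × ℝ) (r : ℝ) =>
          inner ℝ (B' (z - (0, r))) (X' z)) (hint h)]
      exact (integral_prod_symm _ h1').symm
  have hsmall : ∀ᶠ h in 𝓝[>] (0 : ℝ), 0 < h ∧ h < t₁ - a := by
    filter_upwards [Ioo_mem_nhdsGT (sub_pos.2 ha)] with h hh using hh
  refine ⟨hsmall.mono fun h hh => (hfub h hh.1 hh.2).1, hlim.congr' ?_⟩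
  filter_upwards [hsmall] with h hh
  rw [(hfub h hh.1 hh.2).2]

end SpaceAverage

/-- Difference quotients of `t ↦ H(t, t)` in the first variable only, where `H₂` is the derivative
of `H` in the second variable. Differentiability of `H` in the first variable is not needed: a shift
of the integration variable moves the difference to the second variable, up to averages of `H` over
intervals of length `h` at the two endpoints. -/
theorem tendsto_time_average {H H₂ : ℝ → ℝ → ℝ} {a t₁ t₂ M : ℝ} (ha : a < t₁) (ht : t₁ < t₂)
    (hc : ContinuousOn (fun y : ℝ × ℝ => H y.1 y.2) (Icc a t₂ ×ˢ Icc t₁ t₂))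
    (hd : ∀ s ∈ Icc a t₂, ∀ t ∈ Ioo t₁ t₂, HasDerivAt (H s) (H₂ s t) t)
    (hM : ∀ s ∈ Icc a t₂, ∀ t ∈ Ioo t₁ t₂, |H₂ s t| ≤ M) :
    (∀ᶠ h in 𝓝[>] (0 : ℝ), IntegrableOn (fun t => H t t - H (t - h) t) (Ioc t₁ t₂)) ∧
    Tendsto (fun h => h⁻¹ * ∫ t in Ioc t₁ t₂, (H t t - H (t - h) t)) (𝓝[>] 0)
      (𝓝 (H t₂ t₂ - H t₁ t₁ - ∫ t in Ioc t₁ t₂, H₂ t t)) := by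
  have hsmall : ∀ᶠ h in 𝓝[>] (0 : ℝ), 0 < h ∧ h < t₁ - a ∧ h < t₂ - t₁ := by
    filter_upwards [Ioo_mem_nhdsGT (lt_min (sub_pos.2 ha) (sub_pos.2 ht))] with h hh
    exact ⟨hh.1, hh.2.trans_le (min_le_left _ _), hh.2.trans_le (min_le_right _ _)⟩
  -- integrability of the various pieces
  have hc0 : ContinuousOn (fun t => H t t) (Icc t₁ t₂) :=
    hc.comp (f := fun t => (t, t)) (by fun_prop) fun t h => ⟨⟨by linarith [h.1], h.2⟩, h⟩
  have hc1 : ∀ h, 0 < h → h < t₁ - a → ContinuousOn (fun t => H (t - h) t) (Icc t₁ t₂) :=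
    fun h h0 h1 => hc.comp (f := fun t => (t - h, t)) (by fun_prop)
      fun t h => ⟨⟨by linarith [h.1], by linarith [h.2]⟩, h⟩
  have hc2 : ∀ h, 0 < h → h < t₁ - a →
      ContinuousOn (fun t => H t (t + h)) (Icc (t₁ - h) (t₂ - h)) :=
    fun h h0 h1 => hc.comp (f := fun t => (t, t + h)) (by fun_prop)
      fun t h => ⟨⟨by linarith [h.1], by linarith [h.2]⟩, by linarith [h.1], by linarith [h.2]⟩
  refine ⟨hsmall.mono fun h hh => (((hc0.sub (hc1 h hh.1 hh.2.1))).integrableOn_Icc).mono_set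
    Ioc_subset_Icc_self, ?_⟩
  -- the difference quotient in the second variable
  set Q : ℝ → ℝ → ℝ := fun h t => (Iio (t₂ - h)).indicator (fun t => h⁻¹ * (H t (t + h) - H t t)) t
    with hQ
  have hQlim : Tendsto (fun h => ∫ t in t₁..t₂, Q h t) (𝓝[>] 0) (𝓝 (∫ t in t₁..t₂, H₂ t t)) := by
    refine intervalIntegral.tendsto_integral_filter_of_dominated_convergence (fun _ => M) ?_ ?_
      (by simp) ?_
    · filter_upwards [hsmall] with h ⟨h0, h1, h2⟩
      rw [uIoc_of_le ht.le]
      have : (volume.restrict (Ioc t₁ t₂)).restrict (Iio (t₂ - h)) ≤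
          volume.restrict (Icc t₁ (t₂ - h)) := by
        rw [Measure.restrict_restrict measurableSet_Iio]
        exact Measure.restrict_mono_set _ fun t ht => ⟨ht.2.1.le, le_of_lt ht.1⟩
      rw [hQ, aestronglyMeasurable_indicator_iff measurableSet_Iio]
      refine AEStronglyMeasurable.mono_measure ?_ this
      refine ContinuousOn.aestronglyMeasurable ?_ measurableSet_Icc
      exact continuousOn_const.mul (((hc2 h h0 h1).mono (Icc_subset_Icc (by linarith) le_rfl)).sub
        (hc0.mono (Icc_subset_Icc le_rfl (by linarith))))
    · filter_upwards [hsmall] with h ⟨h0, h1, h2⟩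
      refine Eventually.of_forall fun t htI => ?_
      rw [uIoc_of_le ht.le] at htI
      have hM0 : 0 ≤ M := (abs_nonneg _).trans
        (hM t₁ ⟨ha.le, ht.le⟩ ((t₁ + t₂) / 2) ⟨by linarith, by linarith⟩)
      by_cases htI2 : t < t₂ - h
      · rw [hQ]
        simp only [indicator_of_mem (show t ∈ Iio (t₂ - h) from htI2)]
        have h3 := Convex.norm_image_sub_le_of_norm_hasDerivWithin_le (f := H t) (f' := H₂ t)
          (s := Ioo t₁ t₂) (x := t) (y := t + h) (C := M)
          (fun x hx => (hd t ⟨by linarith [htI.1], htI.2⟩ x hx).hasDerivWithinAt)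
          (fun x hx => hM t ⟨by linarith [htI.1], htI.2⟩ x hx) (convex_Ioo _ _)
          ⟨htI.1, by linarith⟩ ⟨by linarith [htI.1], by linarith⟩
        rw [norm_mul, Real.norm_of_nonneg (inv_pos.2 h0).le]
        calc _ ≤ h⁻¹ * (M * ‖t + h - t‖) := mul_le_mul_of_nonneg_left h3 (inv_pos.2 h0).le
          _ = M := by
            rw [add_sub_cancel_left, Real.norm_of_nonneg h0.le]
            field_simp
      · simp [hQ, htI2, hM0]
    · have hne : ∀ᵐ t ∂(volume : Measure ℝ), t ≠ t₂ := by simp [ae_iff]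
      filter_upwards [hne] with t htne htI
      rw [uIoc_of_le ht.le] at htI
      have htt : t < t₂ := lt_of_le_of_ne htI.2 htne
      have h1 := (hasDerivAt_iff_tendsto_slope_zero.1
        (hd t ⟨by linarith [htI.1], htI.2⟩ t ⟨htI.1, htt⟩)).mono_left
        (nhdsWithin_mono (0 : ℝ) (s := Ioi 0) fun x hx => (ne_of_gt hx))
      refine h1.congr' ?_
      filter_upwards [Ioo_mem_nhdsGT (sub_pos.2 htt)] with h hh
      have : t ∈ Iio (t₂ - h) := by
        have := hh.2
        simp only [mem_Iio]
        linarith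
      simp only [hQ, indicator_of_mem this, smul_eq_mul]
  have hnear : ∀ t ∈ Icc t₁ t₂, ∀ ε > 0, ∃ δ > 0, ∀ y ∈ Icc a t₂ ×ˢ Icc t₁ t₂,
      dist y (t, t) < δ → |H y.1 y.2 - H t t| < ε := fun t h ε hε =>
    Metric.continuousWithinAt_iff'.1 (hc (t, t) ⟨⟨by linarith [h.1], h.2⟩, h⟩) ε hε |>
      fun h => by
        obtain ⟨δ, hδ, hb⟩ := Metric.mem_nhdsWithin_iff.1 h
        exact ⟨δ, hδ, fun y hy hd => hb ⟨hd, hy⟩⟩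
  have hE1 : Tendsto (fun h => h⁻¹ * ∫ r in Ioc 0 h, H (t₂ - r) (t₂ - r)) (𝓝[>] 0)
      (𝓝 (H t₂ t₂)) := by
    refine tendsto_average_of_forall_le (D := fun _ r => H (t₂ - r) (t₂ - r)) (fun ε hε => ?_) ?_
    · obtain ⟨δ, hδ, hb⟩ := hnear t₂ ⟨ht.le, le_rfl⟩ ε hε
      filter_upwards [hsmall, Ioo_mem_nhdsGT hδ] with h ⟨h0, h1, h2⟩ hhδ r hr
      refine (hb (t₂ - r, t₂ - r) ⟨⟨by linarith [hr.2], by linarith [hr.1]⟩,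
        by linarith [hr.2], by linarith [hr.1]⟩ ?_).le
      rw [Prod.dist_eq, Real.dist_eq, max_self, abs_lt]
      constructor <;> linarith [hr.1, hr.2, hhδ.2]
    · filter_upwards [hsmall] with h ⟨h0, h1, h2⟩
      refine IntegrableOn.mono_set (ContinuousOn.integrableOn_Icc ?_) Ioc_subset_Icc_self
      exact hc0.comp (f := fun r => t₂ - r) (by fun_prop)
        fun r hr => ⟨by linarith [hr.2], by linarith [hr.1]⟩
  have hE2 : Tendsto (fun h => h⁻¹ * ∫ r in Ioc 0 h, H (t₁ - h + r) (t₁ - h + r + h)) (𝓝[>] 0)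
      (𝓝 (H t₁ t₁)) := by
    refine tendsto_average_of_forall_le (D := fun h r => H (t₁ - h + r) (t₁ - h + r + h))
      (fun ε hε => ?_) ?_
    · obtain ⟨δ, hδ, hb⟩ := hnear t₁ ⟨le_rfl, ht.le⟩ ε hε
      filter_upwards [hsmall, Ioo_mem_nhdsGT hδ] with h ⟨h0, h1, h2⟩ hhδ r hr
      refine (hb (t₁ - h + r, t₁ - h + r + h) ⟨⟨by linarith [hr.1], by linarith [hr.2]⟩,
        by linarith [hr.1], by linarith [hr.2]⟩ ?_).le
      rw [Prod.dist_eq, Real.dist_eq, Real.dist_eq, max_lt_iff, abs_lt, abs_lt]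
      constructor <;> constructor <;> linarith [hr.1, hr.2, hhδ.2]
    · filter_upwards [hsmall] with h ⟨h0, h1, h2⟩
      refine IntegrableOn.mono_set (ContinuousOn.integrableOn_Icc ?_) Ioc_subset_Icc_self
      exact (hc2 h h0 h1).comp (f := fun r => t₁ - h + r) (by fun_prop)
        fun r hr => ⟨by linarith [hr.1], by linarith [hr.2]⟩
  have hall := (hE1.sub hE2).sub hQlim
  rw [intervalIntegral.integral_of_le ht.le] at hall
  refine hall.congr' ?_
  filter_upwards [hsmall] with h ⟨h0, h1, h2⟩
  have i1 : IntervalIntegrable (fun t => H t t) volume t₁ (t₂ - h) :=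
    (hc0.mono (Icc_subset_Icc le_rfl (by linarith))).intervalIntegrable_of_Icc (by linarith)
  have i2 : IntervalIntegrable (fun t => H t t) volume (t₂ - h) t₂ :=
    (hc0.mono (Icc_subset_Icc (by linarith) le_rfl)).intervalIntegrable_of_Icc (by linarith)
  have i3 : IntervalIntegrable (fun t => H t (t + h)) volume (t₁ - h) t₁ :=
    ((hc2 h h0 h1).mono (Icc_subset_Icc le_rfl (by linarith))).intervalIntegrable_of_Icc
      (by linarith)
  have i4 : IntervalIntegrable (fun t => H t (t + h)) volume t₁ (t₂ - h) :=
    ((hc2 h h0 h1).mono (Icc_subset_Icc (by linarith) le_rfl)).intervalIntegrable_of_Icc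
      (by linarith)
  have i5 : IntervalIntegrable (fun t => H (t - h) t) volume t₁ t₂ :=
    (hc1 h h0 h1).intervalIntegrable_of_Icc ht.le
  have e1 : ∫ r in Ioc 0 h, H (t₂ - r) (t₂ - r) = ∫ t in (t₂ - h)..t₂, H t t := by
    rw [← intervalIntegral.integral_of_le h0.le,
      intervalIntegral.integral_comp_sub_left (fun t => H t t), sub_zero]
  have e2 : ∫ r in Ioc 0 h, H (t₁ - h + r) (t₁ - h + r + h) =
      ∫ t in (t₁ - h)..t₁, H t (t + h) := by
    rw [← intervalIntegral.integral_of_le h0.le,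
      intervalIntegral.integral_comp_add_left (fun t => H t (t + h)), add_zero, sub_add_cancel]
  have e3 : ∫ t in t₁..t₂, Q h t =
      h⁻¹ * ((∫ t in t₁..(t₂ - h), H t (t + h)) - ∫ t in t₁..(t₂ - h), H t t) := by
    rw [← intervalIntegral.integral_sub i4 i1, ← intervalIntegral.integral_const_mul,
      intervalIntegral.integral_of_le ht.le, intervalIntegral.integral_of_le (by linarith), hQ,
      setIntegral_indicator measurableSet_Iio, ← integral_Ioc_eq_integral_Ioo.symm]
    congr 2
    ext t
    simp only [mem_inter_iff, mem_Ioc, mem_Iio, mem_Ioo]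
    constructor
    · rintro ⟨⟨h3, -⟩, h4⟩
      exact ⟨h3, h4⟩
    · rintro ⟨h3, h4⟩
      exact ⟨⟨h3, by linarith⟩, h4⟩
  have e4 : ∫ t in t₁..t₂, H (t - h) t = ∫ t in (t₁ - h)..(t₂ - h), H t (t + h) := by
    rw [← intervalIntegral.integral_comp_sub_right (fun t => H t (t + h))]
    simp
  rw [← intervalIntegral.integral_of_le ht.le, intervalIntegral.integral_sub (i1.trans i2) i5, e1,
    e2, e3, e4, ← intervalIntegral.integral_add_adjacent_intervals i1 i2,
    ← intervalIntegral.integral_add_adjacent_intervals i3 i4]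
  ring

/-- The backward difference quotients of `F(u)`, tested with `w`, produce the integrals over the two
boundary slices and move the time derivative to `w`. -/
theorem MemContLocL2.tendsto_time_average {N : ℕ} {E K : Set (Space N)} {T₁ T₂ : ℝ}
    {u : Space N × ℝ → ℝ} (hu : MemContLocL2 E T₁ T₂ u)
    (hum : AEStronglyMeasurable u (volume.restrict (E ×ˢ Ioo T₁ T₂))) (hK : IsCompact K)
    (hKE : K ⊆ E) {L : NNReal} {F : ℝ → ℝ} (hF : LipschitzWith L F) {w w' : Space N × ℝ → ℝ}
    (hw : Continuous w) (hw' : Continuous w')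
    (hd : ∀ x t, HasDerivAt (fun s => w (x, s)) (w' (x, t)) t) {t₁ t₂ : ℝ}
    (h₁ : T₁ < t₁) (h₁₂ : t₁ < t₂) (h₂ : t₂ < T₂) :
    (∀ᶠ h in 𝓝[>] (0 : ℝ), IntegrableOn (fun t => (∫ x in K, F (u (x, t)) * w (x, t)) -
      ∫ x in K, F (u (x, t - h)) * w (x, t)) (Ioc t₁ t₂)) ∧
    Tendsto (fun h => h⁻¹ * ∫ t in Ioc t₁ t₂, ((∫ x in K, F (u (x, t)) * w (x, t)) -
      ∫ x in K, F (u (x, t - h)) * w (x, t))) (𝓝[>] 0)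
      (𝓝 ((∫ x in K, F (u (x, t₂)) * w (x, t₂)) - (∫ x in K, F (u (x, t₁)) * w (x, t₁)) -
        ∫ z in K ×ˢ Ioc t₁ t₂, F (u z) * w' z)) := by
  obtain ⟨a, ha, hat⟩ := exists_between h₁
  have hsub : Icc a t₂ ⊆ Ioo T₁ T₂ := fun s hs => ⟨ha.trans_le hs.1, hs.2.trans_lt h₂⟩
  have hcpt : IsCompact (K ×ˢ Icc t₁ t₂) := hK.prod isCompact_Icc
  obtain ⟨M, hM⟩ := hcpt.exists_bound_of_continuousOn hw.continuousOn
  obtain ⟨M', hM'⟩ := hcpt.exists_bound_of_continuousOn hw'.continuousOn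
  have hFi : ∀ s ∈ Icc a t₂, IntegrableOn (fun x => F (u (x, s))) K := fun s hs =>
    hu.integrableOn_comp_slice hK hKE hF (hsub hs)
  have hslice : ∀ {g : Space N × ℝ → ℝ}, Continuous g → ∀ t,
      AEStronglyMeasurable (fun x => g (x, t)) (volume.restrict K) := fun hg t =>
    (hg.comp (Continuous.prodMk_left t)).aestronglyMeasurable
  have hKm : ∀ᵐ x ∂(volume.restrict K), x ∈ K := ae_restrict_mem hK.measurableSet
  have hFw : ∀ s ∈ Icc a t₂, ∀ t ∈ Icc t₁ t₂,
      IntegrableOn (fun x => F (u (x, s)) * w (x, t)) K := fun s hs t ht =>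
    (hFi s hs).mul_bdd (c := M) (hslice hw t) (hKm.mono fun x hx => hM (x, t) ⟨hx, ht⟩)
  have hFw' : ∀ s ∈ Icc a t₂, ∀ t ∈ Icc t₁ t₂,
      IntegrableOn (fun x => F (u (x, s)) * w' (x, t)) K := fun s hs t ht =>
    (hFi s hs).mul_bdd (c := M') (hslice hw' t) (hKm.mono fun x hx => hM' (x, t) ⟨hx, ht⟩)
  -- a uniform bound for the integrals of `F(u)`
  obtain ⟨C, hC⟩ := isCompact_Icc.exists_bound_of_continuousOn
    ((hu.continuousOn_integral hK hKE (lipschitzWith_one_norm.comp hF) (θ := fun _ => 1) (M := 1)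
      aestronglyMeasurable_const (by simp)).mono hsub)
  have hcont : ContinuousOn (fun y : ℝ × ℝ => ∫ x in K, F (u (x, y.1)) * w (x, y.2))
      (Icc a t₂ ×ˢ Icc t₁ t₂) := by
    rintro ⟨s₀, t₀⟩ ⟨hs₀, ht₀⟩
    rw [ContinuousWithinAt, tendsto_iff_norm_sub_tendsto_zero]
    have l1 : Tendsto (fun y : ℝ × ℝ => (L * M : ℝ) * ∫ x in K, |u (x, y.1) - u (x, s₀)|)
        (𝓝[Icc a t₂ ×ˢ Icc t₁ t₂] (s₀, t₀)) (𝓝 0) := by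
      have := ((hu.tendsto_integral_abs_sub hK hKE (hsub hs₀)).comp
        (continuous_fst.tendsto ((s₀, t₀) : ℝ × ℝ))).const_mul (L * M : ℝ)
      rw [mul_zero] at this
      exact this.mono_left nhdsWithin_le_nhds
    have l2 : Tendsto (fun y : ℝ × ℝ =>
        ‖(∫ x in K, F (u (x, s₀)) * w (x, y.2)) - ∫ x in K, F (u (x, s₀)) * w (x, t₀)‖)
        (𝓝[Icc a t₂ ×ˢ Icc t₁ t₂] (s₀, t₀)) (𝓝 0) := by
      rw [← tendsto_iff_norm_sub_tendsto_zero]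
      refine tendsto_integral_filter_of_dominated_convergence (fun x => ‖F (u (x, s₀))‖ * M) ?_ ?_
        ((hFi s₀ hs₀).norm.mul_const _) (Eventually.of_forall fun x => ?_)
      · exact Eventually.of_forall fun y => (hFi s₀ hs₀).1.mul (hslice hw _)
      · filter_upwards [self_mem_nhdsWithin] with y hy
        filter_upwards [hKm] with x hx
        rw [norm_mul]
        exact mul_le_mul_of_nonneg_left (hM (x, y.2) ⟨hx, hy.2⟩) (norm_nonneg _)
      · have : Continuous fun y : ℝ × ℝ => F (u (x, s₀)) * w (x, y.2) := by fun_prop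
        exact (this.tendsto (s₀, t₀)).mono_left nhdsWithin_le_nhds
    have l3 := l1.add l2
    rw [add_zero] at l3
    refine tendsto_of_tendsto_of_tendsto_of_le_of_le' tendsto_const_nhds l3
      (Eventually.of_forall fun _ => norm_nonneg _) ?_
    filter_upwards [self_mem_nhdsWithin] with y hy
    have hM0 : ∀ x ∈ K, |w (x, y.2)| ≤ M := fun x hx => hM (x, y.2) ⟨hx, hy.2⟩
    have e : (∫ x in K, F (u (x, y.1)) * w (x, y.2)) - ∫ x in K, F (u (x, s₀)) * w (x, t₀) =
        (∫ x in K, (F (u (x, y.1)) - F (u (x, s₀))) * w (x, y.2)) +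
        ((∫ x in K, F (u (x, s₀)) * w (x, y.2)) - ∫ x in K, F (u (x, s₀)) * w (x, t₀)) := by
      simp only [sub_mul]
      rw [integral_sub (hFw _ hy.1 _ hy.2) (hFw _ hs₀ _ hy.2)]
      ring
    rw [e]
    refine (norm_add_le _ _).trans (add_le_add_left ?_ _)
    rw [← integral_const_mul]
    refine (norm_integral_le_integral_norm _).trans (integral_mono_of_nonneg
      (Eventually.of_forall fun _ => norm_nonneg _) ?_ (hKm.mono fun x hx => ?_))
    · exact (((hu.integrableOn_slice hK hKE (hsub hy.1)).sub
        (hu.integrableOn_slice hK hKE (hsub hs₀))).abs).const_mul _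
    · have h2 := hF.dist_le_mul (u (x, y.1)) (u (x, s₀))
      rw [Real.dist_eq, Real.dist_eq] at h2
      simp only [Real.norm_eq_abs, abs_mul]
      calc _ ≤ (L * |u (x, y.1) - u (x, s₀)|) * M :=
            mul_le_mul h2 (hM0 x hx) (abs_nonneg _) (by positivity)
        _ = _ := by ring
  have main := _root_.tendsto_time_average (M := C * |M'|)
    (H := fun s t => ∫ x in K, F (u (x, s)) * w (x, t))
    (H₂ := fun s t => ∫ x in K, F (u (x, s)) * w' (x, t)) hat h₁₂ hcont ?_ ?_
  · refine ⟨main.1, ?_⟩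
    have hint : IntegrableOn (fun z => F (u z) * w' z) (K ×ˢ Ioc t₁ t₂) := by
      have hi := (hu.integrableOn_comp_prod hum hK hKE hF h₁ h₂).mul_continuousOn hw'.continuousOn
        hcpt
      exact hi.mono_set (prod_mono Subset.rfl Ioc_subset_Icc_self)
    have e : ∫ z in K ×ˢ Ioc t₁ t₂, F (u z) * w' z =
        ∫ t in Ioc t₁ t₂, ∫ x in K, F (u (x, t)) * w' (x, t) := by
      rw [Measure.volume_eq_prod, ← Measure.prod_restrict, integral_prod_symm]
      rw [Measure.prod_restrict, ← Measure.volume_eq_prod]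
      exact hint
    rw [e]
    exact main.2
  · intro s hs t ht
    refine (hasDerivAt_integral_of_dominated_loc_of_deriv_le (s := Icc t₁ t₂)
      (bound := fun x => ‖F (u (x, s))‖ * M') (Icc_mem_nhds ht.1 ht.2)
      (Eventually.of_forall fun r => (hFi s hs).1.mul (hslice hw r))
      (hFw s hs t (Ioo_subset_Icc_self ht)) ((hFi s hs).1.mul (hslice hw' t))
      (hKm.mono fun x hx r hr => ?_) ((hFi s hs).norm.mul_const _)
      (Eventually.of_forall fun x r hr => (hd x r).const_mul _)).2
    rw [norm_mul]
    exact mul_le_mul_of_nonneg_left (hM' (x, r) ⟨hx, hr⟩) (norm_nonneg _)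
  · intro s hs t ht
    have h3 : ∫ x in K, ‖F (u (x, s))‖ ≤ C := by
      have := hC s hs
      simp only [mul_one, Function.comp] at this
      exact (le_abs_self _).trans this
    calc _ ≤ ∫ x in K, ‖F (u (x, s)) * w' (x, t)‖ := norm_integral_le_integral_norm _
      _ ≤ ∫ x in K, ‖F (u (x, s))‖ * |M'| := by
          refine integral_mono_ae (hFw' s hs t (Ioo_subset_Icc_self ht)).norm
            ((hFi s hs).norm.mul_const _) (hKm.mono fun x hx => ?_)
          simp only [norm_mul]
          exact mul_le_mul_of_nonneg_left
            ((hM' (x, t) ⟨hx, Ioo_subset_Icc_self ht⟩).trans (le_abs_self _)) (norm_nonneg _)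
      _ ≤ C * |M'| := by
          rw [integral_mul_const]
          exact mul_le_mul_of_nonneg_right h3 (abs_nonneg _)

/-- Powers `g ^ p`, `p > 2`, of smooth functions `g ≥ 0` are not smooth in general, but bounded
limits, together with their gradients, of the smooth functions `(g² + σ²)^(p/2) - σ^p`. -/
theorem exists_smooth_approx_rpow {N : ℕ} {K : Set (Space N)} (hK : IsCompact K) {p : ℝ}
    (hp : 2 < p) {g : Space N → ℝ} (hg : ContDiff ℝ ∞ g) (hg0 : ∀ x, 0 ≤ g x)
    (hgK : ∀ x ∉ K, g x = 0) :
    ∃ (wk : ℕ → Space N → ℝ) (M : ℝ), (∀ k, ContDiff ℝ ∞ (wk k)) ∧ (∀ k x, 0 ≤ wk k x) ∧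
      (∀ k x, wk k x ≤ M) ∧ (∀ k, ∀ x ∉ K, wk k x = 0) ∧ (∀ k x, ‖gradient (wk k) x‖ ≤ M) ∧
      (∀ x, Tendsto (fun k => wk k x) atTop (𝓝 (g x ^ p))) ∧
      (∀ x, Tendsto (fun k => gradient (wk k) x) atTop
        (𝓝 ((p * g x ^ (p - 1)) • gradient g x))) := by
  set σ : ℕ → ℝ := fun k => 1 / (k + 1) with hσ
  have hσ0 : ∀ k, 0 < σ k := fun k => by simp only [hσ]; positivity
  have hσ1 : ∀ k, σ k ≤ 1 := fun k => by
    simp only [hσ]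
    rw [div_le_one (by positivity)]
    linarith [(Nat.cast_nonneg k : (0 : ℝ) ≤ k)]
  have hσl : Tendsto σ atTop (𝓝 0) := tendsto_one_div_add_atTop_nhds_zero_nat
  have hbase : ∀ k x, 0 < g x ^ 2 + σ k ^ 2 := fun k x => by have := hσ0 k; positivity
  have hσp : ∀ k, (σ k ^ 2) ^ (p / 2) = σ k ^ p := fun k => by
    rw [← Real.rpow_natCast, ← Real.rpow_mul (hσ0 k).le]; congr 1; push_cast; ring
  set wk : ℕ → Space N → ℝ := fun k x => (g x ^ 2 + σ k ^ 2) ^ (p / 2) - σ k ^ p with hwk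
  have hgrad : ∀ k x, gradient (wk k) x =
      (p * (g x ^ 2 + σ k ^ 2) ^ (p / 2 - 1) * g x) • gradient g x := by
    intro k x
    have h1 : HasFDerivAt g (fderiv ℝ g x) x := (hg.differentiable (by simp) x).hasFDerivAt
    have h2 := (((h1.pow 2).add_const (σ k ^ 2)).rpow_const (p := p / 2)
      (Or.inl (hbase k x).ne')).sub_const (σ k ^ p)
    have h3 : fderiv ℝ (wk k) x = _ := h2.fderiv
    rw [gradient, h3, gradient]
    simp only [map_smulₛₗ, smul_smul]
    simp
    ring_nf
  obtain ⟨c, hc⟩ := hK.exists_bound_of_continuousOn hg.continuous.continuousOn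
  obtain ⟨c', hc'⟩ := hK.exists_bound_of_continuousOn (continuous_gradient hg).continuousOn
  have hgc : ∀ x, g x ≤ |c| := fun x => by
    by_cases hx : x ∈ K
    · exact (le_abs_self _).trans ((hc x hx).trans (le_abs_self _))
    · rw [hgK x hx]; exact abs_nonneg _
  have hgc' : ∀ x, ‖gradient g x‖ ≤ |c'| := fun x => by
    by_cases hx : x ∈ K
    · exact (hc' x hx).trans (le_abs_self _)
    · rw [gradient_eq_zero_of_notMem hK.isClosed hgK hx, norm_zero]; exact abs_nonneg _
  have hb : ∀ k x, g x ^ 2 + σ k ^ 2 ≤ |c| ^ 2 + 1 := fun k x => by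
    have h1 := pow_le_pow_left₀ (hg0 x) (hgc x) 2
    have h2 := pow_le_one₀ (hσ0 k).le (hσ1 k) (n := 2)
    linarith
  set M := max ((|c| ^ 2 + 1) ^ (p / 2)) (p * (|c| ^ 2 + 1) ^ (p / 2 - 1) * |c| * |c'|)
  refine ⟨wk, M, fun k => ?_, fun k x => ?_, fun k x => ?_, fun k x hx => ?_, fun k x => ?_,
    fun x => ?_, fun x => ?_⟩
  · exact ((((hg.pow 2).add contDiff_const).rpow_const_of_ne fun x => (hbase k x).ne')).sub
      contDiff_const
  · simp only [hwk]
    rw [sub_nonneg, ← hσp]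
    exact Real.rpow_le_rpow (by positivity) (by nlinarith [sq_nonneg (g x)]) (by linarith)
  · refine le_trans ?_ (le_max_left _ _)
    have h1 := Real.rpow_le_rpow (hbase k x).le (hb k x) (by linarith : 0 ≤ p / 2)
    have h2 := Real.rpow_nonneg (hσ0 k).le p
    simp only [hwk]
    linarith
  · simp only [hwk, hgK x hx]
    rw [zero_pow two_ne_zero, zero_add, hσp, sub_self]
  · refine le_trans ?_ (le_max_right _ _)
    have h1 := Real.rpow_le_rpow (hbase k x).le (hb k x) (by linarith : 0 ≤ p / 2 - 1)
    have h2 := Real.rpow_nonneg (hbase k x).le (p / 2 - 1)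
    have h3 := hg0 x
    rw [hgrad, norm_smul, Real.norm_of_nonneg (by positivity)]
    gcongr
    · exact hgc x
    · exact hgc' x
  · have h1 : Tendsto (fun k => (g x ^ 2 + σ k ^ 2) ^ (p / 2) - σ k ^ p) atTop
        (𝓝 ((g x ^ 2 + 0 ^ 2) ^ (p / 2) - 0 ^ p)) :=
      ((tendsto_const_nhds.add (hσl.pow 2)).rpow_const (Or.inr (by linarith))).sub
        (hσl.rpow_const (Or.inr (by linarith)))
    have h2 : (g x ^ 2) ^ (p / 2) = g x ^ p := by
      rw [← Real.rpow_natCast, ← Real.rpow_mul (hg0 x)]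
      congr 1
      push_cast
      ring
    rwa [Real.zero_rpow (by linarith), zero_pow two_ne_zero, add_zero, sub_zero, h2] at h1
  · simp only [hgrad]
    refine Tendsto.smul_const ?_ _
    have h1 : Tendsto (fun k => p * (g x ^ 2 + σ k ^ 2) ^ (p / 2 - 1) * g x) atTop
        (𝓝 (p * (g x ^ 2 + 0 ^ 2) ^ (p / 2 - 1) * g x)) :=
      (((tendsto_const_nhds.add (hσl.pow 2)).rpow_const
        (Or.inr (by linarith))).const_mul p).mul_const _
    convert! h1 using 2
    rw [zero_pow two_ne_zero, add_zero, mul_assoc]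
    congr 1
    rcases (hg0 x).eq_or_lt with h0 | h0
    · rw [← h0, mul_zero, Real.zero_rpow (by linarith)]
    · rw [← Real.rpow_natCast, ← Real.rpow_mul h0.le]
      nth_rw 3 [← Real.rpow_one (g x)]
      rw [← Real.rpow_add h0]
      congr 1
      push_cast
      ring

/-! ### The regularised power and its primitive -/

/-- The regularisation `(s₊ ^ α + δ) ^ κ` of `s ^ (α κ)`, a bounded nonincreasing function of `s`
when `κ ≤ 0 < δ`. It is a smooth function of `s ^ α`, the power of the solution that has a weak
gradient. -/
noncomputable def regPower (α κ δ s : ℝ) : ℝ := (max s 0 ^ α + δ) ^ κ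

/-- The primitive of `regPower` vanishing at `0`, a concave Lipschitz function. -/
noncomputable def regPrimitive (α κ δ r : ℝ) : ℝ := ∫ s in (0 : ℝ)..r, regPower α κ δ s

section RegPower

variable {α κ δ : ℝ}

theorem continuous_regPower (hα : 0 < α) (hδ : 0 < δ) : Continuous (regPower α κ δ) :=
  (((continuous_id.max continuous_const).rpow_const fun _ => Or.inr hα.le).add
    continuous_const).rpow_const fun s => Or.inl
      (add_pos_of_nonneg_of_pos (Real.rpow_nonneg (le_max_right s 0) α) hδ).ne'

theorem antitone_regPower (hα : 0 < α) (hκ : κ ≤ 0) (hδ : 0 < δ) :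
    Antitone (regPower α κ δ) := fun s t hst => by
  have h1 := Real.rpow_nonneg (le_max_right s 0) α
  have h2 := Real.rpow_le_rpow (le_max_right s 0) (max_le_max_right 0 hst) hα.le
  exact Real.rpow_le_rpow_of_nonpos (by linarith) (by linarith) hκ

theorem abs_regPower_le (hκ : κ ≤ 0) (hδ : 0 < δ) (s : ℝ) : |regPower α κ δ s| ≤ δ ^ κ := by
  have h1 := Real.rpow_nonneg (le_max_right s 0) α
  rw [regPower, abs_of_nonneg (Real.rpow_nonneg (by linarith) _)]
  exact Real.rpow_le_rpow_of_nonpos hδ (by linarith) hκ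

theorem lipschitzWith_regPrimitive (hα : 0 < α) (hκ : κ ≤ 0) (hδ : 0 < δ) :
    LipschitzWith (δ ^ κ).toNNReal (regPrimitive α κ δ) := by
  have hd : ∀ r, HasDerivAt (regPrimitive α κ δ) (regPower α κ δ r) r := fun r =>
    ((continuous_regPower hα hδ).integral_hasStrictDerivAt 0 r).hasDerivAt
  refine lipschitzWith_of_nnnorm_deriv_le (fun r => (hd r).differentiableAt) fun r => ?_
  rw [(hd r).deriv, ← NNReal.coe_le_coe, Real.coe_toNNReal _ (Real.rpow_nonneg hδ.le _)]
  exact abs_regPower_le hκ hδ r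

/-- Concavity of the primitive. -/
theorem regPower_mul_sub_le (hα : 0 < α) (hκ : κ ≤ 0) (hδ : 0 < δ) (x y : ℝ) :
    regPower α κ δ y * (y - x) ≤ regPrimitive α κ δ y - regPrimitive α κ δ x := by
  have hi : ∀ a b, IntervalIntegrable (regPower α κ δ) volume a b := fun a b =>
    (continuous_regPower hα hδ).intervalIntegrable a b
  rw [regPrimitive, regPrimitive, intervalIntegral.integral_interval_sub_left (hi _ _) (hi _ _)]
  rcases le_total x y with h | h
  · have := intervalIntegral.integral_mono_on h (intervalIntegrable_const (c := regPower α κ δ y))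
      (hi x y) fun s hs => antitone_regPower hα hκ hδ hs.2
    rw [intervalIntegral.integral_const, smul_eq_mul] at this
    linarith
  · have := intervalIntegral.integral_mono_on h (hi y x)
      (intervalIntegrable_const (c := regPower α κ δ y))
      fun s hs => antitone_regPower hα hκ hδ hs.1
    rw [intervalIntegral.integral_const, smul_eq_mul] at this
    rw [intervalIntegral.integral_symm]
    linarith

end RegPower

theorem regPower_of_nonneg {α κ δ s : ℝ} (hs : 0 ≤ s) :
    regPower α κ δ s = (s ^ α + δ) ^ κ := by
  rw [regPower, max_eq_left hs]

theorem deriv_add_const_rpow (κ δ r : ℝ) :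
    deriv (fun r => (r + δ) ^ κ) r = κ * (r + δ) ^ (κ - 1) := by
  rw [deriv_comp_add_const (f := fun r => r ^ κ), Real.deriv_rpow_const]

/-! ### The regularised inequality -/

theorem ae_ae_slice {α β : Type*} [MeasurableSpace α] [MeasurableSpace β] {μ : Measure α}
    {ν : Measure β} [SFinite μ] [SFinite ν] {P : α × β → Prop} (h : ∀ᵐ z ∂μ.prod ν, P z) :
    ∀ᵐ t ∂ν, ∀ᵐ x ∂μ, P (x, t) :=
  Measure.ae_ae_of_ae_prod (p := fun z : β × α => P z.swap)
    (Measure.measurePreserving_swap.quasiMeasurePreserving.ae h)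

/-- The gradient `D(b(v) φ^p)` for `v = u ^ α`, `Dv = G` and `b(v) = (v + δ) ^ κ`. -/
noncomputable def regGrad {N : ℕ} (α κ δ p : ℝ) (u : Space N × ℝ → ℝ)
    (G : Space N × ℝ → Space N) (φ : Space N × ℝ → ℝ) (z : Space N × ℝ) : Space N :=
  (κ * (u z ^ α + δ) ^ (κ - 1) * φ z ^ p) • G z +
    (u z ^ α + δ) ^ κ • ((p * φ z ^ (p - 1)) • spaceGrad φ z)

theorem continuous_timeDeriv {N : ℕ} {φ : Space N × ℝ → ℝ} (hφ : ContDiff ℝ ∞ φ) :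
    Continuous (timeDeriv φ) := by
  have h1 : timeDeriv φ = fun z => fderiv ℝ φ z (0, 1) := by
    ext z
    have h2 : HasDerivAt (fun s : ℝ => ((z.1, s) : Space N × ℝ)) (0, 1) z.2 :=
      (hasDerivAt_const z.2 z.1).prodMk (hasDerivAt_id z.2)
    exact ((hφ.differentiable (by simp) z).hasFDerivAt.comp_hasDerivAt z.2 h2).deriv
  rw [h1]
  exact (hφ.continuous_fderiv (by simp)).clm_apply continuous_const

theorem hasDerivAt_time {N : ℕ} {φ : Space N × ℝ → ℝ} (hφ : ContDiff ℝ ∞ φ) (x : Space N)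
    (t : ℝ) : HasDerivAt (fun s => φ (x, s)) (timeDeriv φ (x, t)) t :=
  ((hφ.comp (contDiff_const.prodMk contDiff_id : ContDiff ℝ ∞ fun s : ℝ => (x, s))).differentiable
    (by simp) t).hasDerivAt

theorem hasDerivAt_time_rpow {N : ℕ} {φ : Space N × ℝ → ℝ} (hφ : ContDiff ℝ ∞ φ) {p : ℝ}
    (hp : 1 ≤ p) (x : Space N) (t : ℝ) : HasDerivAt (fun s => φ (x, s) ^ p)
      (timeDeriv φ (x, t) * p * φ (x, t) ^ (p - 1)) t :=
  (hasDerivAt_time hφ x t).rpow_const (Or.inr hp)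

theorem continuous_spaceGrad {N : ℕ} {φ : Space N × ℝ → ℝ} (hφ : ContDiff ℝ ∞ φ) :
    Continuous (spaceGrad φ) := by
  have h1 : spaceGrad φ = fun z => (InnerProductSpace.toDual ℝ (Space N)).symm
      ((fderiv ℝ φ z).comp (ContinuousLinearMap.inl ℝ (Space N) ℝ)) := by
    ext1 z
    have h2 : HasFDerivAt (fun y : Space N => (y, z.2)) (ContinuousLinearMap.inl ℝ (Space N) ℝ)
        z.1 := hasFDerivAt_prodMk_left z.1 z.2
    rw [spaceGrad, gradient]
    congr 1
    exact ((hφ.differentiable (by simp) z).hasFDerivAt.comp z.1 h2).fderiv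
  rw [h1]
  exact (InnerProductSpace.toDual ℝ (Space N)).symm.continuous.comp
    ((hφ.continuous_fderiv (by simp)).clm_comp continuous_const)

section Regularized

variable {N : ℕ} {E K : Set (Space N)} {T₁ T₂ p q α κ δ t₁ t₂ : ℝ} {u : Space N × ℝ → ℝ}
  {G B : Space N × ℝ → Space N} {φ : Space N × ℝ → ℝ}

theorem memLp_regGrad (hp : 2 < p) (hK : IsCompact K)
    (hsob : MemLpLocSobolev p E T₁ T₂ (fun z => u z ^ α) G)
    (hupos : ∀ᵐ z ∂(volume.restrict (E ×ˢ Ioo T₁ T₂)), 0 < u z)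
    (hκ : κ ≤ 0) (hδ : 0 < δ) (hφ : ContDiff ℝ ∞ φ) (hKE : K ⊆ E)
    (h₁ : T₁ < t₁) (h₂ : t₂ < T₂) :
    MemLp (regGrad α κ δ p u G φ) (ENNReal.ofReal p) (volume.restrict (K ×ˢ Icc t₁ t₂)) := by
  have hcpt : IsCompact (K ×ˢ Icc t₁ t₂) := hK.prod isCompact_Icc
  have : IsFiniteMeasure ((volume : Measure (Space N × ℝ)).restrict (K ×ˢ Icc t₁ t₂)) :=
    ⟨by rw [Measure.restrict_apply_univ]; exact hcpt.measure_lt_top⟩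
  have hpos : ∀ᵐ z ∂(volume.restrict (K ×ˢ Icc t₁ t₂)), 0 < u z :=
    ae_mono (Measure.restrict_mono_set _ (prod_mono hKE
      fun t (ht : t ∈ Icc t₁ t₂) => mem_Ioo.2 ⟨h₁.trans_le ht.1, ht.2.trans_lt h₂⟩)) hupos
  have hmem : ∀ᵐ z ∂(volume.restrict (K ×ˢ Icc t₁ t₂)), z ∈ K ×ˢ Icc t₁ t₂ :=
    ae_restrict_mem (hK.measurableSet.prod measurableSet_Icc)
  have hv := (hsob.memLp K t₁ t₂ hK hKE h₁ h₂).1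
  have hG := hsob.memLp_grad K t₁ t₂ hK hKE h₁ h₂
  have hvm : ∀ e : ℝ, AEStronglyMeasurable (fun z => (u z ^ α + δ) ^ e)
      (volume.restrict (K ×ˢ Icc t₁ t₂)) := fun e =>
    ((hv.aemeasurable.add_const δ).pow_const e).aestronglyMeasurable
  have hw : Continuous fun z => φ z ^ p := hφ.continuous.rpow_const fun _ => Or.inr (by linarith)
  have hw' : Continuous fun z => (p * φ z ^ (p - 1)) • spaceGrad φ z :=
    (continuous_const.mul (hφ.continuous.rpow_const fun _ => Or.inr (by linarith))).smul
      (continuous_spaceGrad hφ)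
  obtain ⟨M, hM⟩ := hcpt.exists_bound_of_continuousOn hw.continuousOn
  obtain ⟨M', hM'⟩ := hcpt.exists_bound_of_continuousOn hw'.continuousOn
  have hbound : ∀ e : ℝ, e ≤ 0 → ∀ z, 0 < u z → ‖(u z ^ α + δ) ^ e‖ ≤ δ ^ e := fun e he z hz => by
    have h1 := Real.rpow_nonneg hz.le α
    rw [Real.norm_of_nonneg (Real.rpow_nonneg (by linarith) _)]
    exact Real.rpow_le_rpow_of_nonpos hδ (by linarith) he
  refine MemLp.add ?_ ?_
  · refine hG.of_le_mul (c := |κ| * δ ^ (κ - 1) * M) ?_ ?_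
    · exact (((hvm (κ - 1)).const_mul κ).mul hw.aestronglyMeasurable).smul hG.1
    · filter_upwards [hpos, hmem] with z hz hzm
      rw [norm_smul, norm_mul, norm_mul, Real.norm_eq_abs κ]
      gcongr
      · exact hbound _ (by linarith) z hz
      · exact hM z hzm
  · refine MemLp.of_bound (C := δ ^ κ * M') ((hvm κ).smul hw'.aestronglyMeasurable) ?_
    filter_upwards [hpos, hmem] with z hz hzm
    rw [norm_smul]
    exact mul_le_mul (hbound κ hκ z hz) (hM' z hzm) (norm_nonneg _) (by positivity)

/-- The inequality between the slices at times `t - h` and `t`, tested with `b(v) φ^p` frozen at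
time `t`. Testing at the later time and concavity of the primitive `F` give the time difference of
`F(u)` with the right sign, so that no time derivative of `u` is needed. -/
theorem ae_regularized_slice_inequality (hp : 2 < p) (hpq : q.HolderConjugate p) (hE : IsOpen E)
    (hK : IsCompact K) (hKE : K ⊆ E) (hu : MemContLocL2 E T₁ T₂ u)
    (hum : AEStronglyMeasurable u (volume.restrict (E ×ˢ Ioo T₁ T₂)))
    (hupos : ∀ᵐ z ∂(volume.restrict (E ×ˢ Ioo T₁ T₂)), 0 < u z)
    (hsob : MemLpLocSobolev p E T₁ T₂ (fun z => u z ^ α) G)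
    (hB : ∀ a b, T₁ < a → b < T₂ → MemLp B (ENNReal.ofReal q) (volume.restrict (K ×ˢ Icc a b)))
    (hweak : ∀ φ : Space N × ℝ → ℝ, IsTestFunction (E ×ˢ Ioo T₁ T₂) φ → (∀ z, 0 ≤ φ z) →
      0 ≤ -(∫ z in E ×ˢ Ioo T₁ T₂, u z * timeDeriv φ z) +
        ∫ z in E ×ˢ Ioo T₁ T₂, inner ℝ (B z) (spaceGrad φ z))
    (hα : 0 < α) (hκ : κ ≤ 0) (hδ : 0 < δ) (hφ : ContDiff ℝ ∞ φ)
    (hφ0 : ∀ x, ∀ t ∈ Ioc t₁ t₂, 0 ≤ φ (x, t)) (hφK : ∀ x ∉ K, ∀ t ∈ Ioc t₁ t₂, φ (x, t) = 0)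
    (h₂ : t₂ < T₂) {h : ℝ} (hh : 0 < h) (h₁ : T₁ < t₁ - h) :
    ∀ᵐ t ∂(volume.restrict (Ioc t₁ t₂)),
      0 ≤ ((∫ x in K, regPrimitive α κ δ (u (x, t)) * φ (x, t) ^ p) -
        ∫ x in K, regPrimitive α κ δ (u (x, t - h)) * φ (x, t) ^ p) +
        ∫ z in K ×ˢ Ioc (t - h) t, inner ℝ (B z) (regGrad α κ δ p u G φ (z.1, t)) := by
  obtain ⟨K', hK', hKK', hK'E⟩ := exists_compact_between hK hE hKE
  have hsub : Ioc t₁ t₂ ⊆ Ioo T₁ T₂ := fun t ht => ⟨by linarith [ht.1], ht.2.trans_lt h₂⟩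
  have hpos : ∀ᵐ t ∂(volume.restrict (Ioc t₁ t₂)), ∀ᵐ x ∂(volume.restrict K'), 0 < u (x, t) := by
    refine ae_ae_slice (P := fun z => 0 < u z) ?_
    rw [Measure.prod_restrict, ← Measure.volume_eq_prod]
    exact ae_mono (Measure.restrict_mono_set _ (prod_mono hK'E hsub)) hupos
  have hgrad : ∀ᵐ t ∂(volume.restrict (Ioc t₁ t₂)),
      IsWeakGradient E (fun x => u (x, t) ^ α) (fun x => G (x, t)) :=
    ae_mono (Measure.restrict_mono_set _ hsub) hsob.weakGrad
  have hG : ∀ᵐ t ∂(volume.restrict (Ioc t₁ t₂)),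
      MemLp (fun x => G (x, t)) (ENNReal.ofReal p) (volume.restrict K') := by
    refine MemLp.ae_slice (by linarith) ?_
    rw [Measure.prod_restrict, ← Measure.volume_eq_prod]
    exact (hsob.memLp_grad K' t₁ t₂ hK' hK'E (by linarith) h₂).mono_measure
      (Measure.restrict_mono_set _ (prod_mono Subset.rfl Ioc_subset_Icc_self))
  filter_upwards [hpos, hgrad, hG, ae_restrict_mem measurableSet_Ioc] with t hpos hgrad hG ht
  have htT : t ∈ Ioo T₁ T₂ := hsub ht
  have hthT : t - h ∈ Ioo T₁ T₂ := ⟨by linarith [ht.1], by linarith [htT.2]⟩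
  have hgs : ContDiff ℝ ∞ fun x => φ (x, t) := hφ.comp (contDiff_id.prodMk contDiff_const)
  obtain ⟨wk, M₀, w1, w2, w3, w4, w5, w6, w7⟩ :=
    exists_smooth_approx_rpow hK hp hgs (fun x => hφ0 x t ht) (fun x hx => hφK x hx t ht)
  set M := max M₀ (max (δ ^ κ) (|κ| * δ ^ (κ - 1)))
  have hBt : MemLp B (ENNReal.ofReal q) (volume.restrict (K ×ˢ Ioc (t - h) t)) :=
    (hB (t - h) t hthT.1 htT.2).mono_measure
      (Measure.restrict_mono_set _ (prod_mono Subset.rfl Ioc_subset_Icc_self))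
  set Λ : (Space N → Space N) → ℝ := fun X => ∫ z in K ×ˢ Ioc (t - h) t, inner ℝ (B z) (X z.1)
    with hΛ
  have hprod : (volume : Measure (Space N × ℝ)).restrict (K ×ˢ Ioc (t - h) t) =
      (volume.restrict K).prod (volume.restrict (Ioc (t - h) t)) := by
    rw [Measure.prod_restrict, ← Measure.volume_eq_prod]
  have hbase : ∀ r : ℝ, 0 ≤ r → 0 < r + δ := fun r hr => by linarith
  have main := (nonneg_of_forall_testFunction (p := p) (M := M) (by linarith) hK hK' hKK' hK'E
    hgrad (hpos.mono fun x hx => Real.rpow_nonneg hx.le _) hG (b := fun r => (r + δ) ^ κ)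
    (w := fun x => φ (x, t) ^ p)
    (w' := fun x => (p * φ (x, t) ^ (p - 1)) • spaceGrad φ (x, t))
    (fun r hr => (contDiffAt_id.add contDiffAt_const).rpow_const_of_ne (hbase r hr).ne')
    (fun r hr => Real.rpow_nonneg (hbase r hr).le _)
    (fun r hr => (Real.rpow_le_rpow_of_nonpos hδ (by linarith) hκ).trans
      ((le_max_left _ _).trans (le_max_right _ _)))
    (fun r hr => by
      rw [deriv_add_const_rpow, abs_mul, abs_of_nonneg (Real.rpow_nonneg (hbase r hr).le _)]
      exact (mul_le_mul_of_nonneg_left (Real.rpow_le_rpow_of_nonpos hδ (by linarith)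
        (by linarith)) (abs_nonneg _)).trans ((le_max_right _ _).trans (le_max_right _ _)))
    w1 w2 (fun k x => (w3 k x).trans (le_max_left _ _)) w4
    (fun k x => (w5 k x).trans (le_max_left _ _)) w6 w7
    (W := fun x => u (x, t) - u (x, t - h))
    ((hu.integrableOn_slice hK hKE htT).sub (hu.integrableOn_slice hK hKE hthT))
    (Λ := Λ) (C := (eLpNorm B (ENNReal.ofReal q) (volume.restrict (K ×ˢ Ioc (t - h) t))).toReal *
      (volume.restrict (Ioc (t - h) t) univ ^ (1 / p)).toReal) ?_ ?_).2
  · simp only [deriv_add_const_rpow] at main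
    refine main.trans (add_le_add_left ?_ _)
    have hLip := lipschitzWith_regPrimitive hα hκ hδ
    have hcw : Continuous fun x => φ (x, t) ^ p :=
      hgs.continuous.rpow_const fun _ => Or.inr (by linarith)
    obtain ⟨c, hc⟩ := hK.exists_bound_of_continuousOn hcw.continuousOn
    have hKm : ∀ᵐ x ∂(volume.restrict K), x ∈ K := ae_restrict_mem hK.measurableSet
    have hFi : ∀ s ∈ Ioo T₁ T₂,
        IntegrableOn (fun x => regPrimitive α κ δ (u (x, s)) * φ (x, t) ^ p) K := fun s hs =>
      (hu.integrableOn_comp_slice hK hKE hLip hs).mul_bdd (c := c) hcw.aestronglyMeasurable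
        (hKm.mono fun x hx => hc x hx)
    have hposK : ∀ᵐ x ∂(volume.restrict K), 0 < u (x, t) :=
      ae_mono (Measure.restrict_mono_set _ (hKK'.trans interior_subset)) hpos
    rw [← integral_sub (hFi t htT) (hFi _ hthT)]
    have hle : ∀ᵐ x ∂(volume.restrict K), (u (x, t) - u (x, t - h)) *
        ((u (x, t) ^ α + δ) ^ κ * φ (x, t) ^ p) =
        regPower α κ δ (u (x, t)) * (u (x, t) - u (x, t - h)) * φ (x, t) ^ p := by
      filter_upwards [hposK] with x hx
      rw [regPower_of_nonneg hx.le]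
      ring
    rw [integral_congr_ae hle]
    refine integral_mono_ae ?_ ((hFi t htT).sub (hFi _ hthT)) (Eventually.of_forall fun x => ?_)
    · have hui := (hu.integrableOn_slice hK hKE htT).sub (hu.integrableOn_slice hK hKE hthT)
      have h1 : IntegrableOn (fun x => regPower α κ δ (u (x, t)) *
          (u (x, t) - u (x, t - h))) K :=
        hui.bdd_mul (c := δ ^ κ) ((continuous_regPower hα hδ).comp_aestronglyMeasurable
          (hu.integrableOn_slice hK hKE htT).1)
          (Eventually.of_forall fun x => abs_regPower_le hκ hδ _)
      exact h1.mul_bdd (c := c) hcw.aestronglyMeasurable (hKm.mono fun x hx => hc x hx)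
    · simp only
      rw [← sub_mul]
      exact mul_le_mul_of_nonneg_right (regPower_mul_sub_le hα hκ hδ _ _)
        (Real.rpow_nonneg (hφ0 x t ht) _)
  · intro X Y hX hY
    simp only [hΛ]
    rw [← integral_sub (integrableOn_inner_slice hpq hBt hX)
      (integrableOn_inner_slice hpq hBt hY)]
    simp only [← inner_sub_right]
    have hXY := hX.sub hY
    have hXY' : MemLp (fun z : Space N × ℝ => (X - Y) z.1) (ENNReal.ofReal p)
        (volume.restrict (K ×ˢ Ioc (t - h) t)) := by
      rw [hprod]
      exact hXY.comp_fst _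
    have h3 := (norm_integral_le_integral_norm _).trans (integral_norm_inner_le hpq hBt hXY')
    refine h3.trans (le_of_eq ?_)
    have hq0 : ENNReal.ofReal p ≠ 0 := by simpa using (by linarith : 0 < p)
    have hqt : (ENNReal.ofReal p).toReal = p := ENNReal.toReal_ofReal (by linarith)
    rw [eLpNorm_eq_lintegral_rpow_enorm_toReal hq0 ENNReal.ofReal_ne_top,
      eLpNorm_eq_lintegral_rpow_enorm_toReal hq0 ENNReal.ofReal_ne_top, hqt, hprod,
      lintegral_prod_symm _ (by
        rw [← hprod]
        exact hXY'.1.enorm.pow_const p)]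
    simp only [lintegral_const]
    rw [ENNReal.mul_rpow_of_nonneg _ _ (by positivity), ENNReal.toReal_mul]
    ring
  · intro ψ hψ hψ0 hψK
    have := slice_inequality hu hum hK hKE (fun a b ha hb =>
      have : IsFiniteMeasure ((volume : Measure (Space N × ℝ)).restrict (K ×ˢ Icc a b)) :=
        ⟨by rw [Measure.restrict_apply_univ]; exact (hK.prod isCompact_Icc).measure_lt_top⟩
      (hB a b ha hb).integrable (by simpa using ENNReal.ofReal_le_ofReal hpq.lt.le))
      hweak hψ hψ0 hψK hthT.1 (by linarith) htT.2
    exact this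

/-- The regularised inequality over `(t₁, t₂]`: the inequalities between the slices at times `t - h`
and `t` are integrated in `t`, divided by `h`, and `h → 0`. -/
theorem regularized_inequality (hp : 2 < p) (hpq : q.HolderConjugate p) (hE : IsOpen E)
    (hK : IsCompact K) (hKE : K ⊆ E) (hu : MemContLocL2 E T₁ T₂ u)
    (hum : AEStronglyMeasurable u (volume.restrict (E ×ˢ Ioo T₁ T₂)))
    (hupos : ∀ᵐ z ∂(volume.restrict (E ×ˢ Ioo T₁ T₂)), 0 < u z)
    (hsob : MemLpLocSobolev p E T₁ T₂ (fun z => u z ^ α) G)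
    (hB : ∀ a b, T₁ < a → b < T₂ → MemLp B (ENNReal.ofReal q) (volume.restrict (K ×ˢ Icc a b)))
    (hweak : ∀ φ : Space N × ℝ → ℝ, IsTestFunction (E ×ˢ Ioo T₁ T₂) φ → (∀ z, 0 ≤ φ z) →
      0 ≤ -(∫ z in E ×ˢ Ioo T₁ T₂, u z * timeDeriv φ z) +
        ∫ z in E ×ˢ Ioo T₁ T₂, inner ℝ (B z) (spaceGrad φ z))
    (hα : 0 < α) (hκ : κ ≤ 0) (hδ : 0 < δ) (hφ : ContDiff ℝ ∞ φ)
    (hφ0 : ∀ x, ∀ t ∈ Ioc t₁ t₂, 0 ≤ φ (x, t)) (hφK : ∀ x ∉ K, ∀ t ∈ Ioc t₁ t₂, φ (x, t) = 0)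
    (h₁ : T₁ < t₁) (h₁₂ : t₁ < t₂) (h₂ : t₂ < T₂) :
    0 ≤ ((∫ x in K, regPrimitive α κ δ (u (x, t₂)) * φ (x, t₂) ^ p) -
        (∫ x in K, regPrimitive α κ δ (u (x, t₁)) * φ (x, t₁) ^ p) -
        ∫ z in K ×ˢ Ioc t₁ t₂, regPrimitive α κ δ (u z) * (timeDeriv φ z * p * φ z ^ (p - 1))) +
      ∫ z in K ×ˢ Ioc t₁ t₂, inner ℝ (B z) (regGrad α κ δ p u G φ z) := by
  obtain ⟨a, ha, hat⟩ := exists_between h₁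
  obtain ⟨ht1, ht2⟩ := hu.tendsto_time_average hum hK hKE (lipschitzWith_regPrimitive hα hκ hδ)
    (w := fun z => φ z ^ p) (w' := fun z => timeDeriv φ z * p * φ z ^ (p - 1))
    (hφ.continuous.rpow_const fun _ => Or.inr (by linarith))
    (((continuous_timeDeriv hφ).mul continuous_const).mul
      (hφ.continuous.rpow_const fun _ => Or.inr (by linarith)))
    (hasDerivAt_time_rpow hφ (by linarith)) h₁ h₁₂ h₂
  obtain ⟨hs1, hs2⟩ := tendsto_space_average hpq hK hat (hB a t₂ ha h₂)
    ((memLp_regGrad hp hK hsob hupos hκ hδ hφ hKE h₁ h₂).mono_measure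
      (Measure.restrict_mono_set _ (prod_mono Subset.rfl Ioc_subset_Icc_self)))
  refine ge_of_tendsto (ht2.add hs2) ?_
  filter_upwards [ht1, hs1, Ioo_mem_nhdsGT (sub_pos.2 h₁)] with h ht hs hh
  rw [← mul_add, ← integral_add ht hs]
  refine mul_nonneg (inv_nonneg.2 hh.1.le) (integral_nonneg_of_ae ?_)
  exact ae_regularized_slice_inequality hp hpq hE hK hKE hu hum hupos hsob hB hweak hα hκ hδ hφ hφ0
    hφK h₂ hh.1 (by linarith [hh.2])

end Regularized

/-! ### Absorbing the cross term -/

/-- Young's inequality in the form used to absorb the cross term into the energy. -/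
theorem mul_rpow_sub_one_mul_le {p s k a c : ℝ} (hp : 1 < p) (hs : 0 < s) (hk : 0 ≤ k) (ha : 0 ≤ a)
    (hc : 0 ≤ c) : k * (a ^ (p - 1) * c) ≤ s * a ^ p + k ^ p * s ^ (1 - p) * c ^ p := by
  have hsplit : ∀ x : ℝ, 0 ≤ x → x ^ p = x ^ (p - 1) * x := fun x hx => by
    rw [← Real.rpow_add_one' hx (by linarith), sub_add_cancel]
  have hap := Real.rpow_nonneg ha (p - 1)
  rcases le_total (k * c) (s * a) with h | h
  · have h1 : 0 ≤ k ^ p * s ^ (1 - p) * c ^ p := by positivity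
    rw [hsplit a ha]
    nlinarith [mul_le_mul_of_nonneg_left h hap]
  · have h1 : a ≤ k * c / s := by rw [le_div_iff₀ hs]; linarith
    have h2 : a ^ (p - 1) ≤ (k * c / s) ^ (p - 1) := Real.rpow_le_rpow ha h1 (by linarith)
    have h3 : (k * c / s) ^ (p - 1) * (k * c) = k ^ p * s ^ (1 - p) * c ^ p := by
      have hkc : 0 ≤ k * c := by positivity
      rw [Real.div_rpow hkc hs.le, div_mul_eq_mul_div, ← hsplit _ hkc, Real.mul_rpow hk hc,
        show (1 - p) = -(p - 1) by ring, Real.rpow_neg hs.le]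
      ring
    have h4 : 0 ≤ s * a ^ p := by positivity
    have h5 := mul_le_mul_of_nonneg_right h2 (show 0 ≤ k * c by positivity)
    rw [h3] at h5
    linarith

section Energy

variable {N : ℕ} {p κ δ c₀ c₁ : ℝ}

/-- The flux against the gradient of the test function: the lower bound on `b · G` gives the energy
with a negative sign, half of which is spent on the cross term. -/
theorem inner_regGrad_le {α : ℝ} {u : Space N × ℝ → ℝ} {G : Space N × ℝ → Space N}
    {φ : Space N × ℝ → ℝ} {z : Space N × ℝ} {b : Space N} (hp : 2 < p) (hκ : κ < 0) (hδ : 0 ≤ δ)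
    (hc₀ : 0 < c₀) (hc₁ : 0 < c₁) (hu : 0 < u z) (hφ : 0 ≤ φ z)
    (hb : ‖b‖ ≤ c₁ * ‖G z‖ ^ (p - 1)) (hbG : c₀ * ‖G z‖ ^ p ≤ inner ℝ b (G z)) :
    inner ℝ b (regGrad α κ δ p u G φ z) ≤
      (c₁ * p) ^ p * (-κ * c₀ / 2) ^ (1 - p) *
        ((u z ^ α + δ) ^ (κ + p - 1) * ‖spaceGrad φ z‖ ^ p) -
      -κ * c₀ / 2 * ((u z ^ α + δ) ^ (κ - 1) * ‖G z‖ ^ p * φ z ^ p) := by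
  rw [regGrad, inner_add_right, inner_smul_right, inner_smul_right, inner_smul_right]
  have hv : 0 < u z ^ α + δ := by have := Real.rpow_pos_of_pos hu α; linarith
  set v := u z ^ α + δ
  set g := ‖G z‖
  set d := ‖spaceGrad φ z‖
  have hg : 0 ≤ g := norm_nonneg _
  have hd : 0 ≤ d := norm_nonneg _
  have hp0 : p ≠ 0 := by linarith
  have h1 : κ * v ^ (κ - 1) * φ z ^ p * inner ℝ b (G z) ≤
      κ * v ^ (κ - 1) * φ z ^ p * (c₀ * g ^ p) := by
    refine mul_le_mul_of_nonpos_left hbG ?_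
    exact mul_nonpos_of_nonpos_of_nonneg
      (mul_nonpos_of_nonpos_of_nonneg hκ.le (by positivity)) (by positivity)
  have h2 : inner ℝ b (spaceGrad φ z) ≤ c₁ * g ^ (p - 1) * d :=
    (real_inner_le_norm _ _).trans (mul_le_mul_of_nonneg_right hb hd)
  have h3 : v ^ κ * (p * φ z ^ (p - 1) * inner ℝ b (spaceGrad φ z)) ≤
      v ^ κ * (p * φ z ^ (p - 1) * (c₁ * g ^ (p - 1) * d)) := by gcongr
  -- `a` and `c` are chosen so that `a ^ p` is the energy, `c ^ p` is the cutoff term, and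
  -- `a ^ (p - 1) * c` carries the power `v ^ κ` of the cross term
  have hY := mul_rpow_sub_one_mul_le (p := p) (s := -κ * c₀ / 2) (k := c₁ * p)
    (a := v ^ ((κ - 1) / p) * (g * φ z)) (c := v ^ ((κ + p - 1) / p) * d) (by linarith)
    (by have := mul_pos (neg_pos.2 hκ) hc₀; linarith) (by positivity) (by positivity)
    (by positivity)
  have hva : 0 ≤ v ^ ((κ - 1) / p) := by positivity
  rw [Real.mul_rpow hva (by positivity), Real.mul_rpow hva (by positivity),
    Real.mul_rpow hg hφ, Real.mul_rpow hg hφ, Real.mul_rpow (by positivity) hd,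
    ← Real.rpow_mul hv.le, ← Real.rpow_mul hv.le, ← Real.rpow_mul hv.le, div_mul_cancel₀ _ hp0,
    div_mul_cancel₀ _ hp0] at hY
  have h4 : v ^ κ = v ^ ((κ - 1) / p * (p - 1)) * v ^ ((κ + p - 1) / p) := by
    rw [← Real.rpow_add hv]
    congr 1
    field_simp
    ring
  rw [h4] at h3 ⊢
  nlinarith

variable {E K : Set (Space N)} {T₁ T₂ q α t₁ t₂ : ℝ} {u : Space N × ℝ → ℝ}
  {G B : Space N × ℝ → Space N} {φ : Space N × ℝ → ℝ}

theorem memLp_of_norm_le_rpow {X V W : Type*} [MeasurableSpace X] [NormedAddCommGroup V]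
    [NormedAddCommGroup W] {μ : Measure X} {f : X → V} {g : X → W} {p q c : ℝ} (hp : 1 < p)
    (hpq : q.HolderConjugate p) (hg : MemLp g (ENNReal.ofReal p) μ) (hf : AEStronglyMeasurable f μ)
    (h : ∀ᵐ x ∂μ, ‖f x‖ ≤ c * ‖g x‖ ^ (p - 1)) : MemLp f (ENNReal.ofReal q) μ := by
  have h1 := hg.norm_rpow_div (ENNReal.ofReal (p - 1))
  rw [ENNReal.toReal_ofReal (by linarith), ← ENNReal.ofReal_div_of_pos (by linarith),
    ← hpq.symm.conjugate_eq] at h1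
  refine h1.of_le_mul (c := c) hf (h.mono fun x hx => hx.trans_eq ?_)
  rw [Real.norm_of_nonneg (by positivity)]

theorem integrable_add_const_rpow {X : Type*} [MeasurableSpace X] {μ : Measure X}
    [IsFiniteMeasure μ] {v : X → ℝ} {p e : ℝ} (hp : 0 < p) (he : 0 ≤ e) (hep : e ≤ p)
    (hv : MemLp v (ENNReal.ofReal p) μ) (hv0 : ∀ᵐ x ∂μ, 0 ≤ v x) (hδ : 0 ≤ δ) :
    Integrable (fun x => (v x + δ) ^ e) μ := by
  have h1 : MemLp (fun x => v x + δ) (ENNReal.ofReal p) μ := hv.add (memLp_const δ)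
  have h2 := h1.integrable_norm_rpow (by simpa using hp) ENNReal.ofReal_ne_top
  rw [ENNReal.toReal_ofReal hp.le] at h2
  refine (h2.add (integrable_const 1)).mono'
    (h1.1.aemeasurable.pow_const e).aestronglyMeasurable (hv0.mono fun x hx => ?_)
  have h3 : 0 ≤ v x + δ := by linarith
  simp only [Pi.add_apply]
  rw [Real.norm_of_nonneg h3, Real.norm_of_nonneg (by positivity)]
  rcases le_total (v x + δ) 1 with h | h
  · have := Real.rpow_le_one h3 h he
    have := Real.rpow_nonneg h3 p
    linarith
  · have := Real.rpow_le_rpow_of_exponent_le h hep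
    linarith

/-- The energy inequality at the regularised level. -/
theorem regularized_energy_inequality (hp : 2 < p) (hpq : q.HolderConjugate p) (hE : IsOpen E)
    (hK : IsCompact K) (hKE : K ⊆ E) (hu : MemContLocL2 E T₁ T₂ u)
    (hum : AEStronglyMeasurable u (volume.restrict (E ×ˢ Ioo T₁ T₂)))
    (hupos : ∀ᵐ z ∂(volume.restrict (E ×ˢ Ioo T₁ T₂)), 0 < u z)
    (hsob : MemLpLocSobolev p E T₁ T₂ (fun z => u z ^ α) G)
    (hB : ∀ a b, T₁ < a → b < T₂ → MemLp B (ENNReal.ofReal q) (volume.restrict (K ×ˢ Icc a b)))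
    (hweak : ∀ φ : Space N × ℝ → ℝ, IsTestFunction (E ×ˢ Ioo T₁ T₂) φ → (∀ z, 0 ≤ φ z) →
      0 ≤ -(∫ z in E ×ˢ Ioo T₁ T₂, u z * timeDeriv φ z) +
        ∫ z in E ×ˢ Ioo T₁ T₂, inner ℝ (B z) (spaceGrad φ z))
    (hα : 0 < α) (hκ : κ < 0) (hκp : 0 ≤ κ + p - 1) (hδ : 0 < δ) (hc₀ : 0 < c₀) (hc₁ : 0 < c₁)
    (hBG : ∀ᵐ z ∂(volume.restrict (E ×ˢ Ioo T₁ T₂)),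
      ‖B z‖ ≤ c₁ * ‖G z‖ ^ (p - 1) ∧ c₀ * ‖G z‖ ^ p ≤ inner ℝ (B z) (G z))
    (hφ : ContDiff ℝ ∞ φ)
    (hφ0 : ∀ x, ∀ t ∈ Ioc t₁ t₂, 0 ≤ φ (x, t)) (hφK : ∀ x ∉ K, ∀ t ∈ Ioc t₁ t₂, φ (x, t) = 0)
    (h₁ : T₁ < t₁) (h₁₂ : t₁ < t₂) (h₂ : t₂ < T₂) :
    IntegrableOn (fun z => (u z ^ α + δ) ^ (κ - 1) * ‖G z‖ ^ p * φ z ^ p) (K ×ˢ Ioc t₁ t₂) ∧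
    -κ * c₀ / 2 * (∫ z in K ×ˢ Ioc t₁ t₂, (u z ^ α + δ) ^ (κ - 1) * ‖G z‖ ^ p * φ z ^ p) ≤
      (∫ x in K, regPrimitive α κ δ (u (x, t₂)) * φ (x, t₂) ^ p) -
        (∫ x in K, regPrimitive α κ δ (u (x, t₁)) * φ (x, t₁) ^ p) -
        (∫ z in K ×ˢ Ioc t₁ t₂, regPrimitive α κ δ (u z) * (timeDeriv φ z * p * φ z ^ (p - 1))) +
      (c₁ * p) ^ p * (-κ * c₀ / 2) ^ (1 - p) *
        ∫ z in K ×ˢ Ioc t₁ t₂, (u z ^ α + δ) ^ (κ + p - 1) * ‖spaceGrad φ z‖ ^ p := by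
  have hcpt : IsCompact (K ×ˢ Icc t₁ t₂) := hK.prod isCompact_Icc
  have hle : (volume : Measure (Space N × ℝ)).restrict (K ×ˢ Ioc t₁ t₂) ≤
      volume.restrict (K ×ˢ Icc t₁ t₂) :=
    Measure.restrict_mono_set _ (prod_mono Subset.rfl Ioc_subset_Icc_self)
  have : IsFiniteMeasure ((volume : Measure (Space N × ℝ)).restrict (K ×ˢ Ioc t₁ t₂)) :=
    ⟨(hle univ).trans_lt (by rw [Measure.restrict_apply_univ]; exact hcpt.measure_lt_top)⟩
  have hsub : K ×ˢ Ioc t₁ t₂ ⊆ E ×ˢ Ioo T₁ T₂ := prod_mono hKE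
    fun t (ht : t ∈ Ioc t₁ t₂) => mem_Ioo.2 ⟨h₁.trans ht.1, ht.2.trans_lt h₂⟩
  have hpos : ∀ᵐ z ∂(volume.restrict (K ×ˢ Ioc t₁ t₂)), 0 < u z :=
    ae_mono (Measure.restrict_mono_set volume hsub) hupos
  have hBG' : ∀ᵐ z ∂(volume.restrict (K ×ˢ Ioc t₁ t₂)),
      ‖B z‖ ≤ c₁ * ‖G z‖ ^ (p - 1) ∧ c₀ * ‖G z‖ ^ p ≤ inner ℝ (B z) (G z) :=
    ae_mono (Measure.restrict_mono_set volume hsub) hBG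
  have hmem : ∀ᵐ z ∂((volume : Measure (Space N × ℝ)).restrict (K ×ˢ Ioc t₁ t₂)),
    z ∈ K ×ˢ Ioc t₁ t₂ := ae_restrict_mem (hK.measurableSet.prod measurableSet_Ioc)
  have hv := (hsob.memLp K t₁ t₂ hK hKE h₁ h₂).mono_measure hle
  have hG := (hsob.memLp_grad K t₁ t₂ hK hKE h₁ h₂).mono_measure hle
  have hw : Continuous fun z => φ z ^ p := hφ.continuous.rpow_const fun _ => Or.inr (by linarith)
  have hd : Continuous fun z => ‖spaceGrad φ z‖ ^ p :=
    (continuous_spaceGrad hφ).norm.rpow_const fun _ => Or.inr (by linarith)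
  obtain ⟨M, hM⟩ := hcpt.exists_bound_of_continuousOn hw.continuousOn
  obtain ⟨M', hM'⟩ := hcpt.exists_bound_of_continuousOn hd.continuousOn
  have hmem' : ∀ z ∈ K ×ˢ Ioc t₁ t₂, z ∈ K ×ˢ Icc t₁ t₂ := fun z hz =>
    ⟨hz.1, Ioc_subset_Icc_self hz.2⟩
  have hEn : IntegrableOn (fun z => (u z ^ α + δ) ^ (κ - 1) * ‖G z‖ ^ p * φ z ^ p)
      (K ×ˢ Ioc t₁ t₂) := by
    have h1 := hG.integrable_norm_rpow (by simpa using (by linarith : 0 < p))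
      ENNReal.ofReal_ne_top
    rw [ENNReal.toReal_ofReal (by linarith)] at h1
    have h2 : IntegrableOn (fun z => (u z ^ α + δ) ^ (κ - 1) * ‖G z‖ ^ p) (K ×ˢ Ioc t₁ t₂) := by
      refine h1.bdd_mul (c := δ ^ (κ - 1))
        ((hv.1.aemeasurable.add_const δ).pow_const _).aestronglyMeasurable ?_
      filter_upwards [hpos] with z hz
      have h3 := Real.rpow_nonneg hz.le α
      rw [Real.norm_of_nonneg (Real.rpow_nonneg (by linarith) _)]
      exact Real.rpow_le_rpow_of_nonpos hδ (by linarith) (by linarith)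
    exact h2.mul_bdd (c := M) hw.aestronglyMeasurable (hmem.mono fun z hz => hM z (hmem' z hz))
  have hCut : IntegrableOn (fun z => (u z ^ α + δ) ^ (κ + p - 1) * ‖spaceGrad φ z‖ ^ p)
      (K ×ˢ Ioc t₁ t₂) :=
    (integrable_add_const_rpow (by linarith) hκp (by linarith) hv
      (hpos.mono fun z hz => Real.rpow_nonneg hz.le _) hδ.le).mul_bdd (c := M')
      hd.aestronglyMeasurable (hmem.mono fun z hz => hM' z (hmem' z hz))
  refine ⟨hEn, ?_⟩
  have main := regularized_inequality hp hpq hE hK hKE hu hum hupos hsob hB hweak hα hκ.le hδ hφ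
    hφ0 hφK h₁ h₁₂ h₂
  have hI : Integrable (fun z => inner ℝ (B z) (regGrad α κ δ p u G φ z))
      (volume.restrict (K ×ˢ Ioc t₁ t₂)) :=
    integrable_inner_of_memLp hpq ((hB t₁ t₂ h₁ h₂).mono_measure hle)
      ((memLp_regGrad hp hK hsob hupos hκ.le hδ hφ hKE h₁ h₂).mono_measure hle)
  have hmono := integral_mono_ae hI ((hCut.const_mul ((c₁ * p) ^ p * (-κ * c₀ / 2) ^ (1 - p))).sub
    (hEn.const_mul (-κ * c₀ / 2))) (by
      filter_upwards [hpos, hBG', hmem] with z hz hb hm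
      exact inner_regGrad_le hp hκ hδ.le hc₀ hc₁ hz (hφ0 z.1 z.2 hm.2) hb.1 hb.2)
  simp only [Pi.sub_apply] at hmono
  rw [integral_sub (hCut.const_mul _) (hEn.const_mul _), integral_const_mul,
    integral_const_mul] at hmono
  linarith

end Energy

/-! ### Removing the regularisation -/

section RegPowerLimit

variable {α κ δ r : ℝ}

theorem regPower_le_rpow (hκ : κ ≤ 0) (hδ : 0 ≤ δ) (hr : 0 < r) :
    regPower α κ δ r ≤ r ^ (α * κ) := by
  have h := Real.rpow_pos_of_pos hr α
  rw [regPower_of_nonneg hr.le, Real.rpow_mul hr.le]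
  exact Real.rpow_le_rpow_of_nonpos h (by linarith) hκ

theorem regPower_nonneg (hδ : 0 ≤ δ) (s : ℝ) : 0 ≤ regPower α κ δ s :=
  Real.rpow_nonneg (add_nonneg (Real.rpow_nonneg (le_max_right _ _) _) hδ) _

theorem regPrimitive_nonneg (hδ : 0 ≤ δ) (hr : 0 ≤ r) : 0 ≤ regPrimitive α κ δ r :=
  intervalIntegral.integral_nonneg hr fun _ _ => regPower_nonneg hδ _

theorem integral_rpow_eq (hr : -1 < α * κ) (r : ℝ) :
    ∫ s in (0 : ℝ)..r, s ^ (α * κ) = r ^ (1 + α * κ) / (1 + α * κ) := by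
  rw [integral_rpow (Or.inl hr), Real.zero_rpow (by linarith), sub_zero, add_comm]

theorem regPrimitive_le (hα : 0 < α) (hκ : κ ≤ 0) (h : -1 < α * κ) (hδ : 0 < δ) (hr : 0 ≤ r) :
    regPrimitive α κ δ r ≤ r ^ (1 + α * κ) / (1 + α * κ) := by
  rw [← integral_rpow_eq h, regPrimitive]
  exact intervalIntegral.integral_mono_on_of_le_Ioo hr
    ((continuous_regPower hα hδ).intervalIntegrable _ _)
    (intervalIntegral.intervalIntegrable_rpow' h) fun s hs => regPower_le_rpow hκ hδ.le hs.1

theorem tendsto_regPrimitive (hα : 0 < α) (hκ : κ ≤ 0) (h : -1 < α * κ) (hr : 0 ≤ r) :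
    Tendsto (fun δ => regPrimitive α κ δ r) (𝓝[>] 0) (𝓝 (r ^ (1 + α * κ) / (1 + α * κ))) := by
  rw [← integral_rpow_eq h]
  have hδ : ∀ᶠ δ : ℝ in 𝓝[>] 0, 0 < δ := self_mem_nhdsWithin
  refine intervalIntegral.tendsto_integral_filter_of_dominated_convergence
    (fun s => s ^ (α * κ)) ?_ ?_ (intervalIntegral.intervalIntegrable_rpow' h) ?_
  · filter_upwards [hδ] with δ hδ
    exact (continuous_regPower hα hδ).aestronglyMeasurable
  · filter_upwards [hδ] with δ hδ
    refine Eventually.of_forall fun s hs => ?_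
    rw [uIoc_of_le hr] at hs
    rw [Real.norm_of_nonneg (regPower_nonneg hδ.le _)]
    exact regPower_le_rpow hκ hδ.le hs.1
  · refine Eventually.of_forall fun s hs => ?_
    rw [uIoc_of_le hr] at hs
    have h1 := Real.rpow_pos_of_pos hs.1 α
    simp only [regPower_of_nonneg hs.1.le, Real.rpow_mul hs.1.le]
    have h2 : ContinuousAt (fun δ : ℝ => (s ^ α + δ) ^ κ) 0 :=
      (continuousAt_const.add continuousAt_id).rpow_const (Or.inl (by simpa using h1.ne'))
    have h3 := h2.tendsto
    simp only [add_zero] at h3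
    exact h3.mono_left nhdsWithin_le_nhds

end RegPowerLimit

section Limits

variable {X : Type*} [MeasurableSpace X] {μ : Measure X}

/-- Dominated convergence, with `f ^ (1 + α κ) / (1 + α κ)` as the majorant of the primitives. -/
theorem tendsto_integral_regPrimitive {α κ M : ℝ} {f w : X → ℝ} (hα : 0 < α) (hκ : κ ≤ 0)
    (h : -1 < α * κ) (hf : AEStronglyMeasurable f μ) (hf0 : ∀ᵐ x ∂μ, 0 ≤ f x)
    (hfi : Integrable (fun x => f x ^ (1 + α * κ)) μ) (hw : AEStronglyMeasurable w μ)
    (hwM : ∀ᵐ x ∂μ, ‖w x‖ ≤ M) :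
    Tendsto (fun δ => ∫ x, regPrimitive α κ δ (f x) * w x ∂μ) (𝓝[>] 0)
      (𝓝 ((1 + α * κ)⁻¹ * ∫ x, f x ^ (1 + α * κ) * w x ∂μ)) := by
  rw [← integral_const_mul]
  have hδ : ∀ᶠ δ : ℝ in 𝓝[>] 0, 0 < δ := self_mem_nhdsWithin
  refine tendsto_integral_filter_of_dominated_convergence
    (fun x => f x ^ (1 + α * κ) * ((1 + α * κ)⁻¹ * M)) ?_ ?_ (hfi.mul_const _) ?_
  · filter_upwards [hδ] with δ hδ
    exact ((lipschitzWith_regPrimitive hα hκ hδ).continuous.comp_aestronglyMeasurable hf).mul hw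
  · filter_upwards [hδ] with δ hδ
    filter_upwards [hf0, hwM] with x hx hxM
    rw [norm_mul, Real.norm_of_nonneg (regPrimitive_nonneg hδ.le hx), ← mul_assoc]
    exact mul_le_mul ((regPrimitive_le hα hκ h hδ hx).trans_eq (div_eq_mul_inv _ _)) hxM
      (norm_nonneg _) (mul_nonneg (Real.rpow_nonneg hx _) (inv_nonneg.2 (by linarith)))
  · filter_upwards [hf0] with x hx
    have := (tendsto_regPrimitive hα hκ h hx).mul_const (w x)
    rwa [div_eq_inv_mul, mul_assoc] at this

/-- Fatou's lemma with bounds converging to a real limit. -/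
theorem integral_le_of_tendsto_ae {ι : Type*} {l : Filter ι} [l.NeBot] [l.IsCountablyGenerated]
    {f : ι → X → ℝ} {g : X → ℝ} {R : ι → ℝ} {r : ℝ} (hf : ∀ᶠ i in l, Integrable (f i) μ)
    (hf0 : ∀ᶠ i in l, 0 ≤ᵐ[μ] f i) (hfg : ∀ᵐ x ∂μ, Tendsto (fun i => f i x) l (𝓝 (g x)))
    (hR : Tendsto R l (𝓝 r)) (hfR : ∀ᶠ i in l, ∫ x, f i x ∂μ ≤ R i) :
    Integrable g μ ∧ ∫ x, g x ∂μ ≤ r := by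
  obtain ⟨s, hs⟩ := exists_seq_tendsto l
  have hev := hs.eventually (hf.and (hf0.and hfR))
  obtain ⟨n₀, hn₀⟩ := eventually_atTop.1 hev
  set F : ℕ → X → ℝ := fun n => f (s (n + n₀))
  have hF := fun n => hn₀ (n + n₀) (by omega)
  have hs' : Tendsto (fun n => s (n + n₀)) atTop l := hs.comp (tendsto_add_atTop_nat n₀)
  have hFg : ∀ᵐ x ∂μ, Tendsto (fun n => F n x) atTop (𝓝 (g x)) :=
    hfg.mono fun x hx => hx.comp hs'
  have hgm : AEStronglyMeasurable g μ :=
    aestronglyMeasurable_of_tendsto_ae atTop (fun n => (hF n).1.1) hFg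
  have hg0 : 0 ≤ᵐ[μ] g := by
    have h1 : ∀ᵐ x ∂μ, ∀ n, 0 ≤ F n x := ae_all_iff.2 fun n => (hF n).2.1
    filter_upwards [h1, hFg] with x h1 h2
    exact ge_of_tendsto' h2 h1
  have h3 : ∫⁻ x, ENNReal.ofReal (g x) ∂μ ≤ ENNReal.ofReal r := by
    have h4 : ∫⁻ x, ENNReal.ofReal (g x) ∂μ =
        ∫⁻ x, liminf (fun n => ENNReal.ofReal (F n x)) atTop ∂μ :=
      lintegral_congr_ae (hFg.mono fun x hx => (ENNReal.tendsto_ofReal hx).liminf_eq.symm)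
    rw [h4]
    refine (lintegral_liminf_le' fun n => (hF n).1.1.aemeasurable.ennreal_ofReal).trans ?_
    rw [← (ENNReal.tendsto_ofReal (hR.comp hs')).liminf_eq]
    refine liminf_le_liminf (Eventually.of_forall fun n => ?_)
    rw [← ofReal_integral_eq_lintegral_ofReal (hF n).1 (hF n).2.1]
    exact ENNReal.ofReal_le_ofReal (hF n).2.2
  have hgi : Integrable g μ := ⟨hgm, by
    rw [hasFiniteIntegral_iff_ofReal hg0]
    exact h3.trans_lt ENNReal.ofReal_lt_top⟩
  refine ⟨hgi, ?_⟩
  have hr : 0 ≤ r := ge_of_tendsto' (hR.comp hs') fun n =>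
    (integral_nonneg_of_ae (hF n).2.1).trans (hF n).2.2
  rw [← ofReal_integral_eq_lintegral_ofReal hgi hg0] at h3
  exact (ENNReal.ofReal_le_ofReal_iff hr).1 h3

end Limits

section Energy

variable {N : ℕ} {E K : Set (Space N)} {T₁ T₂ p q α κ c₀ c₁ t₁ t₂ : ℝ} {u : Space N × ℝ → ℝ}
  {G B : Space N × ℝ → Space N} {φ : Space N × ℝ → ℝ}

/-- Positivity almost everywhere in space-time passes to every time slice, by continuity in time. -/
theorem MemContLocL2.ae_nonneg_slice (hu : MemContLocL2 E T₁ T₂ u) (hK : IsCompact K) (hKE : K ⊆ E)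
    (hupos : ∀ᵐ z ∂(volume.restrict (E ×ˢ Ioo T₁ T₂)), 0 < u z) {t : ℝ} (ht : t ∈ Ioo T₁ T₂) :
    ∀ᵐ x ∂(volume.restrict K), 0 ≤ u (x, t) := by
  have hF : LipschitzWith 1 fun s : ℝ => max (-s) 0 :=
    (LipschitzWith.id.neg).max_const 0
  have hc := hu.continuousOn_integral hK hKE hF (θ := fun _ => 1) (M := 1)
    aestronglyMeasurable_const (by simp)
  simp only [mul_one] at hc
  have hpos : ∀ᵐ t ∂(volume.restrict (Ioo T₁ T₂)), ∀ᵐ x ∂(volume.restrict K), 0 < u (x, t) := by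
    refine ae_ae_slice (P := fun z => 0 < u z) ?_
    rw [Measure.prod_restrict, ← Measure.volume_eq_prod]
    exact ae_mono (Measure.restrict_mono_set _ (prod_mono hKE Subset.rfl)) hupos
  have hz := Measure.eqOn_open_of_ae_eq (g := fun _ => (0 : ℝ)) (hpos.mono fun t ht =>
    integral_eq_zero_of_ae (ht.mono fun x hx => max_eq_right (neg_nonpos.2 hx.le))) isOpen_Ioo hc
    continuousOn_const ht
  have h2 := (integral_eq_zero_iff_of_nonneg (fun x => le_max_right _ _)
    (hu.integrableOn_comp_slice hK hKE hF ht)).1 hz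
  filter_upwards [h2] with x hx
  have h3 : max (-u (x, t)) 0 = 0 := hx
  have := le_max_left (-u (x, t)) 0
  linarith

theorem integrable_rpow_of_integrable {X : Type*} [MeasurableSpace X] {μ : Measure X}
    [IsFiniteMeasure μ] {f : X → ℝ} {e : ℝ} (he : 0 ≤ e) (he1 : e ≤ 1) (hf : Integrable f μ)
    (hf0 : ∀ᵐ x ∂μ, 0 ≤ f x) : Integrable (fun x => f x ^ e) μ := by
  simpa using integrable_add_const_rpow (δ := 0) one_pos he he1
    (by simpa using memLp_one_iff_integrable.2 hf) hf0 le_rfl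

/-- The energy inequality in terms of `v = u ^ α` and its gradient `G`. -/
theorem energy_inequality (hp : 2 < p) (hpq : q.HolderConjugate p) (hE : IsOpen E)
    (hK : IsCompact K) (hKE : K ⊆ E) (hu : MemContLocL2 E T₁ T₂ u)
    (hum : AEStronglyMeasurable u (volume.restrict (E ×ˢ Ioo T₁ T₂)))
    (hupos : ∀ᵐ z ∂(volume.restrict (E ×ˢ Ioo T₁ T₂)), 0 < u z)
    (hsob : MemLpLocSobolev p E T₁ T₂ (fun z => u z ^ α) G)
    (hB : ∀ a b, T₁ < a → b < T₂ → MemLp B (ENNReal.ofReal q) (volume.restrict (K ×ˢ Icc a b)))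
    (hweak : ∀ φ : Space N × ℝ → ℝ, IsTestFunction (E ×ˢ Ioo T₁ T₂) φ → (∀ z, 0 ≤ φ z) →
      0 ≤ -(∫ z in E ×ˢ Ioo T₁ T₂, u z * timeDeriv φ z) +
        ∫ z in E ×ˢ Ioo T₁ T₂, inner ℝ (B z) (spaceGrad φ z))
    (hα : 0 < α) (hκ : κ < 0) (hακ : -1 < α * κ) (hκp : 0 ≤ κ + p - 1)
    (hc₀ : 0 < c₀) (hc₁ : 0 < c₁)
    (hBG : ∀ᵐ z ∂(volume.restrict (E ×ˢ Ioo T₁ T₂)),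
      ‖B z‖ ≤ c₁ * ‖G z‖ ^ (p - 1) ∧ c₀ * ‖G z‖ ^ p ≤ inner ℝ (B z) (G z))
    (hφ : ContDiff ℝ ∞ φ)
    (hφ0 : ∀ x, ∀ t ∈ Ioc t₁ t₂, 0 ≤ φ (x, t)) (hφK : ∀ x ∉ K, ∀ t ∈ Ioc t₁ t₂, φ (x, t) = 0)
    (h₁ : T₁ < t₁) (h₁₂ : t₁ < t₂) (h₂ : t₂ < T₂) :
    IntegrableOn (fun x => u (x, t₁) ^ (1 + α * κ) * φ (x, t₁) ^ p) K ∧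
    IntegrableOn (fun x => u (x, t₂) ^ (1 + α * κ) * φ (x, t₂) ^ p) K ∧
    IntegrableOn (fun z => (u z ^ α) ^ (κ - 1) * ‖G z‖ ^ p * φ z ^ p) (K ×ˢ Ioc t₁ t₂) ∧
    IntegrableOn (fun z => (u z ^ α) ^ (κ + p - 1) * ‖spaceGrad φ z‖ ^ p) (K ×ˢ Ioc t₁ t₂) ∧
    IntegrableOn (fun z => u z ^ (1 + α * κ) * (timeDeriv φ z * p * φ z ^ (p - 1)))
      (K ×ˢ Ioc t₁ t₂) ∧
    -κ * c₀ / 2 * (∫ z in K ×ˢ Ioc t₁ t₂, (u z ^ α) ^ (κ - 1) * ‖G z‖ ^ p * φ z ^ p) ≤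
      (1 + α * κ)⁻¹ * (∫ x in K, u (x, t₂) ^ (1 + α * κ) * φ (x, t₂) ^ p) -
        (1 + α * κ)⁻¹ * (∫ x in K, u (x, t₁) ^ (1 + α * κ) * φ (x, t₁) ^ p) -
        (1 + α * κ)⁻¹ * (∫ z in K ×ˢ Ioc t₁ t₂,
          u z ^ (1 + α * κ) * (timeDeriv φ z * p * φ z ^ (p - 1))) +
      (c₁ * p) ^ p * (-κ * c₀ / 2) ^ (1 - p) *
        ∫ z in K ×ˢ Ioc t₁ t₂, (u z ^ α) ^ (κ + p - 1) * ‖spaceGrad φ z‖ ^ p := by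
  have hcpt : IsCompact (K ×ˢ Icc t₁ t₂) := hK.prod isCompact_Icc
  have hle : (volume : Measure (Space N × ℝ)).restrict (K ×ˢ Ioc t₁ t₂) ≤
      volume.restrict (K ×ˢ Icc t₁ t₂) :=
    Measure.restrict_mono_set _ (prod_mono Subset.rfl Ioc_subset_Icc_self)
  have : IsFiniteMeasure ((volume : Measure (Space N × ℝ)).restrict (K ×ˢ Ioc t₁ t₂)) :=
    ⟨(hle univ).trans_lt (by rw [Measure.restrict_apply_univ]; exact hcpt.measure_lt_top)⟩
  have : IsFiniteMeasure ((volume : Measure (Space N)).restrict K) :=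
    ⟨by rw [Measure.restrict_apply_univ]; exact hK.measure_lt_top⟩
  have hsub : K ×ˢ Ioc t₁ t₂ ⊆ E ×ˢ Ioo T₁ T₂ := prod_mono hKE
    fun t (ht : t ∈ Ioc t₁ t₂) => mem_Ioo.2 ⟨h₁.trans ht.1, ht.2.trans_lt h₂⟩
  have hpos : ∀ᵐ z ∂(volume.restrict (K ×ˢ Ioc t₁ t₂)), 0 < u z :=
    ae_mono (Measure.restrict_mono_set volume hsub) hupos
  have hmem : ∀ᵐ z ∂((volume : Measure (Space N × ℝ)).restrict (K ×ˢ Ioc t₁ t₂)),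
    z ∈ K ×ˢ Ioc t₁ t₂ := ae_restrict_mem (hK.measurableSet.prod measurableSet_Ioc)
  have hmem' : ∀ z ∈ K ×ˢ Ioc t₁ t₂, z ∈ K ×ˢ Icc t₁ t₂ := fun z hz =>
    ⟨hz.1, Ioc_subset_Icc_self hz.2⟩
  have hKm : ∀ᵐ x ∂((volume : Measure (Space N)).restrict K), x ∈ K :=
    ae_restrict_mem hK.measurableSet
  have hv := (hsob.memLp K t₁ t₂ hK hKE h₁ h₂).mono_measure hle
  have hw : Continuous fun z => φ z ^ p := hφ.continuous.rpow_const fun _ => Or.inr (by linarith)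
  have hw' : Continuous fun z => timeDeriv φ z * p * φ z ^ (p - 1) :=
    ((continuous_timeDeriv hφ).mul continuous_const).mul
      (hφ.continuous.rpow_const fun _ => Or.inr (by linarith))
  have hd : Continuous fun z => ‖spaceGrad φ z‖ ^ p :=
    (continuous_spaceGrad hφ).norm.rpow_const fun _ => Or.inr (by linarith)
  obtain ⟨M, hM⟩ := hcpt.exists_bound_of_continuousOn hw'.continuousOn
  obtain ⟨M', hM'⟩ := hcpt.exists_bound_of_continuousOn hd.continuousOn
  obtain ⟨M'', hM''⟩ := hcpt.exists_bound_of_continuousOn hw.continuousOn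
  have hακ' : α * κ ≤ 0 := mul_nonpos_of_nonneg_of_nonpos hα.le hκ.le
  -- the slices
  have hslice : ∀ t ∈ Icc t₁ t₂,
      IntegrableOn (fun x => u (x, t) ^ (1 + α * κ) * φ (x, t) ^ p) K ∧
      Tendsto (fun δ => ∫ x in K, regPrimitive α κ δ (u (x, t)) * φ (x, t) ^ p) (𝓝[>] 0)
        (𝓝 ((1 + α * κ)⁻¹ * ∫ x in K, u (x, t) ^ (1 + α * κ) * φ (x, t) ^ p)) := fun t ht => by
    have htT : t ∈ Ioo T₁ T₂ := ⟨h₁.trans_le ht.1, ht.2.trans_lt h₂⟩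
    have hi := hu.integrableOn_slice hK hKE htT
    have h0 := hu.ae_nonneg_slice hK hKE hupos htT
    have hi' := integrable_rpow_of_integrable (e := 1 + α * κ) (by linarith) (by linarith) hi h0
    have hwt : Continuous fun x => φ (x, t) ^ p := hw.comp (Continuous.prodMk_left t)
    have hb : ∀ᵐ x ∂(volume.restrict K), ‖φ (x, t) ^ p‖ ≤ M'' :=
      hKm.mono fun x hx => hM'' (x, t) ⟨hx, ht⟩
    exact ⟨hi'.mul_bdd (c := M'') hwt.aestronglyMeasurable hb,
      tendsto_integral_regPrimitive hα hκ.le hακ hi.1 h0 hi' hwt.aestronglyMeasurable hb⟩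
  obtain ⟨hi1, hl1⟩ := hslice t₁ (left_mem_Icc.2 h₁₂.le)
  obtain ⟨hi2, hl2⟩ := hslice t₂ (right_mem_Icc.2 h₁₂.le)
  -- the term with the time derivative of the cutoff
  have hui : IntegrableOn u (K ×ˢ Ioc t₁ t₂) :=
    Integrable.mono_measure (hu.integrableOn_prod hum hK hKE h₁ h₂) hle
  have hui' := integrable_rpow_of_integrable (e := 1 + α * κ) (by linarith) (by linarith) hui
    (hpos.mono fun z hz => hz.le)
  have hbM : ∀ᵐ z ∂(volume.restrict (K ×ˢ Ioc t₁ t₂)),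
      ‖timeDeriv φ z * p * φ z ^ (p - 1)‖ ≤ M := hmem.mono fun z hz => hM z (hmem' z hz)
  have hi3 := hui'.mul_bdd (c := M) hw'.aestronglyMeasurable hbM
  have hl3 := tendsto_integral_regPrimitive hα hκ.le hακ hui.1 (hpos.mono fun z hz => hz.le) hui'
    hw'.aestronglyMeasurable hbM
  -- the term with the gradient of the cutoff
  have hv0 : ∀ᵐ z ∂(volume.restrict (K ×ˢ Ioc t₁ t₂)), 0 ≤ u z ^ α :=
    hpos.mono fun z hz => Real.rpow_nonneg hz.le _
  have hbM' : ∀ᵐ z ∂(volume.restrict (K ×ˢ Ioc t₁ t₂)), ‖‖spaceGrad φ z‖ ^ p‖ ≤ M' :=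
    hmem.mono fun z hz => hM' z (hmem' z hz)
  have hcut : ∀ δ, 0 ≤ δ → Integrable (fun z => (u z ^ α + δ) ^ (κ + p - 1) *
      ‖spaceGrad φ z‖ ^ p) (volume.restrict (K ×ˢ Ioc t₁ t₂)) := fun δ hδ =>
    (integrable_add_const_rpow (by linarith) hκp (by linarith) hv hv0 hδ).mul_bdd (c := M')
      hd.aestronglyMeasurable hbM'
  have hl4 : Tendsto (fun δ => ∫ z in K ×ˢ Ioc t₁ t₂,
      (u z ^ α + δ) ^ (κ + p - 1) * ‖spaceGrad φ z‖ ^ p) (𝓝[>] 0)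
      (𝓝 (∫ z in K ×ˢ Ioc t₁ t₂, (u z ^ α) ^ (κ + p - 1) * ‖spaceGrad φ z‖ ^ p)) := by
    have hδ : ∀ᶠ δ : ℝ in 𝓝[>] 0, δ ∈ Ioo (0 : ℝ) 1 := Ioo_mem_nhdsGT one_pos
    refine tendsto_integral_filter_of_dominated_convergence _ ?_ ?_ (hcut 1 zero_le_one) ?_
    · filter_upwards [hδ] with δ hδ
      exact (hcut δ hδ.1.le).1
    · filter_upwards [hδ] with δ hδ
      filter_upwards [hv0] with z hz
      have h5 : 0 ≤ u z ^ α + δ := add_nonneg hz hδ.1.le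
      rw [Real.norm_of_nonneg (by positivity)]
      gcongr
      exact hδ.2.le
    · filter_upwards [hpos] with z hz
      have h2 : ContinuousAt (fun δ : ℝ => (u z ^ α + δ) ^ (κ + p - 1) * ‖spaceGrad φ z‖ ^ p) 0 :=
        ((continuousAt_const.add continuousAt_id).rpow_const (Or.inr hκp)).mul_const _
      have h3 := h2.tendsto
      simp only [add_zero] at h3
      exact h3.mono_left nhdsWithin_le_nhds
  have hδ : ∀ᶠ δ : ℝ in 𝓝[>] 0, 0 < δ := self_mem_nhdsWithin
  have hreg := fun δ (hδ : 0 < δ) => regularized_energy_inequality hp hpq hE hK hKE hu hum hupos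
    hsob hB hweak hα hκ hκp hδ hc₀ hc₁ hBG hφ hφ0 hφK h₁ h₁₂ h₂
  have hs : 0 < -κ * c₀ / 2 := by have := mul_pos (neg_pos.2 hκ) hc₀; linarith
  -- Fatou's lemma for the energy, which is not known to be integrable beforehand
  have hfat := integral_le_of_tendsto_ae (μ := volume.restrict (K ×ˢ Ioc t₁ t₂))
    (l := 𝓝[>] (0 : ℝ))
    (f := fun δ z => (u z ^ α + δ) ^ (κ - 1) * ‖G z‖ ^ p * φ z ^ p)
    (g := fun z => (u z ^ α) ^ (κ - 1) * ‖G z‖ ^ p * φ z ^ p)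
    (hδ.mono fun δ hδ => (hreg δ hδ).1)
    (hδ.mono fun δ hδ => by
      filter_upwards [hv0, hmem] with z hz hm
      have h5 : 0 ≤ u z ^ α + δ := add_nonneg hz hδ.le
      have h6 := hφ0 z.1 z.2 hm.2
      simp only [Pi.zero_apply]
      positivity)
    (hpos.mono fun z hz => by
      have h1 := Real.rpow_pos_of_pos hz α
      have h2 : ContinuousAt (fun δ : ℝ => (u z ^ α + δ) ^ (κ - 1) * ‖G z‖ ^ p * φ z ^ p) 0 :=
        (((continuousAt_const.add continuousAt_id).rpow_const
          (Or.inl (by simpa using h1.ne'))).mul_const _).mul_const _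
      have h3 := h2.tendsto
      simp only [add_zero] at h3
      exact h3.mono_left nhdsWithin_le_nhds)
    ((((hl2.sub hl1).sub hl3).add
      (hl4.const_mul ((c₁ * p) ^ p * (-κ * c₀ / 2) ^ (1 - p)))).div_const (-κ * c₀ / 2))
    (hδ.mono fun δ hδ => by
      rw [le_div_iff₀' hs]
      exact (hreg δ hδ).2)
  have hcut0 := hcut 0 le_rfl
  simp only [add_zero] at hcut0
  refine ⟨hi1, hi2, hfat.1, hcut0, hi3, ?_⟩
  have := hfat.2
  rwa [le_div_iff₀' hs] at this

end Energy

/-! ### The energy estimates for supersolutions -/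

section Exponents

variable {N : ℕ} {m p C₀ C₁ : ℝ} {u : Space N × ℝ → ℝ} {G : Space N × ℝ → Space N}
  {φ : Space N × ℝ → ℝ} {z : Space N × ℝ}

theorem alphaExp_pos (hp : 2 < p) (hmp : 3 < m + p) : 0 < alphaExp m p :=
  div_pos (by linarith) (by linarith)

theorem alphaExp_mul (hp : 2 < p) : alphaExp m p * (p - 1) = m + p - 2 :=
  div_mul_cancel₀ _ (by linarith)

theorem norm_gradOf (hα : 0 < alphaExp m p) (hu : 0 < u z) :
    ‖gradOf m p u G z‖ = (alphaExp m p)⁻¹ * u z ^ (1 - alphaExp m p) * ‖G z‖ := by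
  rw [gradOf, norm_smul, Real.norm_of_nonneg (by positivity)]

/-- The exponent `α` is chosen so that the powers of `u` cancel here. -/
theorem rpow_mul_gradOf_coeff (hp : 2 < p) (hmp : 3 < m + p) {r : ℝ} (hr : 0 < r) :
    r ^ (m - 1) * ((alphaExp m p)⁻¹ * r ^ (1 - alphaExp m p)) ^ (p - 1) =
      alphaExp m p ^ (1 - p) := by
  have hα := alphaExp_pos hp hmp
  have h1 := alphaExp_mul (m := m) hp
  rw [Real.mul_rpow (by positivity) (by positivity), ← Real.rpow_mul hr.le, mul_left_comm,
    ← Real.rpow_add hr, Real.inv_rpow hα.le, ← Real.rpow_neg hα.le,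
    show m - 1 + (1 - alphaExp m p) * (p - 1) = 0 by linarith, Real.rpow_zero, mul_one, neg_sub]

/-- In terms of `G = D(u ^ α)` the structure conditions lose their degeneracy in `u`. -/
theorem structure_bounds (hp : 2 < p) (hmp : 3 < m + p) (hu : 0 < u z) {b : Space N}
    (hbG : C₀ * |u z| ^ (m - 1) * ‖gradOf m p u G z‖ ^ p ≤ inner ℝ b (gradOf m p u G z))
    (hb : ‖b‖ ≤ C₁ * |u z| ^ (m - 1) * ‖gradOf m p u G z‖ ^ (p - 1)) :
    ‖b‖ ≤ C₁ * alphaExp m p ^ (1 - p) * ‖G z‖ ^ (p - 1) ∧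
      C₀ * alphaExp m p ^ (1 - p) * ‖G z‖ ^ p ≤ inner ℝ b (G z) := by
  have hα := alphaExp_pos hp hmp
  rw [norm_gradOf hα hu, abs_of_pos hu] at hb hbG
  rw [gradOf, inner_smul_right] at hbG
  have h1 := rpow_mul_gradOf_coeff hp hmp hu
  have hk : 0 < (alphaExp m p)⁻¹ * u z ^ (1 - alphaExp m p) := by positivity
  set k := (alphaExp m p)⁻¹ * u z ^ (1 - alphaExp m p)
  rw [Real.mul_rpow hk.le (norm_nonneg _)] at hb hbG
  rw [← h1]
  constructor
  · refine hb.trans_eq (by ring)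
  · have h2 : k ^ p = k ^ (p - 1) * k := by
      rw [← Real.rpow_add_one hk.ne', sub_add_cancel]
    rw [h2] at hbG
    refine le_of_mul_le_mul_left (le_of_eq_of_le ?_ hbG) hk
    ring

theorem energyDensity_eq (hp : 2 < p) (hmp : 3 < m + p) (hu : 0 < u z) (ε : ℝ) :
    energyDensity m p ε u G φ z = alphaExp m p ^ (-p) *
      ((u z ^ alphaExp m p) ^ (ε / alphaExp m p - 1) * ‖G z‖ ^ p * φ z ^ p) := by
  have hα := alphaExp_pos hp hmp
  have h1 := alphaExp_mul (m := m) hp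
  rw [energyDensity, norm_gradOf hα hu, Real.mul_rpow (by positivity) (norm_nonneg _),
    Real.mul_rpow (by positivity) (by positivity), ← Real.rpow_mul hu.le, ← Real.rpow_mul hu.le,
    Real.inv_rpow hα.le, ← Real.rpow_neg hα.le,
    show alphaExp m p * (ε / alphaExp m p - 1) = (1 - alphaExp m p) * p + (m + ε - 2) by
      rw [mul_sub, mul_div_cancel₀ _ hα.ne']; linarith, Real.rpow_add hu]
  ring

theorem cutoffDensity_eq (hp : 2 < p) (hmp : 3 < m + p) (hu : 0 < u z) (ε : ℝ) :
    cutoffDensity m p ε u φ z =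
      (u z ^ alphaExp m p) ^ (ε / alphaExp m p + p - 1) * ‖spaceGrad φ z‖ ^ p := by
  have hα := alphaExp_pos hp hmp
  have h1 := alphaExp_mul (m := m) hp
  rw [cutoffDensity, ← Real.rpow_mul hu.le,
    show alphaExp m p * (ε / alphaExp m p + p - 1) = m + p + ε - 2 by
      rw [add_sub_assoc, mul_add, mul_div_cancel₀ _ hα.ne']; linarith]

theorem timeFactor_eq (hp : 2 < p) (hφ : ContDiff ℝ ∞ φ) (ε : ℝ) :
    timeFactor p ε φ z = 1 / (ε * (1 + ε)) * (timeDeriv φ z * p * φ z ^ (p - 1)) := by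
  rw [timeFactor, timeDeriv, (hasDerivAt_time_rpow hφ (by linarith) z.1 z.2).deriv]

end Exponents

/-- The constant in front of the cutoff term, produced by absorbing the cross term. -/
noncomputable def cutoffConst (m p C₀ C₁ : ℝ) : ℝ :=
  (C₁ * alphaExp m p ^ (1 - p) * p) ^ p * (C₀ * alphaExp m p ^ (-p) / 2) ^ (1 - p)

section Supersolution

variable {N : ℕ} {m p C₀ C₁ ε : ℝ} {E K Q : Set (Space N)} {T₁ T₂ T t₁ t₂ : ℝ}
  {A : Space N → ℝ → ℝ → Space N → Space N} {u : Space N × ℝ → ℝ} {G : Space N × ℝ → Space N}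
  {φ : Space N × ℝ → ℝ}

theorem restrict_prod_Ioo_eq (K : Set (Space N)) (t₁ t₂ : ℝ) :
    (volume : Measure (Space N × ℝ)).restrict (K ×ˢ Ioo t₁ t₂) =
      volume.restrict (K ×ˢ Ioc t₁ t₂) := by
  rw [Measure.volume_eq_prod, ← Measure.prod_restrict, ← Measure.prod_restrict,
    Measure.restrict_congr_set Ioo_ae_eq_Ioc]

/-- The flux `A(x, t, u, Du)` is in `L^{p'}` on compact sets, being bounded by `|G| ^ (p - 1)`. -/
theorem memLp_flux (hp : 2 < p) (hmp : 3 < m + p) (hA : StructureConditions m p C₀ C₁ E T₁ T₂ A)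
    (hu : IsPositiveWeakSupersolution m p A E T₁ T₂ u G) (hK : IsCompact K) (hKE : K ⊆ E)
    {a b : ℝ} (ha : T₁ < a) (hb : b < T₂) :
    MemLp (fun z => A z.1 z.2 (u z) (gradOf m p u G z)) (ENNReal.ofReal (p / (p - 1)))
      (volume.restrict (K ×ˢ Icc a b)) := by
  have hsub : K ×ˢ Icc a b ⊆ E ×ˢ Ioo T₁ T₂ := prod_mono hKE
    fun t (ht : t ∈ Icc a b) => mem_Ioo.2 ⟨ha.trans_le ht.1, ht.2.trans_lt hb⟩
  have hle := Measure.restrict_mono_set (volume : Measure (Space N × ℝ)) hsub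
  have hG := hu.sobolev.memLp_grad K a b hK hKE ha hb
  have hum := (hu.aestronglyMeasurable.mono_measure hle).aemeasurable
  refine memLp_of_norm_le_rpow (c := C₁ * alphaExp m p ^ (1 - p)) (by linarith)
    (Real.HolderConjugate.conjExponent (by linarith : 1 < p)).symm hG ?_ ?_
  · have h1 : AEMeasurable (gradOf m p u G) (volume.restrict (K ×ˢ Icc a b)) :=
      ((hum.pow_const _).const_mul _).smul hG.1.aemeasurable
    exact (hA.measurable.comp_aemeasurable (measurable_fst.aemeasurable.prodMk
      (measurable_snd.aemeasurable.prodMk (hum.prodMk h1)))).aestronglyMeasurable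
  · filter_upwards [ae_mono hle hu.pos, ae_mono hle hA.bounds] with z hz hAz
    have h1 := hAz (u z) (gradOf m p u G z) (ne_of_gt hz)
    exact (structure_bounds hp hmp hz h1.1 h1.2).1

/-- The first energy estimate, with explicit constants: the inequality for `v = u ^ α` with the
exponent `κ = ε / α`, divided by `-ε > 0`. -/
theorem energy_estimate (hp : 2 < p) (hmp : 3 < m + p) (hC₀ : 0 < C₀) (hC₁ : 0 < C₁)
    (hE : IsOpen E) (hA : StructureConditions m p C₀ C₁ E T₁ T₂ A)
    (hu : IsPositiveWeakSupersolution m p A E T₁ T₂ u G) (hQ : IsOpen Q) (hQE : Q ⊆ E)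
    (hT₁ : T₁ < 0) (hT₂ : T < T₂) (hε₁ : -1 < ε) (hε₀ : ε < 0) (h₁ : 0 ≤ t₁) (h₁₂ : t₁ < t₂)
    (h₂ : t₂ ≤ T) (hφ : IsNonnegCutoff Q T φ) :
    IntegrableOn (sliceDensity p ε u φ t₁) Q ∧
    IntegrableOn (sliceDensity p ε u φ t₂) Q ∧
    IntegrableOn (energyDensity m p ε u G φ) (Q ×ˢ Ioo t₁ t₂) ∧
    IntegrableOn (cutoffDensity m p ε u φ) (Q ×ˢ Ioo t₁ t₂) ∧
    IntegrableOn (fun z => u z ^ (1 + ε) * timeFactor p ε φ z) (Q ×ˢ Ioo t₁ t₂) ∧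
    1 / (ε * (1 + ε)) * (∫ x in Q, sliceDensity p ε u φ t₂ x)
        - 1 / (ε * (1 + ε)) * (∫ x in Q, sliceDensity p ε u φ t₁ x)
        + C₀ / 2 * ∫ z in Q ×ˢ Ioo t₁ t₂, energyDensity m p ε u G φ z
      ≤ cutoffConst m p C₀ C₁ * (1 / |ε| ^ p * ∫ z in Q ×ˢ Ioo t₁ t₂, cutoffDensity m p ε u φ z)
        + ∫ z in Q ×ˢ Ioo t₁ t₂, u z ^ (1 + ε) * timeFactor p ε φ z := by
  obtain ⟨K, hK, hKQ, hφK⟩ := hφ.support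
  have hKE := hKQ.trans hQE
  have hp0 : p ≠ 0 := by linarith
  have hα := alphaExp_pos hp hmp
  have hαp : 0 < alphaExp m p ^ (1 - p) := Real.rpow_pos_of_pos hα _
  have hκ : ε / alphaExp m p < 0 := div_neg_of_neg_of_pos hε₀ hα
  have hακ : alphaExp m p * (ε / alphaExp m p) = ε := mul_div_cancel₀ _ hα.ne'
  have hIcc : ∀ t ∈ Ioc t₁ t₂, t ∈ Icc 0 T := fun t ht => ⟨h₁.trans ht.1.le, ht.2.trans h₂⟩
  have hsub : K ×ˢ Ioc t₁ t₂ ⊆ E ×ˢ Ioo T₁ T₂ := prod_mono hKE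
    fun t (ht : t ∈ Ioc t₁ t₂) => mem_Ioo.2 ⟨by linarith [ht.1], by linarith [ht.2]⟩
  have hpos : ∀ᵐ z ∂(volume.restrict (K ×ˢ Ioc t₁ t₂)), 0 < u z :=
    ae_mono (Measure.restrict_mono_set volume hsub) hu.pos
  obtain ⟨hi1, hi2, hi3, hi4, hi5, main⟩ := energy_inequality (E := E) (K := K) (T₁ := T₁)
    (T₂ := T₂) (κ := ε / alphaExp m p) (c₀ := C₀ * alphaExp m p ^ (1 - p))
    (c₁ := C₁ * alphaExp m p ^ (1 - p)) (t₁ := t₁) (t₂ := t₂) hp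
    (Real.HolderConjugate.conjExponent (by linarith : 1 < p)).symm hE hK hKE hu.continuous_time
    hu.aestronglyMeasurable hu.pos hu.sobolev
    (fun a b ha hb => memLp_flux hp hmp hA hu hK hKE ha hb) hu.weak_ineq hα hκ
    (by rw [hακ]; exact hε₁) (by
      refine (mul_nonneg_iff_of_pos_left hα).1 ?_
      rw [add_sub_assoc, mul_add, hακ, alphaExp_mul hp]
      linarith) (mul_pos hC₀ hαp) (mul_pos hC₁ hαp) (by
      filter_upwards [hu.pos, hA.bounds] with z hz hAz
      have h1 := hAz (u z) (gradOf m p u G z) (ne_of_gt hz)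
      exact structure_bounds hp hmp hz h1.1 h1.2) hφ.contDiff
    (fun x t ht => hφ.nonneg x t (hIcc t ht)) (fun x hx t ht => hφK x hx t (hIcc t ht))
    (by linarith) h₁₂ (by linarith)
  rw [hακ] at hi1 hi2 hi5 main
  -- the integrands vanish off `K`
  have hQm := hQ.measurableSet
  have hQtm : MeasurableSet (Q ×ˢ Ioo t₁ t₂) := hQm.prod measurableSet_Ioo
  have hKs : K ×ˢ Ioo t₁ t₂ ⊆ Q ×ˢ Ioo t₁ t₂ := prod_mono hKQ Subset.rfl
  have hs0 : ∀ t ∈ Icc t₁ t₂, ∀ x ∈ Q \ K, sliceDensity p ε u φ t x = 0 := fun t ht x hx => by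
    rw [sliceDensity, hφK x hx.2 t ⟨h₁.trans ht.1, ht.2.trans h₂⟩, Real.zero_rpow hp0, mul_zero]
  have hoff : ∀ z ∈ (Q ×ˢ Ioo t₁ t₂) \ (K ×ˢ Ioo t₁ t₂), φ z = 0 ∧ spaceGrad φ z = 0 := by
    rintro ⟨x, t⟩ ⟨hz, hz'⟩
    have hx : x ∉ K := fun hx => hz' ⟨hx, hz.2⟩
    have ht := hIcc t (Ioo_subset_Ioc_self hz.2)
    exact ⟨hφK x hx t ht, gradient_eq_zero_of_notMem hK.isClosed (fun y hy => hφK y hy t ht) hx⟩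
  have he0 : ∀ z ∈ (Q ×ˢ Ioo t₁ t₂) \ (K ×ˢ Ioo t₁ t₂), energyDensity m p ε u G φ z = 0 :=
    fun z hz => by rw [energyDensity, (hoff z hz).1, Real.zero_rpow hp0, mul_zero]
  have hc0 : ∀ z ∈ (Q ×ˢ Ioo t₁ t₂) \ (K ×ˢ Ioo t₁ t₂), cutoffDensity m p ε u φ z = 0 :=
    fun z hz => by rw [cutoffDensity, (hoff z hz).2, norm_zero, Real.zero_rpow hp0, mul_zero]
  have ht0 : ∀ z ∈ (Q ×ˢ Ioo t₁ t₂) \ (K ×ˢ Ioo t₁ t₂),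
      u z ^ (1 + ε) * timeFactor p ε φ z = 0 := fun z hz => by
    rw [timeFactor_eq hp hφ.contDiff, (hoff z hz).1, Real.zero_rpow (by linarith)]
    ring
  have hee : energyDensity m p ε u G φ =ᵐ[volume.restrict (K ×ˢ Ioc t₁ t₂)] fun z =>
      alphaExp m p ^ (-p) * ((u z ^ alphaExp m p) ^ (ε / alphaExp m p - 1) * ‖G z‖ ^ p * φ z ^ p) :=
    hpos.mono fun z hz => energyDensity_eq hp hmp hz ε
  have hce : cutoffDensity m p ε u φ =ᵐ[volume.restrict (K ×ˢ Ioc t₁ t₂)] fun z =>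
      (u z ^ alphaExp m p) ^ (ε / alphaExp m p + p - 1) * ‖spaceGrad φ z‖ ^ p :=
    hpos.mono fun z hz => cutoffDensity_eq hp hmp hz ε
  have hte : (fun z => u z ^ (1 + ε) * timeFactor p ε φ z) = fun z =>
      1 / (ε * (1 + ε)) * (u z ^ (1 + ε) * (timeDeriv φ z * p * φ z ^ (p - 1))) := by
    ext z
    rw [timeFactor_eq hp hφ.contDiff]
    ring
  refine ⟨IntegrableOn.of_forall_sdiff_eq_zero hi1 hQm (hs0 t₁ (left_mem_Icc.2 h₁₂.le)),
    IntegrableOn.of_forall_sdiff_eq_zero hi2 hQm (hs0 t₂ (right_mem_Icc.2 h₁₂.le)),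
    IntegrableOn.of_forall_sdiff_eq_zero ?_ hQtm he0,
    IntegrableOn.of_forall_sdiff_eq_zero ?_ hQtm hc0,
    IntegrableOn.of_forall_sdiff_eq_zero ?_ hQtm ht0, ?_⟩
  · rw [IntegrableOn, restrict_prod_Ioo_eq, integrable_congr hee]
    exact Integrable.const_mul hi3 _
  · rw [IntegrableOn, restrict_prod_Ioo_eq, integrable_congr hce]
    exact hi4
  · rw [IntegrableOn, restrict_prod_Ioo_eq, hte]
    exact Integrable.const_mul hi5 _
  rw [setIntegral_eq_of_subset_of_forall_sdiff_eq_zero hQm hKQ (hs0 t₁ (left_mem_Icc.2 h₁₂.le)),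
    setIntegral_eq_of_subset_of_forall_sdiff_eq_zero hQm hKQ (hs0 t₂ (right_mem_Icc.2 h₁₂.le)),
    setIntegral_eq_of_subset_of_forall_sdiff_eq_zero hQtm hKs he0,
    setIntegral_eq_of_subset_of_forall_sdiff_eq_zero hQtm hKs hc0,
    setIntegral_eq_of_subset_of_forall_sdiff_eq_zero hQtm hKs ht0, restrict_prod_Ioo_eq,
    integral_congr_ae hee, integral_congr_ae hce, hte, integral_const_mul, integral_const_mul]
  simp only [sliceDensity]
  -- divide the inequality by `-ε`
  have hk : -(ε / alphaExp m p) * (C₀ * alphaExp m p ^ (1 - p)) / 2 =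
      -ε * (C₀ * alphaExp m p ^ (-p) / 2) := by
    rw [show 1 - p = -p + 1 by ring, Real.rpow_add_one hα.ne']
    field_simp
  have hε : 0 < -ε := by linarith
  have hε' : (-ε) ^ (1 - p) = -ε * (1 / |ε| ^ p) := by
    rw [abs_of_neg hε₀, show 1 - p = 1 + -p by ring, Real.rpow_add hε, Real.rpow_one,
      Real.rpow_neg hε.le, one_div]
  rw [hk, Real.mul_rpow hε.le (by positivity), hε'] at main
  have hc : ε * (1 / (ε * (1 + ε))) = (1 + ε)⁻¹ := by
    rw [one_div, mul_inv, mul_inv_cancel_left₀ hε₀.ne]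
  rw [← hc] at main
  rw [cutoffConst]
  refine le_of_mul_le_mul_left ?_ hε
  linarith

theorem cutoffConst_nonneg (hp : 2 < p) (hmp : 3 < m + p) (hC₀ : 0 < C₀) (hC₁ : 0 < C₁) :
    0 ≤ cutoffConst m p C₀ C₁ := by
  have := alphaExp_pos hp hmp
  unfold cutoffConst
  positivity

/-- The slice at `t₂` vanishes, so that the first estimate on `(τ, t₂)` bounds the slice at `τ` for
every `τ`, and the energy for `τ = t₁`. -/
theorem sup_energy_estimate (hp : 2 < p) (hmp : 3 < m + p) (hC₀ : 0 < C₀) (hC₁ : 0 < C₁)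
    (hE : IsOpen E) (hA : StructureConditions m p C₀ C₁ E T₁ T₂ A)
    (hu : IsPositiveWeakSupersolution m p A E T₁ T₂ u G) (hQ : IsOpen Q)
    (hQc : IsCompact (closure Q)) (hQE : closure Q ⊆ E)
    (hT₁ : T₁ < 0) (hT₂ : T < T₂) (hε₁ : -1 < ε) (hε₀ : ε < 0) (h₁ : 0 ≤ t₁) (h₁₂ : t₁ < t₂)
    (h₂ : t₂ ≤ T) (hφ : IsNonnegCutoff Q T φ) (hφt : ∀ x ∈ Q, φ (x, t₂) = 0) :
    ENNReal.ofReal (1 / |ε * (1 + ε)|) *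
        essSup (fun τ => ∫⁻ x in Q, ENNReal.ofReal (sliceDensity p ε u φ τ x))
          (volume.restrict (Icc t₁ t₂))
        + ∫⁻ z in Q ×ˢ Ioo t₁ t₂, ENNReal.ofReal (energyDensity m p ε u G φ z)
      ≤ ENNReal.ofReal ((1 + 2 / C₀) * max 1 (cutoffConst m p C₀ C₁)) *
        (ENNReal.ofReal (1 / |ε| ^ p) *
            (∫⁻ z in Q ×ˢ Ioo t₁ t₂, ENNReal.ofReal (cutoffDensity m p ε u φ z))
          + ∫⁻ z in Q ×ˢ Ioo t₁ t₂,
              ENNReal.ofReal (u z ^ (1 + ε) * max (timeFactor p ε φ z) 0)) := by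
  have hQE' : Q ⊆ E := subset_closure.trans hQE
  have hQtm : MeasurableSet (Q ×ˢ Ioo t₁ t₂) := hQ.measurableSet.prod measurableSet_Ioo
  have hest := fun τ (hτ : τ ∈ Ico t₁ t₂) => energy_estimate hp hmp hC₀ hC₁ hE hA hu hQ hQE' hT₁
    hT₂ hε₁ hε₀ (h₁.trans hτ.1) hτ.2 h₂ hφ
  have hpos : ∀ᵐ z ∂(volume.restrict (Q ×ˢ Ioo t₁ t₂)), 0 < u z :=
    ae_mono (Measure.restrict_mono_set _ (prod_mono hQE'
      fun t (ht : t ∈ Ioo t₁ t₂) => mem_Ioo.2 ⟨by linarith [ht.1], by linarith [ht.2]⟩)) hu.pos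
  have hmem : ∀ᵐ z ∂((volume : Measure (Space N × ℝ)).restrict (Q ×ˢ Ioo t₁ t₂)),
    z ∈ Q ×ˢ Ioo t₁ t₂ := ae_restrict_mem hQtm
  obtain ⟨-, -, hei, hci, hti, hmain⟩ := hest t₁ ⟨le_rfl, h₁₂⟩
  have he0 : 0 ≤ᵐ[volume.restrict (Q ×ˢ Ioo t₁ t₂)] energyDensity m p ε u G φ := by
    filter_upwards [hpos, hmem] with z hz hm
    have := hφ.nonneg z.1 z.2 ⟨h₁.trans hm.2.1.le, hm.2.2.le.trans h₂⟩
    simp only [energyDensity, Pi.zero_apply]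
    positivity
  have hc0 : 0 ≤ᵐ[volume.restrict (Q ×ˢ Ioo t₁ t₂)] cutoffDensity m p ε u φ := by
    filter_upwards [hpos] with z hz
    simp only [cutoffDensity, Pi.zero_apply]
    positivity
  have hp0 : 0 ≤ᵐ[volume.restrict (Q ×ˢ Ioo t₁ t₂)]
      fun z => u z ^ (1 + ε) * max (timeFactor p ε φ z) 0 := by
    filter_upwards [hpos] with z hz
    simp only [Pi.zero_apply]
    positivity
  have hpi : IntegrableOn (fun z => u z ^ (1 + ε) * max (timeFactor p ε φ z) 0)
      (Q ×ˢ Ioo t₁ t₂) := by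
    refine Integrable.congr hti.pos_part ?_
    filter_upwards [hpos] with z hz
    rw [mul_max_of_nonneg _ _ (by positivity), mul_zero]
  have hs0 : ∀ τ ∈ Icc t₁ t₂, 0 ≤ᵐ[volume.restrict Q] sliceDensity p ε u φ τ := fun τ hτ => by
    filter_upwards [ae_mono (Measure.restrict_mono_set _ subset_closure)
      (hu.continuous_time.ae_nonneg_slice hQc hQE hu.pos (t := τ)
        ⟨by linarith [hτ.1], by linarith [hτ.2]⟩)] with x hx
    have := hφ.nonneg x τ ⟨h₁.trans hτ.1, hτ.2.trans h₂⟩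
    exact mul_nonneg (Real.rpow_nonneg hx _) (Real.rpow_nonneg this _)
  have hend : ∫ x in Q, sliceDensity p ε u φ t₂ x = 0 := by
    refine setIntegral_eq_zero_of_forall_eq_zero fun x hx => ?_
    rw [sliceDensity, hφt x hx, Real.zero_rpow (by linarith), mul_zero]
  have habs : 1 / (ε * (1 + ε)) = -(1 / |ε * (1 + ε)|) := by
    rw [abs_of_neg (mul_neg_of_neg_of_pos hε₀ (by linarith)), one_div_neg_eq_neg_one_div, neg_neg]
  have hk : 0 < 1 / |ε * (1 + ε)| :=
    one_div_pos.2 (abs_pos.2 (mul_neg_of_neg_of_pos hε₀ (by linarith)).ne)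
  have hD := cutoffConst_nonneg hp hmp hC₀ hC₁
  set k := 1 / |ε * (1 + ε)|
  set D := cutoffConst m p C₀ C₁
  set r := 1 / |ε| ^ p
  have hr0 : 0 ≤ r := by positivity
  set Cut := ∫ z in Q ×ˢ Ioo t₁ t₂, cutoffDensity m p ε u φ z with hCut
  set P := ∫ z in Q ×ˢ Ioo t₁ t₂, u z ^ (1 + ε) * max (timeFactor p ε φ z) 0 with hP
  have hCut0 : 0 ≤ Cut := integral_nonneg_of_ae hc0
  have hP0 : 0 ≤ P := integral_nonneg_of_ae hp0
  -- the estimate on `(τ, t₂)`, with the right-hand side enlarged to `(t₁, t₂)`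
  have hτ : ∀ τ ∈ Ico t₁ t₂, k * (∫ x in Q, sliceDensity p ε u φ τ x) +
      C₀ / 2 * (∫ z in Q ×ˢ Ioo τ t₂, energyDensity m p ε u G φ z) ≤ D * (r * Cut) + P := by
    intro τ hτ
    obtain ⟨-, -, -, -, hti', h⟩ := hest τ hτ
    have hss : Q ×ˢ Ioo τ t₂ ⊆ Q ×ˢ Ioo t₁ t₂ := prod_mono Subset.rfl (Ioo_subset_Ioo_left hτ.1)
    have h3 : ∫ z in Q ×ˢ Ioo τ t₂, cutoffDensity m p ε u φ z ≤ Cut :=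
      setIntegral_mono_set hci hc0 hss.eventuallyLE
    have h4 : ∫ z in Q ×ˢ Ioo τ t₂, u z ^ (1 + ε) * timeFactor p ε φ z ≤ P := by
      refine le_trans ?_ (setIntegral_mono_set hpi hp0 hss.eventuallyLE)
      refine integral_mono_ae hti' (hpi.mono_set hss) ?_
      filter_upwards [ae_mono (Measure.restrict_mono_set _ hss) hpos] with z hz
      exact mul_le_mul_of_nonneg_left (le_max_left _ _) (Real.rpow_nonneg (le_of_lt hz) _)
    rw [hend, habs] at h
    have h5 : D * (r * ∫ z in Q ×ˢ Ioo τ t₂, cutoffDensity m p ε u φ z) ≤ D * (r * Cut) := by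
      gcongr
    linarith
  have hR : D * (r * Cut) + P ≤ max 1 D * (r * Cut + P) := by
    have h5 := mul_le_mul_of_nonneg_right (le_max_right 1 D) (mul_nonneg hr0 hCut0)
    have h6 := mul_le_mul_of_nonneg_right (le_max_left 1 D) hP0
    linarith
  set R := D * (r * Cut) + P
  have hR0 : 0 ≤ R := by positivity
  have hEn0 : ∀ τ ∈ Ico t₁ t₂, 0 ≤ ∫ z in Q ×ˢ Ioo τ t₂, energyDensity m p ε u G φ z :=
    fun τ hτ => integral_nonneg_of_ae (ae_mono (Measure.restrict_mono_set _
      (prod_mono Subset.rfl (Ioo_subset_Ioo_left hτ.1))) he0)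
  have hsup : essSup (fun τ => ∫⁻ x in Q, ENNReal.ofReal (sliceDensity p ε u φ τ x))
      (volume.restrict (Icc t₁ t₂)) ≤ ENNReal.ofReal (R / k) := by
    refine essSup_le_of_ae_le _ ((ae_restrict_mem measurableSet_Icc).mono fun τ hτI => ?_)
    rcases hτI.2.lt_or_eq with hlt | rfl
    · have hτ' : τ ∈ Ico t₁ t₂ := ⟨hτI.1, hlt⟩
      simp only
      rw [← ofReal_integral_eq_lintegral_ofReal (hest τ hτ').1 (hs0 τ hτI)]
      refine ENNReal.ofReal_le_ofReal ((le_div_iff₀' hk).2 ?_)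
      have := hτ τ hτ'
      have := mul_nonneg (half_pos hC₀).le (hEn0 τ hτ')
      linarith
    · simp only
      rw [← ofReal_integral_eq_lintegral_ofReal (hest t₁ ⟨le_rfl, h₁₂⟩).2.1 (hs0 _ hτI), hend,
        ENNReal.ofReal_zero]
      exact zero_le
  have hEn : ∫ z in Q ×ˢ Ioo t₁ t₂, energyDensity m p ε u G φ z ≤ 2 / C₀ * R := by
    have h7 := hτ t₁ ⟨le_rfl, h₁₂⟩
    have h8 := mul_nonneg hk.le (integral_nonneg_of_ae (hs0 t₁ ⟨le_rfl, h₁₂.le⟩))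
    rw [div_mul_eq_mul_div, le_div_iff₀ hC₀]
    linarith
  rw [← ofReal_integral_eq_lintegral_ofReal hei he0, ← ofReal_integral_eq_lintegral_ofReal hci hc0,
    ← ofReal_integral_eq_lintegral_ofReal hpi hp0, ← hCut, ← hP, ← ENNReal.ofReal_mul hr0,
    ← ENNReal.ofReal_add (by positivity) hP0, ← ENNReal.ofReal_mul (by positivity)]
  calc _ ≤ ENNReal.ofReal k * ENNReal.ofReal (R / k) + ENNReal.ofReal (2 / C₀ * R) := by
        gcongr
    _ = ENNReal.ofReal ((1 + 2 / C₀) * R) := by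
        rw [← ENNReal.ofReal_mul hk.le, mul_div_cancel₀ _ hk.ne',
          ← ENNReal.ofReal_add hR0 (by positivity)]
        congr 1
        ring
    _ ≤ _ := by
        refine ENNReal.ofReal_le_ofReal ?_
        rw [mul_assoc]
        gcongr

end Supersolution

theorem mainTheorem6 (m p C₀ C₁ : ℝ) (hp : 2 < p) (hmp : 3 < m + p)
    (hC₀ : 0 < C₀) (hC₁ : 0 < C₁) :
    ∃ γ : ℝ, 0 < γ ∧
      ∀ (N : ℕ), 1 ≤ N →
      ∀ (E : Set (Space N)) (T₁ T₂ : ℝ) (A : Space N → ℝ → ℝ → Space N → Space N)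
        (u : Space N × ℝ → ℝ) (G : Space N × ℝ → Space N),
      IsOpen E →
      StructureConditions m p C₀ C₁ E T₁ T₂ A →
      IsPositiveWeakSupersolution m p A E T₁ T₂ u G →
      ∀ (Q : Set (Space N)) (T : ℝ), IsOpen Q → IsCompact (closure Q) → closure Q ⊆ E →
      0 < T → T₁ < 0 → T < T₂ →
      ∀ (ε : ℝ), -1 < ε → ε < 0 →
      ∀ (t₁ t₂ : ℝ), 0 ≤ t₁ → t₁ < t₂ → t₂ ≤ T →
      ∀ (φ : Space N × ℝ → ℝ), IsNonnegCutoff Q T φ →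
        (IntegrableOn (sliceDensity p ε u φ t₁) Q ∧
          IntegrableOn (sliceDensity p ε u φ t₂) Q ∧
          IntegrableOn (energyDensity m p ε u G φ) (Q ×ˢ Ioo t₁ t₂) ∧
          IntegrableOn (cutoffDensity m p ε u φ) (Q ×ˢ Ioo t₁ t₂) ∧
          IntegrableOn (fun z => u z ^ (1 + ε) * timeFactor p ε φ z) (Q ×ˢ Ioo t₁ t₂) ∧
          1 / (ε * (1 + ε)) * (∫ x in Q, sliceDensity p ε u φ t₂ x)
              - 1 / (ε * (1 + ε)) * (∫ x in Q, sliceDensity p ε u φ t₁ x)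
              + γ⁻¹ * ∫ z in Q ×ˢ Ioo t₁ t₂, energyDensity m p ε u G φ z
            ≤ γ * (1 / |ε| ^ p * ∫ z in Q ×ˢ Ioo t₁ t₂, cutoffDensity m p ε u φ z)
              + ∫ z in Q ×ˢ Ioo t₁ t₂, u z ^ (1 + ε) * timeFactor p ε φ z) ∧
        ((∀ x ∈ Q, φ (x, t₂) = 0) →
          ENNReal.ofReal (1 / |ε * (1 + ε)|) *
              essSup (fun τ => ∫⁻ x in Q, ENNReal.ofReal (sliceDensity p ε u φ τ x))
                (volume.restrict (Icc t₁ t₂))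
              + ∫⁻ z in Q ×ˢ Ioo t₁ t₂, ENNReal.ofReal (energyDensity m p ε u G φ z)
            ≤ ENNReal.ofReal γ *
              (ENNReal.ofReal (1 / |ε| ^ p) *
                  (∫⁻ z in Q ×ˢ Ioo t₁ t₂, ENNReal.ofReal (cutoffDensity m p ε u φ z))
                + ∫⁻ z in Q ×ˢ Ioo t₁ t₂,
                    ENNReal.ofReal (u z ^ (1 + ε) * max (timeFactor p ε φ z) 0))) := by
  -- `γ ≥ 2 / C₀` and `γ ≥ cutoffConst` serve the first inequality; the factor `1 + 2 / C₀` adds up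
  -- the bounds for the supremum and for the energy in the second one
  have hγ : 0 < 1 + 2 / C₀ := by positivity
  have hγ₁ : 1 ≤ 1 + 2 / C₀ := le_add_of_nonneg_right (by positivity)
  refine ⟨(1 + 2 / C₀) * max 1 (cutoffConst m p C₀ C₁),
    mul_pos hγ (one_pos.trans_le (le_max_left _ _)), ?_⟩
  intro N _ E T₁ T₂ A u G hE hA hu Q T hQ hQc hQE _ hT₁ hT₂ ε hε₁ hε₀ t₁ t₂ h₁ h₁₂ h₂ φ hφ
  have hQE' : Q ⊆ E := subset_closure.trans hQE
  obtain ⟨i1, i2, i3, i4, i5, h⟩ := energy_estimate hp hmp hC₀ hC₁ hE hA hu hQ hQE' hT₁ hT₂ hε₁ hε₀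
    h₁ h₁₂ h₂ hφ
  refine ⟨⟨i1, i2, i3, i4, i5, ?_⟩, fun hφt => sup_energy_estimate hp hmp hC₀ hC₁ hE hA hu hQ hQc
    hQE hT₁ hT₂ hε₁ hε₀ h₁ h₁₂ h₂ hφ hφt⟩
  have hpos : ∀ᵐ z ∂(volume.restrict (Q ×ˢ Ioo t₁ t₂)), 0 < u z :=
    ae_mono (Measure.restrict_mono_set _ (prod_mono hQE'
      fun t (ht : t ∈ Ioo t₁ t₂) => mem_Ioo.2 ⟨by linarith [ht.1], by linarith [ht.2]⟩)) hu.pos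
  have hEn : 0 ≤ ∫ z in Q ×ˢ Ioo t₁ t₂, energyDensity m p ε u G φ z := by
    refine integral_nonneg_of_ae ?_
    filter_upwards [hpos, ae_restrict_mem (hQ.measurableSet.prod measurableSet_Ioo)] with z hz hm
    have := hφ.nonneg z.1 z.2 ⟨h₁.trans hm.2.1.le, hm.2.2.le.trans h₂⟩
    simp only [energyDensity, Pi.zero_apply]
    positivity
  have hCut : 0 ≤ ∫ z in Q ×ˢ Ioo t₁ t₂, cutoffDensity m p ε u φ z := by
    refine integral_nonneg_of_ae ?_
    filter_upwards [hpos] with z hz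
    simp only [cutoffDensity, Pi.zero_apply]
    positivity
  have hle₁ : ((1 + 2 / C₀) * max 1 (cutoffConst m p C₀ C₁))⁻¹ ≤ C₀ / 2 := by
    rw [← inv_div 2 C₀]
    refine inv_anti₀ (by positivity) ?_
    calc 2 / C₀ ≤ (1 + 2 / C₀) * 1 := by linarith
      _ ≤ _ := by gcongr; exact le_max_left _ _
  have hle₂ : cutoffConst m p C₀ C₁ ≤ (1 + 2 / C₀) * max 1 (cutoffConst m p C₀ C₁) :=
    (le_max_right 1 _).trans
      (le_mul_of_one_le_left (zero_le_one.trans (le_max_left _ _)) hγ₁)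
  have hb₁ := mul_le_mul_of_nonneg_right hle₁ hEn
  have hb₂ := mul_le_mul_of_nonneg_right hle₂
    (mul_nonneg (show 0 ≤ 1 / |ε| ^ p by positivity) hCut)
  linarith
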